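/- Let $N\ge 1$ and let $\mu$ be a finite positive measure on $\mathbb R^N$ with compact support and finite energy, i.e. $\varphi\mapsto\int\varphi\,d\mu$ is continuous for the $H^1$ norm on $C_c^\infty(\mathbb R^N)$. For a bounded open set $U\subset\mathbb R^N$ let $u_U\in H^1_0(U)$ be the weak solution of $\Delta u_U=1-\mu$ in $U$, $u_U=0$ on $\partial U$, and let $$E(U)=E(u_U,U)=\int_U \tfrac12|\nabla u_U|^2\,dx+\int_U u_U\,dx-\int_U u_U\,d\mu .$$ Let $V(t,x)$ be a velocity field defined for $x$ in a neighbourhood of $\overline U$, continuous in $(t,x)$ and of class $C^1$ in $x$ with $D_xV$ continuous in $(t,x)$; let $T_t$ be either its flow ($\partial_tT_t(x)=V(t,T_t(x))$, $T_0(x)=x$) or the perturbation of the identity $T_t(x)=x+tV(0,x)$, and put $$dE(U,V)=\lim_{t\to0}\frac{E(T_t(U))-E(U)}{t}$$ when this limit exists. Let $\Omega\supset\operatorname{supp}\mu$ be a bounded open set and let $u$ solve Problem (P): $$\Delta u=\chi_\Omega-\mu \text{ in the sense of distributions on }\mathbb R^N,\qquad u\ge0 \text{ in }\mathbb R^N,\qquad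 u=0\text{ in }\mathbb R^N\setminus\Omega,$$ where $u\in L^1_{\rm loc}(\mathbb R^N)$ is represented by its continuous representative off $\operatorname{supp}\mu$. Then: 1. $u_U$ exists and $E(U)$ is well defined for every bounded open $U$, and $u=u_\Omega$ almost everywhere. 2. $u$ is $C^1$ off $\operatorname{supp}\mu$, and $\nabla u=0$ on the free boundary $\partial\Omega$. 3. The solution is a critical point of $E$: for all $V$ and $T_t$ as above, $dE(\Omega,V)$ exists and equals $0$. 4. Let $\Sigma$ be an open set with $C^1$ boundary and outward unit normal $n$, with $\operatorname{supp}\mu\subset\Sigma\subset\Omega$, and with $u_\Sigma\ge0$ in $\Sigma$, where $u_\Sigma$ is represented so as to be continuous on $\overline\Sigma\setminus\operatorname{supp}\mu$ and zero on $\partial\Sigma$. If the (one-sided) normal derivative $\partial u_\Sigma/\partial n$ exists and $V(0,\cdot)\cdot n=-\,\partial u_\Sigma/\partial n$ on $\partial\Sigma$, then $dE(\Sigma,V)$ exists and $dE(\Sigma,V)\le0$: $E$ is non-increasing to first order along this velocity. -/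

import Mathlib

open Set Filter Topology MeasureTheory
open scoped ContDiff

namespace QuadDomain

/-- The space `ℝ^N` with its Euclidean norm. -/
abbrev Euc (N : ℕ) : Type := EuclideanSpace ℝ (Fin N)

/-- Test functions on the open set `U`: smooth, with compact support contained in `U`. -/
def IsTest {N : ℕ} (U : Set (Euc N)) (φ : Euc N → ℝ) : Prop :=
  ContDiff ℝ ∞ φ ∧ HasCompactSupport φ ∧ tsupport φ ⊆ U

/-- `μ` has finite energy: `φ ↦ ∫ φ dμ` is continuous for the `H¹` norm, so that the term
`∫ u dμ` makes sense for `u` in `H¹`. -/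
def HasFiniteEnergy {N : ℕ} (μ : Measure (Euc N)) : Prop :=
  ∃ C : ℝ, ∀ φ : Euc N → ℝ, IsTest univ φ →
    (∫ x, φ x ∂μ) ^ 2 ≤ C * ((∫ x, φ x ^ 2) + ∫ x, ‖gradient φ x‖ ^ 2)

/-- `u` solves Problem (P) with the open set `Ω`: `Δu = χ_Ω - μ` in the sense of distributions on
`ℝ^N`, `u ≥ 0` in `ℝ^N`, `u = 0` in `ℝ^N \ Ω`.
Off the support of `μ` the Laplacian of `u` is bounded, so `u` has a continuous representative
there; it is the one that is used, so that the pointwise conditions have a meaning. -/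
structure IsSolutionP {N : ℕ} (μ : Measure (Euc N)) (Ω : Set (Euc N)) (u : Euc N → ℝ) : Prop where
  locallyIntegrable : LocallyIntegrable u volume
  equation : ∀ φ : Euc N → ℝ, IsTest univ φ →
    ∫ x, u x * Laplacian.laplacian φ x = (∫ x in Ω, φ x) - ∫ x, φ x ∂μ
  continuousOn : ContinuousOn u μ.supportᶜ
  nonneg : ∀ x, 0 ≤ u x
  eq_zero : ∀ x, x ∉ Ω → u x = 0

/-- `u ∈ H¹₀(U)` with weak gradient `G`: `(u, G)` is the limit of test functions on `U` and their
gradients in `L²`.  The convergence in `L¹(μ)` selects the representative of `u` that is determined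
`μ`-almost everywhere as well, so that `∫ u dμ` is meaningful also when `μ` is singular. -/
def MemH10 {N : ℕ} (μ : Measure (Euc N)) (U : Set (Euc N)) (u : Euc N → ℝ)
    (G : Euc N → Euc N) : Prop :=
  MemLp u 2 volume ∧ MemLp G 2 volume ∧ Integrable u μ ∧
  ∃ φ : ℕ → Euc N → ℝ, (∀ n, IsTest U (φ n)) ∧
    Tendsto (fun n => eLpNorm (fun x => φ n x - u x) 2 volume) atTop (𝓝 0) ∧
    Tendsto (fun n => eLpNorm (fun x => gradient (φ n) x - G x) 2 volume) atTop (𝓝 0) ∧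
    Tendsto (fun n => eLpNorm (fun x => φ n x - u x) 1 μ) atTop (𝓝 0)

/-- `u = u_U` (with weak gradient `G`) is the weak solution of the state equation
`Δu = 1 - μ` in `U`, `u = 0` on `∂U`. -/
def IsState {N : ℕ} (μ : Measure (Euc N)) (U : Set (Euc N)) (u : Euc N → ℝ)
    (G : Euc N → Euc N) : Prop :=
  MemH10 μ U u G ∧ ∀ φ : Euc N → ℝ, IsTest U φ →
    ∫ x in U, inner ℝ (G x) (gradient φ x) = -((∫ x in U, φ x) - ∫ x in U, φ x ∂μ)

/-- The energy `E(u, U) = ∫_U ½|∇u|² dx + ∫_U (1 - μ) u dx`, where `G = ∇u`. -/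
noncomputable def energy {N : ℕ} (μ : Measure (Euc N)) (U : Set (Euc N)) (u : Euc N → ℝ)
    (G : Euc N → Euc N) : ℝ :=
  (∫ x in U, 1 / 2 * ‖G x‖ ^ 2) + ((∫ x in U, u x) - ∫ x in U, u x ∂μ)

open Classical in
/-- The domain functional `E(U) = E(u_U, U)`. -/
noncomputable def shapeEnergy {N : ℕ} (μ : Measure (Euc N)) (U : Set (Euc N)) : ℝ :=
  if h : ∃ p : (Euc N → ℝ) × (Euc N → Euc N), IsState μ U p.1 p.2 then
    energy μ U h.choose.1 h.choose.2
  else 0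

/-- A velocity field `V(t, x)` on the open set `D`: continuous in `(t, x)`, of class `C¹` in `x`,
with a space derivative that is continuous in `(t, x)`. -/
structure IsVelocityField {N : ℕ} (D : Set (Euc N)) (V : ℝ → Euc N → Euc N) : Prop where
  continuousOn : ContinuousOn (fun p : ℝ × Euc N => V p.1 p.2) (univ ×ˢ D)
  contDiffOn : ∀ t, ContDiffOn ℝ 1 (V t) D
  continuousOn_fderiv :
    ContinuousOn (fun p : ℝ × Euc N => fderiv ℝ (V p.1) p.2) (univ ×ˢ D)

/-- `X(t, x) = T_t(V) x`, for `x ∈ S` and small `|t|`, is the flow of `V` inside `D`. -/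
def IsFlow {N : ℕ} (D : Set (Euc N)) (V : ℝ → Euc N → Euc N) (S : Set (Euc N))
    (X : ℝ → Euc N → Euc N) : Prop :=
  ∃ ε : ℝ, 0 < ε ∧ ∀ x ∈ S, X 0 x = x ∧
    ∀ t ∈ Ioo (-ε) ε, X t x ∈ D ∧ HasDerivAt (fun s => X s x) (V t (X t x)) t

/-- `X(t, x) = T_t(V) x` for `x ∈ S`, where `T_t(V)` is the flow of `V` or the perturbation of the
identity `I + t V(0, ·)`. -/
def IsDeformation {N : ℕ} (D : Set (Euc N)) (V : ℝ → Euc N → Euc N) (S : Set (Euc N))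
    (X : ℝ → Euc N → Euc N) : Prop :=
  IsFlow D V S X ∨ ∀ x ∈ S, ∀ t : ℝ, X t x = x + t • V 0 x

/-- `dJ = d` at `S` along the deformation `X`: the limit of `(J(S_t) - J(S)) / t` as `t → 0` exists
and equals `d`, where `S_t = X(t, S)` (and `S_0 = S`, since `X(0, ·)` is the identity on `S`). -/
def HasShapeDeriv {N : ℕ} (J : Set (Euc N) → ℝ) (S : Set (Euc N)) (X : ℝ → Euc N → Euc N)
    (d : ℝ) : Prop :=
  HasDerivAt (fun t : ℝ => J (X t '' S)) d 0

/-- Near its boundary point `x` the set `S` is `{ψ < 0}` for a `C¹` function `ψ` with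
`∇ψ(x) ≠ 0`, and `ν = ∇ψ(x) / |∇ψ(x)|` is the outward unit normal at `x`. -/
def IsOutwardNormal {N : ℕ} (S : Set (Euc N)) (x ν : Euc N) : Prop :=
  ∃ (W : Set (Euc N)) (ψ : Euc N → ℝ), IsOpen W ∧ x ∈ W ∧ ContDiffOn ℝ 1 ψ W ∧
    ψ x = 0 ∧ gradient ψ x ≠ 0 ∧ (∀ y ∈ W, y ∈ S ↔ ψ y < 0) ∧
    ν = ‖gradient ψ x‖⁻¹ • gradient ψ x

/-- The open set `S` has a `C¹` boundary (and lies locally on one side of it). -/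
def HasC1Boundary {N : ℕ} (S : Set (Euc N)) : Prop :=
  ∀ x ∈ frontier S, ∃ ν, IsOutwardNormal S x ν

/-- `∂u/∂ν (x) = d`, the derivative of `u` in direction `ν` at the boundary point `x` being taken
from inside the domain. -/
def HasNormalDeriv {N : ℕ} (u : Euc N → ℝ) (x ν : Euc N) (d : ℝ) : Prop :=
  HasDerivWithinAt (fun s : ℝ => u (x + s • ν)) d (Iic 0) 0

end QuadDomain

/-! The state of `U` is the minimiser of `E(·, U)` over `H¹₀(U)`, and completing the square gives
`E(w, U) = E(U) + ½ ∫_U |∇w - ∇u_U|²` (`IsState.energy_eq_add`). It is obtained from a minimising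
sequence of test functions, which the parallelogram identity makes Cauchy; Poincaré's inequality and
the finite energy of `μ` control the linear term (`exists_isState`).

The core is `hasDerivAt_shapeEnergy`: the domain functional is differentiable for an arbitrary
bounded open `U`, with no regularity of the boundary and without differentiating `t ↦ u_t`.
Competitors are carried between `U` and its image by the change of variables `x ↦ x + R x`. If `ψ`
is the pull-back of `φ` and `D = ∫_U |∇ψ - ∇u_U|²`, then the energy of `φ` is `E(U) + D/2 + t ·
shapeGrad` up to an error of size `|t| (C √D + C D + o(1))`. Pushing forward approximations of `u_U`
bounds the new energy from above. Pulling back approximations of the new state bounds it from below,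
since the term `D/2` absorbs `C |t| √D` at the cost `O(t²)`.

Only the motion of the boundary counts: changing a deformation on a compact subset of `U` does not
change the image of `U` (`image_id_add_subset`). So the field may be cut off near the support of
`μ`, where the load would otherwise move. The flow and the perturbation of the identity enter only
through their common expansion `id + t V(0, ·) + o(t)` in the Lipschitz norm (`HasExpansion`).

For a solution of (P), `u` belongs to `H¹₀(Ω)` for any open `Ω`: `u` is continuous and zero at the
boundary, so cutting off the small values of a mollification of `u` gives test functions on `Ω`
(`IsSolutionP.exists_test_approx`). An interior gradient estimate makes `u` of class `C¹` off the
support of `μ`, and points outside `Ω` are minima of `u ≥ 0`, hence critical. Pohozaev's identity,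
applied to mollifications, turns the first variation into the limit of `-∫ ⟨Y, ∇u⟩ (1 - Δu)`. This
vanishes because `Δu = 1` on the part of `Ω` that `Y` sees and `∇u = 0` outside `Ω`
(`IsSolutionP.shapeGrad_eq_zero`).

For the descent statement no boundary integral is computed. A nonnegative state has nonpositive
outward normal derivative, so `V · n ≥ 0`. Adding a small multiple of a strictly outward field makes
the domains grow, and `E` decreases under inclusion (`shapeEnergy_anti`). Since the first variation
is linear in the field, the perturbation can be sent to zero. -/

namespace QuadDomain

/-! ### Cauchy–Schwarz and limits of integrals in `L²` -/

section L2

variable {α : Type*} [MeasurableSpace α] {ν : Measure α}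
  {E : Type*} [NormedAddCommGroup E] [InnerProductSpace ℝ E]

lemma integrable_inner_of_memLp {f g : α → E} (hf : MemLp f 2 ν) (hg : MemLp g 2 ν) :
    Integrable (fun x => inner ℝ (f x) (g x)) ν := by
  refine (L2.integrable_inner (𝕜 := ℝ) (hf.toLp f) (hg.toLp g)).congr ?_
  filter_upwards [hf.coeFn_toLp, hg.coeFn_toLp] with x h1 h2
  rw [h1, h2]

lemma inner_toLp {f g : α → E} (hf : MemLp f 2 ν) (hg : MemLp g 2 ν) :
    inner ℝ (hf.toLp f) (hg.toLp g) = ∫ x, inner ℝ (f x) (g x) ∂ν := by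
  rw [L2.inner_def]
  refine integral_congr_ae ?_
  filter_upwards [hf.coeFn_toLp, hg.coeFn_toLp] with x h1 h2
  rw [h1, h2]

lemma integrable_norm_sq_of_memLp {f : α → E} (hf : MemLp f 2 ν) :
    Integrable (fun x => ‖f x‖ ^ 2) ν := by
  simpa only [real_inner_self_eq_norm_sq] using integrable_inner_of_memLp hf hf

lemma norm_toLp_sq {f : α → E} (hf : MemLp f 2 ν) :
    ‖hf.toLp f‖ ^ 2 = ∫ x, ‖f x‖ ^ 2 ∂ν := by
  rw [← real_inner_self_eq_norm_sq, inner_toLp]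
  simp only [real_inner_self_eq_norm_sq]

lemma sq_integral_inner_le {f g : α → E} (hf : MemLp f 2 ν) (hg : MemLp g 2 ν) :
    (∫ x, inner ℝ (f x) (g x) ∂ν) ^ 2 ≤ (∫ x, ‖f x‖ ^ 2 ∂ν) * ∫ x, ‖g x‖ ^ 2 ∂ν := by
  rw [← inner_toLp hf hg, ← norm_toLp_sq hf, ← norm_toLp_sq hg, ← mul_pow]
  exact sq_le_sq' (neg_le_of_abs_le (abs_real_inner_le_norm _ _)) (real_inner_le_norm _ _)

lemma toReal_eLpNorm_two_sq {f : α → E} (hf : MemLp f 2 ν) :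
    (eLpNorm f 2 ν).toReal ^ 2 = ∫ x, ‖f x‖ ^ 2 ∂ν := by
  rw [← norm_toLp_sq hf, Lp.norm_toLp]

lemma tendsto_eLpNorm_two_iff {ι : Type*} {l : Filter ι} {f : ι → α → E}
    (hf : ∀ n, MemLp (f n) 2 ν) :
    Tendsto (fun n => eLpNorm (f n) 2 ν) l (𝓝 0) ↔
      Tendsto (fun n => ∫ x, ‖f n x‖ ^ 2 ∂ν) l (𝓝 0) := by
  have h1 : Tendsto (fun n => eLpNorm (f n) 2 ν) l (𝓝 0) ↔
      Tendsto (fun n => (eLpNorm (f n) 2 ν).toReal) l (𝓝 0) := by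
    rw [← ENNReal.toReal_zero]
    exact (ENNReal.tendsto_toReal_iff (fun n => (hf n).2.ne) ENNReal.zero_ne_top).symm
  rw [h1]
  simp only [← toReal_eLpNorm_two_sq (hf _)]
  constructor
  · intro h
    simpa using h.pow 2
  · intro h
    have := h.sqrt
    simpa [Real.sqrt_sq] using this

lemma tendsto_integral_inner {ι : Type*} {l : Filter ι} {f g : ι → α → E} {f₀ g₀ : α → E}
    (hf : ∀ n, MemLp (f n) 2 ν) (hg : ∀ n, MemLp (g n) 2 ν) (hf₀ : MemLp f₀ 2 ν)
    (hg₀ : MemLp g₀ 2 ν)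
    (hfl : Tendsto (fun n => eLpNorm (fun x => f n x - f₀ x) 2 ν) l (𝓝 0))
    (hgl : Tendsto (fun n => eLpNorm (fun x => g n x - g₀ x) 2 ν) l (𝓝 0)) :
    Tendsto (fun n => ∫ x, inner ℝ (f n x) (g n x) ∂ν) l (𝓝 (∫ x, inner ℝ (f₀ x) (g₀ x) ∂ν)) := by
  have h1 := (Lp.tendsto_Lp_iff_tendsto_eLpNorm'' f hf f₀ hf₀).2 hfl
  have h2 := (Lp.tendsto_Lp_iff_tendsto_eLpNorm'' g hg g₀ hg₀).2 hgl
  have h3 := h1.inner (𝕜 := ℝ) h2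
  simpa only [inner_toLp] using h3

lemma sq_setIntegral_le {U : Set α} (hU : ν U ≠ ⊤) {f : α → ℝ} (hf : MemLp f 2 (ν.restrict U)) :
    (∫ x in U, f x ∂ν) ^ 2 ≤ (ν U).toReal * ∫ x in U, f x ^ 2 ∂ν := by
  have : IsFiniteMeasure (ν.restrict U) := ⟨by simpa using hU.lt_top⟩
  have h := sq_integral_inner_le (memLp_const (1 : ℝ)) hf
  simp only [Real.norm_eq_abs, sq_abs, one_pow] at h
  have e : ∀ x, inner ℝ (1 : ℝ) (f x) = f x := fun x => by simp
  simp only [e] at h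
  simpa [Measure.real] using h

lemma tendsto_setIntegral_of_eLpNorm_two {U : Set α} (hU : ν U ≠ ⊤) {f : ℕ → α → ℝ} {f₀ : α → ℝ}
    (hf : ∀ n, MemLp (f n) 2 ν) (hf₀ : MemLp f₀ 2 ν)
    (hfl : Tendsto (fun n => eLpNorm (fun x => f n x - f₀ x) 2 ν) atTop (𝓝 0)) :
    Tendsto (fun n => ∫ x in U, f n x ∂ν) atTop (𝓝 (∫ x in U, f₀ x ∂ν)) := by
  have : IsFiniteMeasure (ν.restrict U) := ⟨by simpa using hU.lt_top⟩
  have h1 : Tendsto (fun n => eLpNorm (fun x => f n x - f₀ x) 2 (ν.restrict U)) atTop (𝓝 0) :=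
    tendsto_of_tendsto_of_tendsto_of_le_of_le tendsto_const_nhds hfl (fun _ => zero_le)
      (fun n => eLpNorm_mono_measure _ Measure.restrict_le_self)
  have h := tendsto_integral_inner (ν := ν.restrict U) (f := fun n x => (1 : ℝ)) (g := f)
    (f₀ := fun _ => 1) (g₀ := f₀) (l := atTop) (fun _ => memLp_const _) (fun n => (hf n).restrict U)
    (memLp_const _) (hf₀.restrict U) (by simp) h1
  have e : ∀ y : ℝ, inner ℝ (1 : ℝ) y = y := fun x => by simp
  simpa only [e] using h

end L2

/-! ### Calculus of gradients -/

section Gradient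

variable {N : ℕ} {f g : Euc N → ℝ} {x : Euc N}

lemma inner_gradient (f : Euc N → ℝ) (x e : Euc N) :
    inner ℝ (gradient f x) e = fderiv ℝ f x e := inner_gradient_left

lemma norm_gradient (f : Euc N → ℝ) (x : Euc N) : ‖gradient f x‖ = ‖fderiv ℝ f x‖ := by
  rw [gradient, LinearIsometryEquiv.norm_map]

lemma gradient_add' (hf : DifferentiableAt ℝ f x) (hg : DifferentiableAt ℝ g x) :
    gradient (fun y => f y + g y) x = gradient f x + gradient g x := by
  simp only [gradient]
  rw [fderiv_fun_add hf hg, map_add]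

lemma gradient_sub' (hf : DifferentiableAt ℝ f x) (hg : DifferentiableAt ℝ g x) :
    gradient (fun y => f y - g y) x = gradient f x - gradient g x := by
  simp only [gradient]
  rw [fderiv_fun_sub hf hg, map_sub]

lemma gradient_const_mul' (hf : DifferentiableAt ℝ f x) (c : ℝ) :
    gradient (fun y => c * f y) x = c • gradient f x := by
  simp only [gradient]
  rw [fderiv_const_mul hf, map_smul]

lemma gradient_comp' {F : ℝ → ℝ} (hF : DifferentiableAt ℝ F (f x)) (hf : DifferentiableAt ℝ f x) :
    gradient (fun y => F (f y)) x = deriv F (f x) • gradient f x := by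
  have := (hF.hasDerivAt.comp_hasFDerivAt x hf.hasFDerivAt).fderiv
  simp only [gradient]
  rw [show (fun y => F (f y)) = F ∘ f from rfl, this, map_smul]

end Gradient

/-! ### Test functions -/

section Test

variable {N : ℕ} {U : Set (Euc N)} {φ ψ : Euc N → ℝ}

lemma IsTest.mono {W : Set (Euc N)} (h : IsTest U φ) (hUW : U ⊆ W) : IsTest W φ :=
  ⟨h.1, h.2.1, h.2.2.trans hUW⟩

lemma IsTest.univ (h : IsTest U φ) : IsTest univ φ := h.mono (subset_univ _)

lemma IsTest.differentiable (h : IsTest U φ) : Differentiable ℝ φ := h.1.differentiable (by simp)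

lemma IsTest.add (h : IsTest U φ) (h' : IsTest U ψ) : IsTest U (fun x => φ x + ψ x) :=
  ⟨h.1.add h'.1, h.2.1.add h'.2.1, (tsupport_add _ _).trans (union_subset h.2.2 h'.2.2)⟩

lemma IsTest.const_mul (h : IsTest U φ) (c : ℝ) : IsTest U (fun x => c * φ x) :=
  ⟨contDiff_const.mul h.1, h.2.1.mul_left, (tsupport_mul_subset_right).trans h.2.2⟩

lemma IsTest.sub (h : IsTest U φ) (h' : IsTest U ψ) : IsTest U (fun x => φ x - ψ x) := by
  have := h.add (h'.const_mul (-1))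
  simpa [sub_eq_add_neg] using this

lemma isTest_zero : IsTest U (fun _ => (0 : ℝ)) := by
  refine ⟨contDiff_const, ?_, ?_⟩
  · exact HasCompactSupport.zero
  · simp [tsupport, Function.support]

lemma IsTest.continuous (h : IsTest U φ) : Continuous φ := h.1.continuous

lemma IsTest.continuous_fderiv (h : IsTest U φ) : Continuous (fderiv ℝ φ) :=
  h.1.continuous_fderiv (by simp)

lemma IsTest.continuous_gradient (h : IsTest U φ) : Continuous (gradient φ) :=
  (LinearIsometryEquiv.continuous _).comp h.continuous_fderiv

lemma tsupport_gradient_subset (φ : Euc N → ℝ) : tsupport (gradient φ) ⊆ tsupport φ := by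
  refine closure_minimal (fun x hx => ?_) (isClosed_tsupport φ)
  by_contra h
  refine hx ?_
  simp only [gradient]
  rw [fderiv_of_notMem_tsupport (𝕜 := ℝ) h, map_zero]

lemma IsTest.hasCompactSupport_gradient (h : IsTest U φ) : HasCompactSupport (gradient φ) :=
  h.2.1.mono' (subset_closure.trans (tsupport_gradient_subset φ))

lemma IsTest.memLp (h : IsTest U φ) (p : ENNReal) (ν : Measure (Euc N))
    [IsFiniteMeasureOnCompacts ν] : MemLp φ p ν :=
  h.continuous.memLp_of_hasCompactSupport h.2.1

lemma IsTest.memLp_gradient (h : IsTest U φ) (p : ENNReal) (ν : Measure (Euc N))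
    [IsFiniteMeasureOnCompacts ν] : MemLp (gradient φ) p ν :=
  h.continuous_gradient.memLp_of_hasCompactSupport h.hasCompactSupport_gradient

lemma IsTest.integrable (h : IsTest U φ) (ν : Measure (Euc N))
    [IsFiniteMeasureOnCompacts ν] : Integrable φ ν :=
  h.continuous.integrable_of_hasCompactSupport h.2.1

lemma IsTest.setIntegral_eq (h : IsTest U φ) (ν : Measure (Euc N)) :
    ∫ x in U, φ x ∂ν = ∫ x, φ x ∂ν :=
  setIntegral_eq_integral_of_forall_compl_eq_zero fun _ hx =>
    image_eq_zero_of_notMem_tsupport fun h' => hx (h.2.2 h')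

lemma IsTest.gradient_eq_zero (h : IsTest U φ) {x : Euc N} (hx : x ∉ U) : gradient φ x = 0 :=
  image_eq_zero_of_notMem_tsupport fun h' => hx (h.2.2 (tsupport_gradient_subset φ h'))

end Test

/-! ### Poincaré's inequality and finite energy -/

section Poincare

variable {N : ℕ}

/-- Integrating `φ²` by parts against a linear coordinate `ℓ`, whose derivative is `1`, gives `∫ φ²
= -2 ∫ ℓ φ ∂φ`. Cauchy–Schwarz and `|ℓ| ≤ R` on `U` do the rest, with constant `(2R)²`. A unit
vector, hence a coordinate, exists because `1 ≤ N`. -/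
lemma poincare_test (hN : 1 ≤ N) {U : Set (Euc N)} {R : ℝ} (hU : ∀ x ∈ U, ‖x‖ ≤ R)
    {φ : Euc N → ℝ} (h : IsTest U φ) :
    ∫ x, φ x ^ 2 ≤ 4 * R ^ 2 * ∫ x, ‖gradient φ x‖ ^ 2 := by
  obtain ⟨e, hne⟩ : ∃ e : Euc N, ‖e‖ = 1 := ⟨EuclideanSpace.single ⟨0, hN⟩ 1, by simp⟩
  obtain ⟨ℓ, hℓ⟩ : ∃ ℓ : Euc N →L[ℝ] ℝ, ∀ x, ℓ x = inner ℝ e x := ⟨innerSL ℝ e, fun x => rfl⟩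
  have hℓe : ℓ e = 1 := by simp [hℓ, hne]
  have hcℓ := ℓ.continuous
  have hcφ := h.continuous
  have hcs : HasCompactSupport φ := h.2.1
  have hφ2 : Continuous (fun x => φ x * φ x) := h.continuous.mul h.continuous
  have hd2 : ∀ x, fderiv ℝ (fun x => φ x * φ x) x e = 2 * φ x * fderiv ℝ φ x e := fun x => by
    rw [fderiv_fun_mul (h.differentiable x) (h.differentiable x)]
    simp; ring
  have hcd : Continuous (fun x => fderiv ℝ φ x e) := h.continuous_fderiv.clm_apply continuous_const
  have key := integral_mul_fderiv_eq_neg_fderiv_mul_of_integrable (μ := (volume : Measure (Euc N)))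
    (f := fun x => ℓ x) (g := fun x => φ x * φ x) (v := e) ?_ ?_ ?_ ?_ ?_
  rotate_left
  · refine Continuous.integrable_of_hasCompactSupport ?_ (hcs.mul_left.mul_left)
    simp only [ContinuousLinearMap.fderiv]
    fun_prop
  · simp only [hd2]
    refine Continuous.integrable_of_hasCompactSupport (by fun_prop) ?_
    exact HasCompactSupport.mul_left (HasCompactSupport.mul_right hcs.mul_left)
  · exact Continuous.integrable_of_hasCompactSupport (by fun_prop) (hcs.mul_left.mul_left)
  · exact fun x _ => ℓ.differentiableAt
  · exact fun x _ => (h.differentiable x).mul (h.differentiable x)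
  simp only [hd2, ContinuousLinearMap.fderiv, hℓe, one_mul] at key
  have hA : MemLp (fun x => ℓ x * φ x) 2 (volume : Measure (Euc N)) :=
    Continuous.memLp_of_hasCompactSupport (by fun_prop) hcs.mul_left
  have hB : MemLp (fun x => fderiv ℝ φ x e) 2 (volume : Measure (Euc N)) :=
    Continuous.memLp_of_hasCompactSupport hcd (hcs.fderiv_apply ℝ e)
  have cs := sq_integral_inner_le hA hB
  have e1 : ∫ x, inner ℝ (ℓ x * φ x) (fderiv ℝ φ x e) = -(1 / 2) * ∫ x, φ x ^ 2 := by
    have : (∫ x, φ x ^ 2) = ∫ x, φ x * φ x := by simp only [sq]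
    rw [this, ← neg_eq_iff_eq_neg.2 key, ← integral_neg, ← integral_const_mul]
    refine integral_congr_ae (Eventually.of_forall fun x => ?_)
    simp; ring
  have hint2 : Integrable (fun x => φ x ^ 2) := by
    simpa using integrable_norm_sq_of_memLp (h.memLp 2 volume)
  have e2 : ∫ x, ‖ℓ x * φ x‖ ^ 2 ≤ R ^ 2 * ∫ x, φ x ^ 2 := by
    rw [← integral_const_mul]
    refine integral_mono (integrable_norm_sq_of_memLp hA) (hint2.const_mul _) fun x => ?_
    by_cases hx : x ∈ U
    · have : |ℓ x| ≤ R := by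
        have := abs_real_inner_le_norm e x
        rw [hne, one_mul, ← hℓ] at this
        exact this.trans (hU x hx)
      simp only [norm_mul, Real.norm_eq_abs, mul_pow, sq_abs]
      have h3 : (ℓ x) ^ 2 ≤ R ^ 2 := sq_le_sq' (neg_le_of_abs_le this) (le_of_abs_le this)
      exact mul_le_mul_of_nonneg_right h3 (sq_nonneg _)
    · have : φ x = 0 := image_eq_zero_of_notMem_tsupport fun h' => hx (h.2.2 h')
      simp [this]
  have e3 : ∫ x, ‖fderiv ℝ φ x e‖ ^ 2 ≤ ∫ x, ‖gradient φ x‖ ^ 2 := by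
    refine integral_mono (integrable_norm_sq_of_memLp hB)
      (integrable_norm_sq_of_memLp (h.memLp_gradient 2 volume)) fun x => ?_
    have := (fderiv ℝ φ x).le_opNorm e
    rw [hne, mul_one, ← norm_gradient] at this
    exact pow_le_pow_left₀ (norm_nonneg _) this 2
  rw [e1] at cs
  have n1 : 0 ≤ ∫ x, φ x ^ 2 := integral_nonneg fun _ => sq_nonneg _
  have n2 : 0 ≤ ∫ x, ‖gradient φ x‖ ^ 2 := integral_nonneg fun _ => sq_nonneg _
  have n3 : 0 ≤ ∫ x, ‖fderiv ℝ φ x e‖ ^ 2 := integral_nonneg fun _ => sq_nonneg _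
  generalize (∫ x, φ x ^ 2) = A at *
  generalize (∫ x, ‖gradient φ x‖ ^ 2) = B at *
  -- Cauchy–Schwarz yields `A² / 4 ≤ R² A B`, and a factor `A = ∫ φ²` has to be cancelled.
  rcases n1.eq_or_lt with h0 | h0
  · rw [← h0]; exact mul_nonneg (by positivity) n2
  · have := cs.trans (mul_le_mul e2 e3 n3 (mul_nonneg (sq_nonneg _) n1))
    refine le_of_mul_le_mul_left ?_ h0
    linarith

/-- `|φ|` is not a test function, but `√(φ² + δ²) - δ` is one. It is dominated by `|φ|`, its
gradient is dominated by that of `φ`, and it tends to `|φ|` as `δ → 0`. This strengthening is what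
turns gradient bounds into `L¹(μ)` bounds. -/
lemma HasFiniteEnergy.abs {μ : Measure (Euc N)} [IsFiniteMeasure μ] (hμ : HasFiniteEnergy μ) :
    ∃ C : ℝ, 0 ≤ C ∧ ∀ φ : Euc N → ℝ, IsTest univ φ →
      (∫ x, |φ x| ∂μ) ^ 2 ≤ C * ((∫ x, φ x ^ 2) + ∫ x, ‖gradient φ x‖ ^ 2) := by
  obtain ⟨C, hC⟩ := hμ
  refine ⟨max C 0, le_max_right _ _, fun φ h => ?_⟩
  set δ : ℕ → ℝ := fun n => 1 / ((n : ℝ) + 1)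
  have hδ : ∀ n, 0 < δ n := fun n => by positivity
  have hδ0 : Tendsto δ atTop (𝓝 0) := tendsto_one_div_add_atTop_nhds_zero_nat
  set ψ : ℕ → Euc N → ℝ := fun n x => Real.sqrt (φ x ^ 2 + δ n ^ 2) - δ n with hψ
  have hpos : ∀ n x, 0 < φ x ^ 2 + δ n ^ 2 := fun n x =>
    add_pos_of_nonneg_of_pos (sq_nonneg _) (pow_pos (hδ n) 2)
  have hsq : ∀ n, Real.sqrt (δ n ^ 2) = δ n := fun n => Real.sqrt_sq (hδ n).le
  have hle : ∀ n x, |ψ n x| ≤ |φ x| := fun n x => by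
    have h1 : δ n ≤ Real.sqrt (φ x ^ 2 + δ n ^ 2) := by
      rw [← hsq n]; exact Real.sqrt_le_sqrt (by rw [hsq]; nlinarith [sq_nonneg (φ x)])
    have h2 : Real.sqrt (φ x ^ 2 + δ n ^ 2) ≤ |φ x| + δ n := by
      rw [Real.sqrt_le_left (by have := hδ n; positivity)]
      nlinarith [sq_abs (φ x), mul_nonneg (abs_nonneg (φ x)) (hδ n).le]
    rw [abs_le]; constructor
    · have := abs_nonneg (φ x); simp only [hψ]; linarith
    · simp only [hψ]; linarith
  have hts : ∀ n, IsTest univ (ψ n) := fun n => by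
    refine ⟨?_, ?_, subset_univ _⟩
    · exact (((h.1.pow 2).add contDiff_const).sqrt fun x => (hpos n x).ne').sub contDiff_const
    · refine h.2.1.mono fun x hx => ?_
      intro h0
      have := hle n x
      rw [h0, abs_zero] at this
      exact hx (abs_nonpos_iff.1 this)
  have hgr : ∀ n x, ‖gradient (ψ n) x‖ ≤ ‖gradient φ x‖ := fun n x => by
    have hd : HasDerivAt (fun s : ℝ => Real.sqrt (s ^ 2 + δ n ^ 2) - δ n)
        ((2 * φ x) / (2 * Real.sqrt (φ x ^ 2 + δ n ^ 2))) (φ x) := by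
      have := (((hasDerivAt_pow 2 (φ x)).add_const (δ n ^ 2)).sqrt (hpos n x).ne').sub_const (δ n)
      simpa using this
    have := gradient_comp' (f := φ) (x := x) hd.differentiableAt (h.differentiable x)
    rw [hd.deriv] at this
    simp only [hψ]
    rw [this, norm_smul]
    refine mul_le_of_le_one_left (norm_nonneg _) ?_
    rw [mul_div_mul_left _ _ two_ne_zero, Real.norm_eq_abs, abs_div, abs_of_nonneg (Real.sqrt_nonneg _)]
    refine div_le_one_of_le₀ ?_ (Real.sqrt_nonneg _)
    rw [← Real.sqrt_sq_eq_abs]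
    exact Real.sqrt_le_sqrt (by nlinarith [sq_nonneg (δ n)])
  have hb : ∀ n, (∫ x, ψ n x ∂μ) ^ 2 ≤
      max C 0 * ((∫ x, φ x ^ 2) + ∫ x, ‖gradient φ x‖ ^ 2) := fun n => by
    refine (hC (ψ n) (hts n)).trans ?_
    refine mul_le_mul (le_max_left _ _) (add_le_add ?_ ?_)
      (add_nonneg (integral_nonneg fun _ => sq_nonneg _) (integral_nonneg fun _ => sq_nonneg _))
      (le_max_right _ _)
    · refine integral_mono ?_ ?_ fun x => sq_le_sq.2 (hle n x)
      · simpa using integrable_norm_sq_of_memLp ((hts n).memLp 2 volume)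
      · simpa using integrable_norm_sq_of_memLp (h.memLp 2 volume)
    · refine integral_mono (integrable_norm_sq_of_memLp ((hts n).memLp_gradient 2 volume))
        (integrable_norm_sq_of_memLp (h.memLp_gradient 2 volume)) fun x => ?_
      exact pow_le_pow_left₀ (norm_nonneg _) (hgr n x) 2
  have hlim : Tendsto (fun n => ∫ x, ψ n x ∂μ) atTop (𝓝 (∫ x, |φ x| ∂μ)) := by
    refine tendsto_integral_of_dominated_convergence (fun x => |φ x|)
      (fun n => (hts n).continuous.aestronglyMeasurable) (h.integrable μ).abs
      (fun n => Eventually.of_forall fun x => hle n x) (Eventually.of_forall fun x => ?_)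
    have : Tendsto (fun n => Real.sqrt (φ x ^ 2 + δ n ^ 2) - δ n) atTop
        (𝓝 (Real.sqrt (φ x ^ 2 + 0 ^ 2) - 0)) :=
      ((tendsto_const_nhds.add (hδ0.pow 2)).sqrt).sub hδ0
    simpa [Real.sqrt_sq_eq_abs] using this
  exact le_of_tendsto' (hlim.pow 2) hb

end Poincare

/-- The projection argument in a Hilbert space, made abstract. Near-minimisers over a decreasing
sequence of midpoint-stable sets are Cauchy: two of them lie in a common `S n₀`, so does their
midpoint, and the infima over the `S n` increase to a finite limit. With a constant sequence it
produces the state. With shrinking `L¹` neighbourhoods it replaces weak compactness when the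
solution of (P) is placed in `H¹₀`. -/
lemma exists_cauchy_minimizing {E : Type*} {S : ℕ → Set E} (hanti : Antitone S) {mid : E → E → E}
    (hmid : ∀ n, ∀ a ∈ S n, ∀ b ∈ S n, mid a b ∈ S n) {F : E → ℝ} {d : E → E → ℝ}
    (hd : ∀ a ∈ S 0, ∀ b ∈ S 0, d a b ≤ F a + F b - 2 * F (mid a b)) {m M : ℝ}
    (hlow : ∀ a ∈ S 0, m ≤ F a) (hup : ∀ n, ∃ a ∈ S n, F a ≤ M) :
    ∃ w : ℕ → E, (∀ n, w n ∈ S n) ∧ (∀ n : ℕ, ∀ a ∈ S n, F (w n) ≤ F a + 1 / ((n : ℝ) + 1)) ∧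
      ∀ ε > 0, ∃ n₀, ∀ i ≥ n₀, ∀ j ≥ n₀, d (w i) (w j) ≤ ε := by
  have hne : ∀ n, (F '' S n).Nonempty := fun n => by
    obtain ⟨a, ha, -⟩ := hup n
    exact ⟨F a, a, ha, rfl⟩
  have hbdd : ∀ n, BddBelow (F '' S n) := fun n =>
    ⟨m, by rintro _ ⟨a, ha, rfl⟩; exact hlow a (hanti (Nat.zero_le n) ha)⟩
  set I : ℕ → ℝ := fun n => sInf (F '' S n) with hI
  have hle : ∀ n, ∀ a ∈ S n, I n ≤ F a := fun n a ha => csInf_le (hbdd n) ⟨a, ha, rfl⟩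
  have hImono : Monotone I := fun i j hij =>
    csInf_le_csInf (hbdd i) (hne j) (image_mono (hanti hij))
  have hIM : ∀ n, I n ≤ M := fun n => by
    obtain ⟨a, ha, h⟩ := hup n
    exact (hle n a ha).trans h
  have hlim := tendsto_atTop_ciSup hImono ⟨M, by rintro _ ⟨n, rfl⟩; exact hIM n⟩
  set L := ⨆ n, I n
  have hIL : ∀ n, I n ≤ L := fun n => le_ciSup (f := I) ⟨M, by rintro _ ⟨n, rfl⟩; exact hIM n⟩ n
  have hw : ∀ n : ℕ, ∃ a ∈ S n, F a < I n + 1 / ((n : ℝ) + 1) := fun n => by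
    obtain ⟨_, ⟨a, ha, rfl⟩, h⟩ := Real.lt_sInf_add_pos (hne n)
      (show (0 : ℝ) < 1 / ((n : ℝ) + 1) by positivity)
    exact ⟨a, ha, h⟩
  choose w hwS hwF using hw
  refine ⟨w, hwS, fun n a ha => (hwF n).le.trans (by linarith [hle n a ha]), fun ε hε => ?_⟩
  have hev : Tendsto (fun n : ℕ => 2 * (L - I n) + 2 * (1 / ((n : ℝ) + 1))) atTop (𝓝 0) := by
    have := ((tendsto_const_nhds (x := L)).sub hlim).const_mul 2 |>.add
      ((tendsto_one_div_add_atTop_nhds_zero_nat (𝕜 := ℝ)).const_mul 2)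
    simpa using this
  obtain ⟨n₀, hn₀⟩ := (hev.eventually (gt_mem_nhds hε)).exists
  refine ⟨n₀, fun i hi j hj => ?_⟩
  have h1 : ∀ k ≥ n₀, F (w k) ≤ L + 1 / ((n₀ : ℝ) + 1) := fun k hk => by
    have h2 : 1 / ((k : ℝ) + 1) ≤ 1 / ((n₀ : ℝ) + 1) :=
      one_div_le_one_div_of_le (by positivity) (by exact_mod_cast Nat.succ_le_succ hk)
    linarith [hwF k, hIL k]
  have h3 := hle n₀ _ (hmid n₀ _ (hanti hi (hwS i)) _ (hanti hj (hwS j)))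
  have h4 := hd _ (hanti (Nat.zero_le i) (hwS i)) _ (hanti (Nat.zero_le j) (hwS j))
  linarith [h1 i hi, h1 j hj]

/-! ### Completeness, and limits of test functions in `H¹₀` -/

section Cauchy

variable {α : Type*} [MeasurableSpace α] {ν : Measure α}
  {E : Type*} [NormedAddCommGroup E]

lemma exists_limit_of_cauchy [CompleteSpace E] {p : ENNReal} [Fact (1 ≤ p)] {f : ℕ → α → E}
    (hf : ∀ n, MemLp (f n) p ν)
    (hc : ∀ ε > 0, ∃ n₀, ∀ i ≥ n₀, ∀ j ≥ n₀, (eLpNorm (fun x => f i x - f j x) p ν).toReal ≤ ε) :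
    ∃ g, MemLp g p ν ∧ Tendsto (fun n => eLpNorm (fun x => f n x - g x) p ν) atTop (𝓝 0) := by
  have hcs : CauchySeq (fun n => (hf n).toLp (f n)) := by
    refine Metric.cauchySeq_iff.2 fun ε hε => ?_
    obtain ⟨n₀, h⟩ := hc (ε / 2) (half_pos hε)
    refine ⟨n₀, fun i hi j hj => ?_⟩
    rw [dist_eq_norm, ← MemLp.toLp_sub, Lp.norm_toLp]
    exact (h i hi j hj).trans_lt (half_lt_self hε)
  obtain ⟨g, hg⟩ := cauchySeq_tendsto_of_complete hcs
  refine ⟨g, Lp.memLp g, ?_⟩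
  exact (Lp.tendsto_Lp_iff_tendsto_eLpNorm'' (fi := atTop) f hf g (Lp.memLp g)).1
    (by rwa [Lp.toLp_coeFn])

lemma toReal_eLpNorm_one {f : α → ℝ} (hf : Integrable f ν) :
    (eLpNorm f 1 ν).toReal = ∫ x, |f x| ∂ν := by
  rw [eLpNorm_one_eq_lintegral_enorm, ← integral_norm_eq_lintegral_enorm hf.aestronglyMeasurable]
  rfl

end Cauchy

variable {N : ℕ} {μ : Measure (Euc N)}

lemma exists_poincare (hN : 1 ≤ N) [IsFiniteMeasure μ] (hμ : HasFiniteEnergy μ) {U : Set (Euc N)}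
    (hU : Bornology.IsBounded U) :
    ∃ K : ℝ, 0 ≤ K ∧ ∀ φ : Euc N → ℝ, IsTest U φ →
      (∫ x, φ x ^ 2) ≤ K * (∫ x, ‖gradient φ x‖ ^ 2) ∧
      (∫ x, |φ x| ∂μ) ^ 2 ≤ K * ∫ x, ‖gradient φ x‖ ^ 2 := by
  obtain ⟨R, hR⟩ := isBounded_iff_forall_norm_le.1 hU
  obtain ⟨C, hC0, hC⟩ := hμ.abs
  refine ⟨max (4 * R ^ 2) (C * (4 * R ^ 2 + 1)), le_max_of_le_left (by positivity), fun φ h => ?_⟩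
  have n2 : 0 ≤ ∫ x, ‖gradient φ x‖ ^ 2 := integral_nonneg fun x => sq_nonneg _
  have h1 := poincare_test hN hR h
  have h2 := hC φ h.univ
  refine ⟨h1.trans (mul_le_mul_of_nonneg_right (le_max_left _ _) n2), h2.trans ?_⟩
  refine le_trans ?_ (mul_le_mul_of_nonneg_right (le_max_right _ _) n2)
  rw [mul_assoc]
  exact mul_le_mul_of_nonneg_left (by linarith) hC0

/-- The three convergences in `MemH10`. -/
structure TendstoH1 (μ : Measure (Euc N)) (φ : ℕ → Euc N → ℝ) (u : Euc N → ℝ)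
    (G : Euc N → Euc N) : Prop where
  memLp : MemLp u 2 volume
  memLp_grad : MemLp G 2 volume
  integrable : Integrable u μ
  tendsto : Tendsto (fun n => eLpNorm (fun x => φ n x - u x) 2 volume) atTop (𝓝 0)
  tendsto_grad : Tendsto (fun n => eLpNorm (fun x => gradient (φ n) x - G x) 2 volume) atTop (𝓝 0)
  tendsto_measure : Tendsto (fun n => eLpNorm (fun x => φ n x - u x) 1 μ) atTop (𝓝 0)

lemma memH10_iff {U : Set (Euc N)} {u : Euc N → ℝ} {G : Euc N → Euc N} :
    MemH10 μ U u G ↔ ∃ φ : ℕ → Euc N → ℝ, (∀ n, IsTest U (φ n)) ∧ TendstoH1 μ φ u G :=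
  ⟨fun ⟨h1, h2, h3, φ, h4, h5, h6, h7⟩ => ⟨φ, h4, h1, h2, h3, h5, h6, h7⟩,
    fun ⟨φ, h4, h1, h2, h3, h5, h6, h7⟩ => ⟨h1, h2, h3, φ, h4, h5, h6, h7⟩⟩

/-- By Poincaré's inequality and finite energy, a Cauchy sequence of gradients makes the functions
Cauchy in `L²(dx)` and in `L¹(μ)`. The two limits have to be represented by one function, although
`μ` may be singular. -/
lemma exists_tendstoH1_of_cauchy (hN : 1 ≤ N) [IsFiniteMeasure μ] (hμ : HasFiniteEnergy μ)
    {U : Set (Euc N)} (hU : Bornology.IsBounded U) {φ : ℕ → Euc N → ℝ} (hφ : ∀ n, IsTest U (φ n))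
    (hc : ∀ ε > 0, ∃ n₀, ∀ i ≥ n₀, ∀ j ≥ n₀,
      ∫ x, ‖gradient (φ i) x - gradient (φ j) x‖ ^ 2 ≤ ε) :
    ∃ u G, TendstoH1 μ φ u G := by
  obtain ⟨K, hK0, hK⟩ := exists_poincare hN hμ hU
  have hsub : ∀ i j, gradient (fun x => φ i x - φ j x) =
      fun x => gradient (φ i) x - gradient (φ j) x := fun i j => funext fun x =>
    gradient_sub' ((hφ i).differentiable x) ((hφ j).differentiable x)
  have hK' : ∀ i j, (∫ x, (φ i x - φ j x) ^ 2) ≤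
        K * (∫ x, ‖gradient (φ i) x - gradient (φ j) x‖ ^ 2) ∧
      (∫ x, |φ i x - φ j x| ∂μ) ^ 2 ≤ K * ∫ x, ‖gradient (φ i) x - gradient (φ j) x‖ ^ 2 :=
    fun i j => by
      have := hK _ ((hφ i).sub (hφ j))
      rwa [hsub] at this
  have hc2 : ∀ ε > 0, ∃ n₀, ∀ i ≥ n₀, ∀ j ≥ n₀,
      K * (∫ x, ‖gradient (φ i) x - gradient (φ j) x‖ ^ 2) ≤ ε ^ 2 ∧
      (∫ x, ‖gradient (φ i) x - gradient (φ j) x‖ ^ 2) ≤ ε ^ 2 := fun ε hε => by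
    obtain ⟨n₀, h⟩ := hc (ε ^ 2 / (K + 1)) (by positivity)
    refine ⟨n₀, fun i hi j hj => ?_⟩
    have h1 := h i hi j hj
    rw [le_div_iff₀ (by positivity)] at h1
    have h0 : 0 ≤ ∫ x, ‖gradient (φ i) x - gradient (φ j) x‖ ^ 2 :=
      integral_nonneg fun x => sq_nonneg _
    constructor <;> nlinarith
  obtain ⟨V, hV, hVl⟩ := exists_limit_of_cauchy (ν := volume) (p := 2)
    (fun n => (hφ n).memLp 2 volume) fun ε hε => by
      obtain ⟨n₀, h⟩ := hc2 ε hε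
      refine ⟨n₀, fun i hi j hj => ?_⟩
      refine (pow_le_pow_iff_left₀ ENNReal.toReal_nonneg hε.le two_ne_zero).1 ?_
      have e := toReal_eLpNorm_two_sq (((hφ i).sub (hφ j)).memLp 2 volume)
      simp only [Real.norm_eq_abs, sq_abs] at e
      rw [e]
      exact (hK' i j).1.trans (h i hi j hj).1
  obtain ⟨G, hG, hGl⟩ := exists_limit_of_cauchy (ν := volume) (p := 2)
    (fun n => (hφ n).memLp_gradient 2 volume) fun ε hε => by
      obtain ⟨n₀, h⟩ := hc2 ε hε
      refine ⟨n₀, fun i hi j hj => ?_⟩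
      refine (pow_le_pow_iff_left₀ ENNReal.toReal_nonneg hε.le two_ne_zero).1 ?_
      have e := toReal_eLpNorm_two_sq
        (((hφ i).memLp_gradient 2 volume).sub ((hφ j).memLp_gradient 2 volume))
      simp only [Pi.sub_def] at e
      rw [e]
      exact (h i hi j hj).2
  obtain ⟨W, hW, hWl⟩ := exists_limit_of_cauchy (ν := μ) (p := 1)
    (fun n => (hφ n).memLp 1 μ) fun ε hε => by
      obtain ⟨n₀, h⟩ := hc2 ε hε
      refine ⟨n₀, fun i hi j hj => ?_⟩
      refine (pow_le_pow_iff_left₀ ENNReal.toReal_nonneg hε.le two_ne_zero).1 ?_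
      rw [toReal_eLpNorm_one (((hφ i).sub (hφ j)).integrable μ)]
      exact (hK' i j).2.trans (h i hi j hj).1
  -- Two successive extractions give one subsequence that converges almost everywhere for the volume
  -- and for `μ`. Its pointwise limit is a representative for both.
  obtain ⟨n₁, hn₁, h₁⟩ := (tendstoInMeasure_of_tendsto_eLpNorm two_ne_zero
    (fun n => (hφ n).continuous.aestronglyMeasurable) hV.1 hVl).exists_seq_tendsto_ae
  obtain ⟨n₂, hn₂, h₂⟩ := (tendstoInMeasure_of_tendsto_eLpNorm (f := fun i => φ (n₁ i))
    (l := atTop) one_ne_zero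
    (fun n => (hφ (n₁ n)).continuous.aestronglyMeasurable) hW.1
    (hWl.comp hn₁.tendsto_atTop)).exists_seq_tendsto_ae
  set v : Euc N → ℝ := fun x => limUnder atTop fun i => φ (n₁ (n₂ i)) x with hv
  have e1 : V =ᵐ[volume] v := by
    filter_upwards [h₁] with x hx
    exact ((hx.comp hn₂.tendsto_atTop).limUnder_eq).symm
  have e2 : W =ᵐ[μ] v := by
    filter_upwards [h₂] with x hx
    exact hx.limUnder_eq.symm
  refine ⟨v, G, hV.ae_eq e1, hG, (memLp_one_iff_integrable.1 hW).congr e2, ?_, hGl, ?_⟩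
  · refine hVl.congr fun n => eLpNorm_congr_ae ?_
    filter_upwards [e1] with x hx
    rw [hx]
  · refine hWl.congr fun n => eLpNorm_congr_ae ?_
    filter_upwards [e2] with x hx
    rw [hx]

/-! ### The energy, existence of the state, monotonicity in the domain -/

section Energy

variable {U : Set (Euc N)}

/-- The linear part `∫_U φ dx - ∫_U φ dμ` of the energy. -/
noncomputable def load (μ : Measure (Euc N)) (U : Set (Euc N)) (φ : Euc N → ℝ) : ℝ :=
  (∫ x in U, φ x) - ∫ x in U, φ x ∂μ

lemma energy_eq (u : Euc N → ℝ) (G : Euc N → Euc N) :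
    energy μ U u G = 1 / 2 * (∫ x in U, ‖G x‖ ^ 2) + load μ U u := by
  rw [energy, load, integral_const_mul]

lemma TendstoH1.memLp_of_test [IsFiniteMeasure μ] {φ : ℕ → Euc N → ℝ} {u : Euc N → ℝ}
    {G : Euc N → Euc N} (h : TendstoH1 μ φ u G) (hφ : ∀ n, IsTest U (φ n)) :
    MemH10 μ U u G := memH10_iff.2 ⟨φ, hφ, h⟩

lemma tendsto_eLpNorm_restrict {E : Type*} [NormedAddCommGroup E] {f : ℕ → Euc N → E}
    {p : ENNReal} {ν : Measure (Euc N)} (U : Set (Euc N))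
    (h : Tendsto (fun n => eLpNorm (f n) p ν) atTop (𝓝 0)) :
    Tendsto (fun n => eLpNorm (f n) p (ν.restrict U)) atTop (𝓝 0) :=
  tendsto_of_tendsto_of_tendsto_of_le_of_le tendsto_const_nhds h (fun _ => zero_le)
    (fun _ => eLpNorm_mono_measure _ Measure.restrict_le_self)

variable [IsFiniteMeasure μ] {W : Set (Euc N)} {φ : ℕ → Euc N → ℝ} {u : Euc N → ℝ}
  {G : Euc N → Euc N}

lemma TendstoH1.tendsto_load (h : TendstoH1 μ φ u G) (hφ : ∀ n, IsTest W (φ n))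
    (hU : Bornology.IsBounded U) :
    Tendsto (fun n => load μ U (φ n)) atTop (𝓝 (load μ U u)) := by
  refine Tendsto.sub (tendsto_setIntegral_of_eLpNorm_two hU.measure_lt_top.ne
    (fun n => (hφ n).memLp 2 volume) h.memLp h.tendsto) ?_
  refine tendsto_integral_of_L1' _ h.integrable.integrableOn.1
    (Eventually.of_forall fun n => ((hφ n).integrable μ).integrableOn) ?_
  exact tendsto_eLpNorm_restrict U h.tendsto_measure

lemma TendstoH1.tendsto_sq (h : TendstoH1 μ φ u G) (hφ : ∀ n, IsTest W (φ n)) (U : Set (Euc N)) :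
    Tendsto (fun n => ∫ x in U, ‖gradient (φ n) x‖ ^ 2) atTop (𝓝 (∫ x in U, ‖G x‖ ^ 2)) := by
  have := tendsto_integral_inner (ν := volume.restrict U)
    (fun n => ((hφ n).memLp_gradient 2 volume).restrict U)
    (fun n => ((hφ n).memLp_gradient 2 volume).restrict U) (h.memLp_grad.restrict U)
    (h.memLp_grad.restrict U) (tendsto_eLpNorm_restrict U h.tendsto_grad)
    (tendsto_eLpNorm_restrict U h.tendsto_grad)
  simpa only [real_inner_self_eq_norm_sq] using this

lemma TendstoH1.tendsto_energy (h : TendstoH1 μ φ u G) (hφ : ∀ n, IsTest W (φ n))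
    (hU : Bornology.IsBounded U) :
    Tendsto (fun n => energy μ U (φ n) (gradient (φ n))) atTop (𝓝 (energy μ U u G)) := by
  simp only [energy_eq]
  exact ((h.tendsto_sq hφ U).const_mul _).add (h.tendsto_load hφ hU)

lemma TendstoH1.tendsto_inner (h : TendstoH1 μ φ u G) (hφ : ∀ n, IsTest W (φ n))
    (U : Set (Euc N)) {H : Euc N → Euc N} (hH : MemLp H 2 volume) :
    Tendsto (fun n => ∫ x in U, inner ℝ (H x) (gradient (φ n) x)) atTop
      (𝓝 (∫ x in U, inner ℝ (H x) (G x))) :=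
  tendsto_integral_inner (ν := volume.restrict U) (f := fun _ => H) (f₀ := H)
    (fun _ => hH.restrict U)
    (fun n => ((hφ n).memLp_gradient 2 volume).restrict U) (hH.restrict U)
    (h.memLp_grad.restrict U) (by simp)
    (tendsto_eLpNorm_restrict U h.tendsto_grad)

lemma integral_norm_sub_sq {ν : Measure (Euc N)} {H G : Euc N → Euc N} (hH : MemLp H 2 ν)
    (hG : MemLp G 2 ν) : ∫ x, ‖H x - G x‖ ^ 2 ∂ν =
      (∫ x, ‖H x‖ ^ 2 ∂ν) - 2 * (∫ x, inner ℝ (G x) (H x) ∂ν) + ∫ x, ‖G x‖ ^ 2 ∂ν := by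
  rw [← integral_const_mul, ← integral_sub (integrable_norm_sq_of_memLp hH)
    ((integrable_inner_of_memLp hG hH).const_mul _), ← integral_add
    (by exact (integrable_norm_sq_of_memLp hH).sub ((integrable_inner_of_memLp hG hH).const_mul _))
    (integrable_norm_sq_of_memLp hG)]
  refine integral_congr_ae (Eventually.of_forall fun x => ?_)
  simp only
  rw [norm_sub_sq_real, real_inner_comm]

lemma IsTest.load_add {f g : Euc N → ℝ} (hf : IsTest W f) (hg : IsTest W g) :
    load μ U (fun x => f x + g x) = load μ U f + load μ U g := by
  simp only [load]
  rw [integral_add (hf.integrable _).integrableOn (hg.integrable _).integrableOn,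
    integral_add (hf.integrable _).integrableOn (hg.integrable _).integrableOn]
  ring

lemma load_const_mul (f : Euc N → ℝ) (c : ℝ) :
    load μ U (fun x => c * f x) = c * load μ U f := by
  simp only [load, integral_const_mul]
  ring

lemma IsState.inner_eq (h : IsState μ U u G) (hU : Bornology.IsBounded U) {w : Euc N → ℝ}
    {H : Euc N → Euc N} (hw : MemH10 μ U w H) :
    ∫ x in U, inner ℝ (G x) (H x) = -load μ U w := by
  obtain ⟨ψ, hψ, hψl⟩ := memH10_iff.1 hw
  refine tendsto_nhds_unique (hψl.tendsto_inner hψ U h.1.2.1) ?_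
  exact (hψl.tendsto_load hψ hU).neg.congr fun n => (h.2 _ (hψ n)).symm

/-- The weak equation, tested with `w` and with `u` itself, replaces both loads by Dirichlet
pairings; what remains is a perfect square. -/
lemma IsState.energy_eq_add (h : IsState μ U u G) (hU : Bornology.IsBounded U) {w : Euc N → ℝ}
    {H : Euc N → Euc N} (hw : MemH10 μ U w H) :
    energy μ U w H = energy μ U u G + 1 / 2 * ∫ x in U, ‖H x - G x‖ ^ 2 := by
  have e1 := h.inner_eq hU hw
  have e2 := h.inner_eq hU h.1
  simp only [real_inner_self_eq_norm_sq] at e2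
  rw [energy_eq, energy_eq, integral_norm_sub_sq (hw.2.1.restrict U) (h.1.2.1.restrict U), e1]
  linarith

lemma IsState.energy_le (h : IsState μ U u G) (hU : Bornology.IsBounded U) {w : Euc N → ℝ}
    {H : Euc N → Euc N} (hw : MemH10 μ U w H) : energy μ U u G ≤ energy μ U w H := by
  rw [h.energy_eq_add hU hw]
  have : 0 ≤ ∫ x in U, ‖H x - G x‖ ^ 2 := integral_nonneg fun x => sq_nonneg _
  linarith

/-- Any two states are competitors for each other and both minimise, so the arbitrary choice in the
definition does not matter. -/
lemma shapeEnergy_eq (hU : Bornology.IsBounded U) (h : IsState μ U u G) :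
    shapeEnergy μ U = energy μ U u G := by
  have hex : ∃ p : (Euc N → ℝ) × (Euc N → Euc N), IsState μ U p.1 p.2 := ⟨(u, G), h⟩
  rw [shapeEnergy, dif_pos hex]
  exact le_antisymm (hex.choose_spec.energy_le hU h.1) (h.energy_le hU hex.choose_spec.1)

lemma IsTest.energy_eq_of_subset {f : Euc N → ℝ} (hf : IsTest U f) (hUW : U ⊆ W) :
    energy μ W f (gradient f) = energy μ U f (gradient f) := by
  have hz : ∀ V : Set (Euc N), U ⊆ V → ∀ x ∉ V, ‖gradient f x‖ ^ 2 = 0 := fun V hV x hx => by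
    rw [hf.gradient_eq_zero fun h => hx (hV h)]; simp
  rw [energy_eq, energy_eq, load, load, hf.setIntegral_eq, hf.setIntegral_eq,
    (hf.mono hUW).setIntegral_eq, (hf.mono hUW).setIntegral_eq,
    setIntegral_eq_integral_of_forall_compl_eq_zero (hz U le_rfl),
    setIntegral_eq_integral_of_forall_compl_eq_zero (hz W hUW)]

lemma MemH10.mono (h : MemH10 μ U u G) (hUW : U ⊆ W) : MemH10 μ W u G := by
  obtain ⟨ψ, hψ, hψl⟩ := memH10_iff.1 h
  exact memH10_iff.2 ⟨ψ, fun n => (hψ n).mono hUW, hψl⟩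

lemma MemH10.energy_eq_of_subset (h : MemH10 μ U u G) (hUW : U ⊆ W) (hW : Bornology.IsBounded W) :
    energy μ W u G = energy μ U u G := by
  obtain ⟨ψ, hψ, hψl⟩ := memH10_iff.1 h
  refine tendsto_nhds_unique (hψl.tendsto_energy hψ hW) ?_
  exact (hψl.tendsto_energy hψ (hW.subset hUW)).congr fun n =>
    ((hψ n).energy_eq_of_subset hUW).symm

lemma exists_poincare_sub (hN : 1 ≤ N) (hμ : HasFiniteEnergy μ) (hU : Bornology.IsBounded U) :
    ∃ K : ℝ, 0 ≤ K ∧ ∀ u G w H, MemH10 μ U u G → MemH10 μ U w H →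
      (∫ x in U, (w x - u x) ^ 2) ≤ K * (∫ x in U, ‖H x - G x‖ ^ 2) := by
  obtain ⟨K, hK0, hK⟩ := exists_poincare hN hμ hU
  refine ⟨K, hK0, fun u G w H hu hw => ?_⟩
  obtain ⟨φ, hφ, hφl⟩ := memH10_iff.1 hu
  obtain ⟨ψ, hψ, hψl⟩ := memH10_iff.1 hw
  have hd : ∀ n, IsTest U fun x => ψ n x - φ n x := fun n => (hψ n).sub (hφ n)
  have hg : ∀ n, gradient (fun x => ψ n x - φ n x) = fun x => gradient (ψ n) x - gradient (φ n) x :=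
    fun n => funext fun x => gradient_sub' ((hψ n).differentiable x) ((hφ n).differentiable x)
  have l1 : Tendsto (fun n => eLpNorm (fun x => (ψ n x - φ n x) - (w x - u x)) 2
      (volume.restrict U)) atTop (𝓝 0) := by
    refine tendsto_eLpNorm_restrict U ?_
    refine tendsto_of_tendsto_of_tendsto_of_le_of_le tendsto_const_nhds
      (by simpa using hψl.tendsto.add hφl.tendsto) (fun _ => zero_le) fun n => ?_
    have := eLpNorm_sub_le (p := 2) (μ := (volume : Measure (Euc N)))
      (((hψ n).memLp 2 volume).sub hw.1).1 (((hφ n).memLp 2 volume).sub hu.1).1 (by norm_num)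
    refine le_trans (le_of_eq ?_) this
    congr 1
    ext x
    simp only [Pi.sub_apply]; ring
  have l2 : Tendsto (fun n => eLpNorm (fun x => (gradient (ψ n) x - gradient (φ n) x) - (H x - G x))
      2 (volume.restrict U)) atTop (𝓝 0) := by
    refine tendsto_eLpNorm_restrict U ?_
    refine tendsto_of_tendsto_of_tendsto_of_le_of_le tendsto_const_nhds
      (by simpa using hψl.tendsto_grad.add hφl.tendsto_grad) (fun _ => zero_le) fun n => ?_
    have := eLpNorm_sub_le (p := 2) (μ := (volume : Measure (Euc N)))
      (((hψ n).memLp_gradient 2 volume).sub hw.2.1).1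
      (((hφ n).memLp_gradient 2 volume).sub hu.2.1).1 (by norm_num)
    refine le_trans (le_of_eq ?_) this
    congr 1
    ext1 x
    simp only [Pi.sub_apply]; abel
  have m1 : ∀ n, MemLp (fun x => ψ n x - φ n x) 2 (volume.restrict U) := fun n =>
    ((hd n).memLp 2 volume).restrict U
  have m2 : ∀ n, MemLp (fun x => gradient (ψ n) x - gradient (φ n) x) 2 (volume.restrict U) :=
    fun n => (((hψ n).memLp_gradient 2 volume).sub ((hφ n).memLp_gradient 2 volume)).restrict U
  have t1 := tendsto_integral_inner m1 m1 ((hw.1.sub hu.1).restrict U)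
    ((hw.1.sub hu.1).restrict U) l1 l1
  have t2 := tendsto_integral_inner m2 m2 ((hw.2.1.sub hu.2.1).restrict U)
    ((hw.2.1.sub hu.2.1).restrict U) l2 l2
  simp only [real_inner_self_eq_norm_sq, Real.norm_eq_abs, sq_abs, Pi.sub_apply] at t1 t2
  refine le_of_tendsto_of_tendsto' t1 (t2.const_mul K) fun n => ?_
  have := (hK _ (hd n)).1
  rw [hg] at this
  rw [setIntegral_eq_integral_of_forall_compl_eq_zero, setIntegral_eq_integral_of_forall_compl_eq_zero]
  · exact this
  · intro x hx
    rw [(hψ n).gradient_eq_zero hx, (hφ n).gradient_eq_zero hx]; simp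
  · intro x hx
    have : ψ n x - φ n x = 0 := image_eq_zero_of_notMem_tsupport (f := fun x => ψ n x - φ n x)
      fun h' => hx ((hd n).2.2 h')
    rw [this]; simp

/-- Direct method on test functions. The load is bounded by `√(A q)`, where `q` is the Dirichlet
integral, so the energy is bounded below. The Euler–Lagrange equation is then read off from the
near-minimising property and passes to the limit. -/
lemma exists_isState (hN : 1 ≤ N) (hμ : HasFiniteEnergy μ) (hU : Bornology.IsBounded U) :
    ∃ v G, IsState μ U v G := by
  obtain ⟨K, hK0, hK⟩ := exists_poincare hN hμ hU
  set q : (Euc N → ℝ) → ℝ := fun φ => ∫ x, ‖gradient φ x‖ ^ 2 with hq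
  set F : (Euc N → ℝ) → ℝ := fun φ => 1 / 2 * q φ + load μ U φ with hF
  have hq0 : ∀ φ, 0 ≤ q φ := fun φ => integral_nonneg fun x => sq_nonneg _
  have hqadd : ∀ φ ψ : Euc N → ℝ, IsTest U φ → IsTest U ψ → ∀ s t : ℝ,
      q (fun x => s * φ x + t * ψ x) = s ^ 2 * q φ +
        2 * s * t * (∫ x, inner ℝ (gradient φ x) (gradient ψ x)) + t ^ 2 * q ψ := by
    intro φ ψ hφ hψ s t
    have a1 := integrable_norm_sq_of_memLp (hφ.memLp_gradient 2 volume)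
    have a2 := integrable_norm_sq_of_memLp (hψ.memLp_gradient 2 volume)
    have a3 := integrable_inner_of_memLp (hφ.memLp_gradient 2 volume) (hψ.memLp_gradient 2 volume)
    simp only [hq]
    rw [← integral_const_mul, ← integral_const_mul, ← integral_const_mul, ← integral_add, ← integral_add]
    · refine integral_congr_ae (Eventually.of_forall fun x => ?_)
      simp only
      rw [gradient_add' ((hφ.differentiable x).const_mul s) ((hψ.differentiable x).const_mul t),
        gradient_const_mul' (hφ.differentiable x), gradient_const_mul' (hψ.differentiable x),
        norm_add_sq_real, norm_smul, norm_smul, real_inner_smul_left, real_inner_smul_right,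
        mul_pow, mul_pow, Real.norm_eq_abs, Real.norm_eq_abs, sq_abs, sq_abs]
      ring
    · exact (a1.const_mul _).add (a3.const_mul _)
    · exact a2.const_mul _
    · exact a1.const_mul _
    · exact a3.const_mul _
  have hladd : ∀ φ ψ : Euc N → ℝ, IsTest U φ → IsTest U ψ → ∀ s t : ℝ,
      load μ U (fun x => s * φ x + t * ψ x) = s * load μ U φ + t * load μ U ψ := by
    intro φ ψ hφ hψ s t
    rw [IsTest.load_add (hφ.const_mul s) (hψ.const_mul t), load_const_mul, load_const_mul]
  obtain ⟨A, hA0, hA⟩ : ∃ A : ℝ, 0 ≤ A ∧ ∀ φ, IsTest U φ → (load μ U φ) ^ 2 ≤ A * q φ := by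
    -- From `(a - b)² ≤ 2a² + 2b²`, with Cauchy–Schwarz on the finite volume of `U` for `a` and the
    -- `L¹(μ)` bound for `b`.
    refine ⟨2 * ((volume U).toReal * K + K), by positivity, fun φ hφ => ?_⟩
    obtain ⟨h1, h2⟩ := hK φ hφ
    have h3 := sq_setIntegral_le (ν := volume) hU.measure_lt_top.ne ((hφ.memLp 2 volume).restrict U)
    have h4 : ∫ x in U, φ x ^ 2 = ∫ x, φ x ^ 2 :=
      setIntegral_eq_integral_of_forall_compl_eq_zero fun x hx => by
        rw [image_eq_zero_of_notMem_tsupport fun h' => hx (hφ.2.2 h')]; simp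
    have h5 : (∫ x in U, φ x ∂μ) ^ 2 ≤ (∫ x, |φ x| ∂μ) ^ 2 := by
      rw [hφ.setIntegral_eq]
      exact sq_le_sq.2 ((abs_integral_le_integral_abs).trans (le_abs_self _))
    rw [h4] at h3
    have h6 := h3.trans (mul_le_mul_of_nonneg_left h1 ENNReal.toReal_nonneg)
    have h7 := h5.trans h2
    simp only [load]
    generalize (∫ x in U, φ x) = a at *
    generalize (∫ x in U, φ x ∂μ) = b at *
    nlinarith [sq_nonneg (a + b)]
  obtain ⟨w, hwS, hwF, hwc⟩ := exists_cauchy_minimizing (S := fun _ : ℕ => {φ | IsTest U φ})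
    (fun _ _ _ => le_rfl) (mid := fun φ ψ x => 1 / 2 * φ x + 1 / 2 * ψ x)
    (fun _ a ha b hb => (IsTest.const_mul ha _).add (IsTest.const_mul hb _)) (F := F)
    -- The affine load cancels in `F φ + F ψ - 2 F(mid)`, which is exactly a quarter of the
    -- Dirichlet integral of `φ - ψ`. The bound `-A/2` is the minimum of `q/2 - √(A q)`.
    (d := fun φ ψ => 1 / 4 * q (fun x => 1 * φ x + (-1) * ψ x)) (m := -A / 2) (M := F fun _ => 0)
    (fun a ha b hb => by
      simp only [hF]
      rw [hqadd a b ha hb, hqadd a b ha hb, hladd a b ha hb]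
      linarith)
    (fun φ hφ => by
      have h1 := hA φ hφ
      simp only [hF]
      by_contra! h2
      have h3 : (1 / 2 * (q φ + A)) ^ 2 < load μ U φ ^ 2 := by
        rw [← neg_sq (load μ U φ)]
        exact pow_lt_pow_left₀ (by linarith) (by linarith [hq0 φ]) two_ne_zero
      nlinarith [sq_nonneg (q φ - A)])
    (fun _ => ⟨fun _ => 0, isTest_zero, le_rfl⟩)
  obtain ⟨v, G, hvG⟩ := exists_tendstoH1_of_cauchy hN hμ hU hwS fun ε hε => by
    obtain ⟨n₀, h⟩ := hwc (ε / 4) (by positivity)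
    refine ⟨n₀, fun i hi j hj => ?_⟩
    have h1 := h i hi j hj
    have h2 : q (fun x => 1 * w i x + (-1) * w j x) =
        ∫ x, ‖gradient (w i) x - gradient (w j) x‖ ^ 2 := by
      simp only [hq]
      refine integral_congr_ae (Eventually.of_forall fun x => ?_)
      simp only
      rw [gradient_add' (((hwS i).differentiable x).const_mul _)
        (((hwS j).differentiable x).const_mul _), gradient_const_mul' ((hwS i).differentiable x),
        gradient_const_mul' ((hwS j).differentiable x)]
      simp [sub_eq_add_neg]
    rw [h2] at h1
    linarith
  refine ⟨v, G, hvG.memLp_of_test hwS, fun ψ hψ => ?_⟩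
  have hlim := hvG.tendsto_inner hwS U (hψ.memLp_gradient 2 volume)
  -- Compare `w n` with `w n + s ψ`: the loss `1 / (n + 1)` disappears in the limit. A quadratic
  -- polynomial without constant term that is nonnegative for all `s` has no linear term.
  have key : ∀ s : ℝ, 0 ≤ s * ((∫ x in U, inner ℝ (gradient ψ x) (G x)) + load μ U ψ) +
      s ^ 2 * (1 / 2 * q ψ) := by
    intro s
    have hl : Tendsto (fun n : ℕ => s * ((∫ x in U, inner ℝ (gradient ψ x) (gradient (w n) x)) +
        load μ U ψ) + s ^ 2 * (1 / 2 * q ψ) + 1 / ((n : ℝ) + 1)) atTop (𝓝 _) :=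
      (((hlim.add_const _).const_mul s).add_const _).add
        (tendsto_one_div_add_atTop_nhds_zero_nat (𝕜 := ℝ))
    rw [add_zero] at hl
    refine ge_of_tendsto' hl fun n => ?_
    have h1 := hwF n (fun x => 1 * w n x + s * ψ x) (((hwS n).const_mul 1).add (hψ.const_mul s))
    simp only [hF] at h1
    rw [hqadd _ _ (hwS n) hψ, hladd _ _ (hwS n) hψ] at h1
    have h2 : (∫ x in U, inner ℝ (gradient ψ x) (gradient (w n) x)) =
        ∫ x, inner ℝ (gradient (w n) x) (gradient ψ x) := by
      rw [setIntegral_eq_integral_of_forall_compl_eq_zero]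
      · simp only [real_inner_comm]
      · intro x hx
        rw [hψ.gradient_eq_zero hx]; simp
    rw [h2]
    linarith
  have h0 : (∫ x in U, inner ℝ (gradient ψ x) (G x)) + load μ U ψ = 0 := by
    generalize (∫ x in U, inner ℝ (gradient ψ x) (G x)) + load μ U ψ = a at key
    have hb := hq0 ψ
    generalize q ψ = b at key hb
    by_contra ha
    have h1 := key (-a / (b + 1))
    have h2 : -a / (b + 1) * a + (-a / (b + 1)) ^ 2 * (1 / 2 * b) =
        -(a ^ 2 * ((b / 2 + 1) / (b + 1) ^ 2)) := by field_simp; ring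
    rw [h2] at h1
    have : 0 < a ^ 2 * ((b / 2 + 1) / (b + 1) ^ 2) := by positivity
    linarith
  have h3 : ∫ x in U, inner ℝ (G x) (gradient ψ x) = ∫ x in U, inner ℝ (gradient ψ x) (G x) := by
    simp only [real_inner_comm]
  rw [h3]
  exact eq_neg_of_add_eq_zero_left h0

/-- Extension by zero preserves the energy, so a larger domain only has more competitors. -/
lemma shapeEnergy_anti (hN : 1 ≤ N) (hμ : HasFiniteEnergy μ) (hUW : U ⊆ W)
    (hW : Bornology.IsBounded W) : shapeEnergy μ W ≤ shapeEnergy μ U := by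
  obtain ⟨u, G, h⟩ := exists_isState hN hμ (hW.subset hUW)
  obtain ⟨v, H, h'⟩ := exists_isState hN hμ hW
  rw [shapeEnergy_eq (hW.subset hUW) h, shapeEnergy_eq hW h',
    ← h.1.energy_eq_of_subset hUW hW]
  exact h'.energy_le hW (h.1.mono hUW)

end Energy

/-! ### Mollification and Lipschitz functions in `H¹₀` -/

section Mollify

variable {N : ℕ} {F : Type*} [NormedAddCommGroup F] [NormedSpace ℝ F]

/-- A sequence of bump functions shrinking to the origin. -/
noncomputable def bump (N n : ℕ) : ContDiffBump (0 : Euc N) where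
  rIn := 1 / ((n : ℝ) + 1) / 2
  rOut := 1 / ((n : ℝ) + 1)
  rIn_pos := by positivity
  rIn_lt_rOut := half_lt_self (by positivity)

/-- The normalized smoothing kernel of radius `1 / (n + 1)`. -/
noncomputable def kernel (N n : ℕ) : Euc N → ℝ := (bump N n).normed volume

/-- Convolution with the smoothing kernel. -/
noncomputable def mollify (n : ℕ) (f : Euc N → F) : Euc N → F :=
  convolution (kernel N n) f (ContinuousLinearMap.lsmul ℝ ℝ) volume

lemma tendsto_rOut_bump : Tendsto (fun n => (bump N n).rOut) atTop (𝓝 0) :=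
  tendsto_one_div_add_atTop_nhds_zero_nat

lemma contDiff_kernel (n : ℕ) : ContDiff ℝ ∞ (kernel N n) := (bump N n).contDiff_normed

lemma hasCompactSupport_kernel (n : ℕ) : HasCompactSupport (kernel N n) :=
  (bump N n).hasCompactSupport_normed

lemma kernel_nonneg (n : ℕ) (x : Euc N) : 0 ≤ kernel N n x := (bump N n).nonneg_normed x

lemma integral_kernel (n : ℕ) : ∫ x, kernel N n x = 1 := (bump N n).integral_normed

lemma kernel_eq_zero {n : ℕ} {x : Euc N} (hx : 1 / ((n : ℝ) + 1) ≤ ‖x‖) : kernel N n x = 0 := by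
  have : x ∉ Function.support (kernel N n) := by
    rw [kernel, ContDiffBump.support_normed_eq]
    simpa [bump] using hx
  simpa using this

lemma integrable_kernel (n : ℕ) : Integrable (kernel N n) :=
  (contDiff_kernel n).continuous.integrable_of_hasCompactSupport (hasCompactSupport_kernel n)

lemma isTest_kernel (n : ℕ) : IsTest univ (kernel N n) :=
  ⟨contDiff_kernel n, hasCompactSupport_kernel n, subset_univ _⟩

lemma isTest_kernel_sub (n : ℕ) (x : Euc N) : IsTest univ (fun t => kernel N n (x - t)) :=
  ⟨(contDiff_kernel n).comp (contDiff_const.sub contDiff_id),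
    (hasCompactSupport_kernel n).comp_homeomorph (Homeomorph.subLeft x), subset_univ _⟩

lemma mollify_apply (n : ℕ) (f : Euc N → F) (x : Euc N) :
    mollify n f x = ∫ t, kernel N n (x - t) • f t := convolution_lsmul_swap

lemma contDiff_mollify (n : ℕ) {f : Euc N → F} (hf : LocallyIntegrable f volume) :
    ContDiff ℝ ∞ (mollify n f) :=
  HasCompactSupport.contDiff_convolution_left _ (hasCompactSupport_kernel n) (contDiff_kernel n) hf

lemma ae_tendsto_mollify [CompleteSpace F] {f : Euc N → F} (hf : LocallyIntegrable f volume) :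
    ∀ᵐ x, Tendsto (fun n => mollify n f x) atTop (𝓝 (f x)) :=
  ContDiffBump.ae_convolution_tendsto_right_of_locallyIntegrable (φ := bump N) (K := 2)
    tendsto_rOut_bump (Eventually.of_forall fun n => le_of_eq (by simp only [bump]; ring)) hf

lemma dist_mollify_le [CompleteSpace F] {n : ℕ} {f : Euc N → F} {x : Euc N} {z : F} {ε : ℝ}
    (hε : 0 ≤ ε) (hf : AEStronglyMeasurable f volume)
    (h : ∀ y, dist y x < 1 / ((n : ℝ) + 1) → dist (f y) z ≤ ε) :
    dist (mollify n f x) z ≤ ε :=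
  dist_convolution_le hε (R := 1 / ((n : ℝ) + 1)) (by
    rw [kernel, ContDiffBump.support_normed_eq]; rfl) (kernel_nonneg n) (integral_kernel n) hf
    fun y hy => h y hy

lemma norm_mollify_le [CompleteSpace F] {n : ℕ} {f : Euc N → F} {M : ℝ} (hM : 0 ≤ M)
    (hf : AEStronglyMeasurable f volume) (h : ∀ x, ‖f x‖ ≤ M) (x : Euc N) :
    ‖mollify n f x‖ ≤ M := by
  have := dist_mollify_le (n := n) (x := x) (z := (0 : F)) hM hf
    (fun y _ => by simpa using h y)
  simpa using this

lemma mollify_eq_zero {n : ℕ} {f : Euc N → F} {x : Euc N}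
    (h : ∀ y, dist y x < 1 / ((n : ℝ) + 1) → f y = 0) : mollify n f x = 0 := by
  rw [mollify_apply]
  refine integral_eq_zero_of_ae (Eventually.of_forall fun t => ?_)
  by_cases ht : dist t x < 1 / ((n : ℝ) + 1)
  · simp [h t ht]
  · rw [not_lt, dist_comm, dist_eq_norm] at ht
    simp [kernel_eq_zero ht]

lemma tsupport_mollify_subset (n : ℕ) (f : Euc N → F) :
    tsupport (mollify n f) ⊆ Metric.cthickening (1 / ((n : ℝ) + 1)) (tsupport f) := by
  refine closure_minimal (fun x hx => ?_) Metric.isClosed_cthickening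
  by_contra h
  refine hx (mollify_eq_zero fun y hy => ?_)
  by_contra hfy
  exact h (Metric.mem_cthickening_of_dist_le x y _ _ (subset_tsupport f hfy)
    (by rw [dist_comm]; exact hy.le))

lemma hasCompactSupport_mollify (n : ℕ) {f : Euc N → F} (hf : HasCompactSupport f) :
    HasCompactSupport (mollify n f) :=
  hf.isCompact.cthickening.of_isClosed_subset (isClosed_tsupport _) (tsupport_mollify_subset n f)

/-- Meant for gradients of Lipschitz functions, which are bounded but need not be continuous.
Convergence holds at Lebesgue points, and all supports lie in a fixed compact set, so dominated
convergence applies. -/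
lemma tendsto_integral_mollify_sub [CompleteSpace F] {f : Euc N → F} {M : ℝ}
    (hf : AEStronglyMeasurable f volume) (hM : ∀ x, ‖f x‖ ≤ M) (hc : HasCompactSupport f) :
    Tendsto (fun n => ∫ x, ‖mollify n f x - f x‖ ^ 2) atTop (𝓝 0) := by
  have hM0 : 0 ≤ M := (norm_nonneg _).trans (hM 0)
  have hcpt : IsCompact (Metric.cthickening 1 (tsupport f)) := hc.isCompact.cthickening
  have hint : Integrable f := by
    refine (integrableOn_iff_integrable_of_support_subset (subset_tsupport f)).1 ?_
    exact Measure.integrableOn_of_bounded hc.isCompact.measure_lt_top.ne hf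
      (Eventually.of_forall hM)
  have hli := hint.locallyIntegrable
  have h0 : ∫ x : Euc N, (0 : ℝ) = 0 := by simp
  rw [← h0]
  refine tendsto_integral_of_dominated_convergence
    (indicator (Metric.cthickening 1 (tsupport f)) fun _ => (2 * M) ^ 2) (fun n => ?_) ?_ (fun n => ?_) ?_
  · exact (((contDiff_mollify n hli).continuous.aestronglyMeasurable.sub hf).norm.pow 2)
  · exact (integrable_indicator_iff hcpt.measurableSet).2
      (integrableOn_const hcpt.measure_lt_top.ne)
  · refine Eventually.of_forall fun x => ?_
    rw [Real.norm_of_nonneg (sq_nonneg _)]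
    by_cases hx : x ∈ Metric.cthickening 1 (tsupport f)
    · rw [indicator_of_mem hx]
      refine pow_le_pow_left₀ (norm_nonneg _) ((norm_sub_le _ _).trans ?_) 2
      linarith [norm_mollify_le (n := n) hM0 hf hM x, hM x]
    · rw [indicator_of_notMem hx]
      have h1 : f x = 0 := image_eq_zero_of_notMem_tsupport fun h =>
        hx (Metric.self_subset_cthickening _ h)
      have h2 : mollify n f x = 0 := image_eq_zero_of_notMem_tsupport fun h =>
        hx (Metric.cthickening_mono (by
          rw [div_le_one (by positivity)]; linarith [(Nat.cast_nonneg n : (0 : ℝ) ≤ n)]) _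
          (tsupport_mollify_subset n f h))
      simp [h1, h2]
  · filter_upwards [ae_tendsto_mollify hli] with x hx
    have := (hx.sub_const (f x)).norm.pow 2
    simpa using this

lemma fderiv_convolution_apply {ρ f : Euc N → ℝ} (hc : HasCompactSupport ρ) (hρ : ContDiff ℝ 1 ρ)
    (hf : LocallyIntegrable f volume) (x e : Euc N) :
    fderiv ℝ (convolution ρ f (ContinuousLinearMap.lsmul ℝ ℝ) volume) x e =
      ∫ t, fderiv ℝ ρ (x - t) e * f t := by
  rw [(hc.hasFDerivAt_convolution_left (ContinuousLinearMap.lsmul ℝ ℝ) hρ hf x).fderiv,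
    convolution_eq_swap, ContinuousLinearMap.integral_apply]
  · rfl
  · have := (hc.fderiv ℝ).convolutionExists_left
      ((ContinuousLinearMap.lsmul ℝ ℝ : ℝ →L[ℝ] ℝ →L[ℝ] ℝ).precompL (Euc N))
      (hρ.continuous_fderiv one_ne_zero) hf x
    exact this.integrable_swap

/-- `G` is the weak gradient of `f` on the whole space. -/
def HasWeakGradient (f : Euc N → ℝ) (G : Euc N → Euc N) : Prop :=
  ∀ φ : Euc N → ℝ, IsTest univ φ → ∀ e : Euc N,
    ∫ x, f x * fderiv ℝ φ x e = -∫ x, inner ℝ (G x) e * φ x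

lemma fderiv_kernel_sub (n : ℕ) (x t e : Euc N) :
    fderiv ℝ (fun t => kernel N n (x - t)) t e = -fderiv ℝ (kernel N n) (x - t) e := by
  have h := ((isTest_kernel n).differentiable (x - t)).hasFDerivAt.comp t
    ((hasFDerivAt_id t).const_sub x)
  rw [show (fun t => kernel N n (x - t)) = kernel N n ∘ fun t => x - t from rfl]
  have h' : HasFDerivAt (kernel N n ∘ fun t => x - t) _ t := h
  rw [h'.fderiv]
  simp

/-- The derivative falls on the kernel, and `t ↦ kernel (x - t)` is itself an admissible test
function in the definition of the weak gradient. -/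
lemma HasWeakGradient.gradient_mollify {f : Euc N → ℝ} {G : Euc N → Euc N}
    (h : HasWeakGradient f G) (hf : LocallyIntegrable f volume) (hG : LocallyIntegrable G volume)
    (n : ℕ) (x : Euc N) : gradient (mollify n f) x = mollify n G x := by
  refine ext_inner_right ℝ fun e => ?_
  rw [inner_gradient, mollify, fderiv_convolution_apply (hasCompactSupport_kernel n)
    ((contDiff_kernel n).of_le (by simp)) hf]
  have h1 := h _ (isTest_kernel_sub n x) e
  simp only [fderiv_kernel_sub, mul_neg, integral_neg, neg_inj] at h1
  have h2 : Integrable fun t => kernel N n (x - t) • G t :=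
    hG.integrable_smul_left_of_hasCompactSupport (isTest_kernel_sub n x).continuous
      (isTest_kernel_sub n x).2.1
  rw [mollify_apply, real_inner_comm, ← integral_inner h2]
  simp only [mul_comm (fderiv ℝ _ _ _)]
  rw [h1]
  refine integral_congr_ae (Eventually.of_forall fun t => ?_)
  simp only
  rw [real_inner_smul_right, real_inner_comm, mul_comm]

lemma measurable_gradient (f : Euc N → ℝ) : Measurable (gradient f) :=
  (LinearIsometryEquiv.continuous _).measurable.comp (measurable_fderiv ℝ f)

lemma LipschitzWith.norm_gradient_le {C : NNReal} {f : Euc N → ℝ} (hf : LipschitzWith C f)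
    (x : Euc N) : ‖gradient f x‖ ≤ C := by
  rw [norm_gradient]; exact norm_fderiv_le_of_lipschitz ℝ hf

/-- Rademacher's theorem, combined with integration by parts for line derivatives of Lipschitz
functions. -/
lemma hasWeakGradient_of_lipschitz {C : NNReal} {f : Euc N → ℝ} (hf : LipschitzWith C f) :
    HasWeakGradient f (gradient f) := by
  intro φ hφ e
  obtain ⟨D, hD⟩ := hφ.1.lipschitzWith_of_hasCompactSupport hφ.2.1 (by simp)
  have h := hf.integral_lineDeriv_mul_eq (μ := (volume : Measure (Euc N))) hD hφ.2.1 e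
  have e1 : ∫ x, lineDeriv ℝ f x e * φ x = ∫ x, inner ℝ (gradient f x) e * φ x := by
    refine integral_congr_ae ?_
    filter_upwards [hf.ae_differentiableAt (μ := (volume : Measure (Euc N)))] with x hx
    rw [hx.lineDeriv_eq_fderiv, inner_gradient]
  rw [← e1, h, ← integral_neg]
  refine integral_congr_ae (Eventually.of_forall fun x => ?_)
  simp only
  rw [(hφ.differentiable x).lineDeriv_eq_fderiv, map_neg]
  ring

/-- Test functions transported by a merely Lipschitz change of variables are only Lipschitz; this
makes them admissible competitors. -/
lemma memH10_of_lipschitz {μ : Measure (Euc N)} [IsFiniteMeasure μ] {U : Set (Euc N)}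
    (hU : IsOpen U) {C : NNReal} {f : Euc N → ℝ} (hf : LipschitzWith C f)
    (hc : HasCompactSupport f) (hs : tsupport f ⊆ U) : MemH10 μ U f (gradient f) := by
  obtain ⟨M, hM⟩ := hf.continuous.bounded_above_of_compact_support hc
  have hM0 : 0 ≤ M := (norm_nonneg _).trans (hM 0)
  have hmg : AEStronglyMeasurable (gradient f) volume := (measurable_gradient f).aestronglyMeasurable
  have hcg : HasCompactSupport (gradient f) :=
    hc.mono' (subset_closure.trans (tsupport_gradient_subset f))
  have hCg := fun x => LipschitzWith.norm_gradient_le hf x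
  have hmemG : MemLp (gradient f) 2 volume := by
    have : MemLp (gradient f) 2 (volume.restrict (tsupport (gradient f))) := by
      have : IsFiniteMeasure (volume.restrict (tsupport (gradient f))) :=
        ⟨by simpa using hcg.isCompact.measure_lt_top⟩
      exact MemLp.of_bound hmg.restrict C (Eventually.of_forall hCg)
    rw [← memLp_indicator_iff_restrict (isClosed_tsupport _).measurableSet] at this
    rwa [indicator_eq_self.2 (subset_tsupport _)] at this
  have hli : LocallyIntegrable f volume := hf.continuous.locallyIntegrable
  have hliG : LocallyIntegrable (gradient f) volume := hmemG.locallyIntegrable (by norm_num)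
  obtain ⟨δ, hδ, hδU⟩ := hc.isCompact.exists_cthickening_subset_open hU hs
  obtain ⟨n₀, hn₀⟩ := exists_nat_one_div_lt hδ
  -- The shift by `n₀` keeps the radius of the kernel below the distance `δ` by which the support
  -- may be thickened inside `U`.
  have hts : ∀ n, IsTest U (mollify (n + n₀) f) := fun n => by
    refine ⟨contDiff_mollify _ hli, hasCompactSupport_mollify _ hc,
      ((tsupport_mollify_subset _ f).trans (Metric.cthickening_mono ?_ _)).trans hδU⟩
    refine le_trans (one_div_le_one_div_of_le (by positivity) ?_) hn₀.le
    push_cast; linarith [(Nat.cast_nonneg n : (0 : ℝ) ≤ n)]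
  have hm : MemLp f 2 volume := hf.continuous.memLp_of_hasCompactSupport hc
  have hI : Integrable f μ := hf.continuous.integrable_of_hasCompactSupport hc
  have hgr : ∀ n, gradient (mollify n f) = mollify n (gradient f) := fun n => funext fun x =>
    (hasWeakGradient_of_lipschitz hf).gradient_mollify hli hliG n x
  refine memH10_iff.2 ⟨fun n => mollify (n + n₀) f, hts, hm, hmemG, hI, ?_, ?_, ?_⟩
  · exact (tendsto_eLpNorm_two_iff fun n => ((hts n).memLp 2 volume).sub hm).2
      ((tendsto_integral_mollify_sub hf.continuous.aestronglyMeasurable hM hc).comp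
        (tendsto_add_atTop_nat n₀))
  · refine (tendsto_eLpNorm_two_iff fun n => ((hts n).memLp_gradient 2 volume).sub hmemG).2 ?_
    simp only [hgr]
    exact (tendsto_integral_mollify_sub hmg hCg hcg).comp (tendsto_add_atTop_nat n₀)
  · have hI' : ∀ n, Integrable (fun x => mollify (n + n₀) f x - f x) μ := fun n =>
      ((hts n).integrable μ).sub hI
    have h1 : ∀ n, eLpNorm (fun x => mollify (n + n₀) f x - f x) 1 μ =
        ENNReal.ofReal (∫ x, |mollify (n + n₀) f x - f x| ∂μ) := fun n => by
      rw [← toReal_eLpNorm_one (hI' n), ENNReal.ofReal_toReal]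
      exact (memLp_one_iff_integrable.2 (hI' n)).2.ne
    simp only [h1]
    rw [← ENNReal.ofReal_zero]
    refine ENNReal.tendsto_ofReal ?_
    have h0 : ∫ x : Euc N, (0 : ℝ) ∂μ = 0 := by simp
    rw [← h0]
    refine tendsto_integral_of_dominated_convergence (fun _ => 2 * M) (fun n => ?_)
      (integrable_const _) (fun n => Eventually.of_forall fun x => ?_)
      (Eventually.of_forall fun x => ?_)
    · exact (((hts n).continuous.sub hf.continuous).abs).aestronglyMeasurable
    · rw [Real.norm_eq_abs, abs_abs]
      have a1 := norm_mollify_le (n := n + n₀) hM0 hf.continuous.aestronglyMeasurable hM x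
      have a2 := norm_sub_le (mollify (n + n₀) f x) (f x)
      rw [Real.norm_eq_abs (_ - _)] at a2
      linarith [hM x]
    -- For a possibly singular `μ`, Lebesgue-almost everywhere convergence is not enough; continuity
    -- of `f` gives convergence at every point.
    · have hp : Tendsto (fun n => mollify n f x) atTop (𝓝 (f x)) :=
        ContDiffBump.convolution_tendsto_right_of_continuous (φ := bump N) tendsto_rOut_bump
          hf.continuous x
      have := (((hp.comp (tendsto_add_atTop_nat n₀)).sub_const (f x))).abs
      simpa using this

end Mollify

/-! ### First order expansion of the pulled-back energy density -/

section LinearAlgebra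

variable {N : ℕ}

/-- The trace of an endomorphism. -/
noncomputable def trace (B : Euc N →L[ℝ] Euc N) : ℝ :=
  ∑ i, inner ℝ (EuclideanSpace.basisFun (Fin N) ℝ i) (B (EuclideanSpace.basisFun (Fin N) ℝ i))

lemma trace_add (A B : Euc N →L[ℝ] Euc N) : trace (A + B) = trace A + trace B := by
  simp [trace, inner_add_right, Finset.sum_add_distrib]

lemma trace_smul (c : ℝ) (B : Euc N →L[ℝ] Euc N) : trace (c • B) = c * trace B := by
  simp only [trace, Finset.mul_sum]
  refine Finset.sum_congr rfl fun i _ => ?_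
  rw [FunLike.coe_smul, Pi.smul_apply, real_inner_smul_right]

lemma abs_trace_le (B : Euc N →L[ℝ] Euc N) : |trace B| ≤ N * ‖B‖ := by
  refine (Finset.abs_sum_le_sum_abs _ _).trans ?_
  have : ∀ i ∈ (Finset.univ : Finset (Fin N)), |inner ℝ (EuclideanSpace.basisFun (Fin N) ℝ i)
      (B (EuclideanSpace.basisFun (Fin N) ℝ i))| ≤ ‖B‖ := fun i _ => by
    refine (abs_real_inner_le_norm _ _).trans ?_
    have h1 : ‖EuclideanSpace.basisFun (Fin N) ℝ i‖ = 1 :=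
      (EuclideanSpace.basisFun (Fin N) ℝ).norm_eq_one i
    have h2 := B.le_opNorm (EuclideanSpace.basisFun (Fin N) ℝ i)
    rw [h1] at h2 ⊢
    linarith
  refine (Finset.sum_le_sum this).trans ?_
  simp

/-- The matrix of an endomorphism in the standard basis, as a linear map. -/
noncomputable def matrixOf (N : ℕ) : (Euc N →L[ℝ] Euc N) →ₗ[ℝ] Matrix (Fin N) (Fin N) ℝ :=
  (LinearMap.toMatrix (EuclideanSpace.basisFun (Fin N) ℝ).toBasis
    (EuclideanSpace.basisFun (Fin N) ℝ).toBasis).toLinearMap.comp (ContinuousLinearMap.coeLM ℝ)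

lemma det_eq_det_matrixOf (B : Euc N →L[ℝ] Euc N) : B.det = (matrixOf N B).det := by
  simp only [matrixOf, ContinuousLinearMap.det]
  exact (LinearMap.det_toMatrix _ _).symm

lemma matrixOf_one : matrixOf N 1 = 1 := by
  simp only [matrixOf]
  exact LinearMap.toMatrix_one _

lemma trace_matrixOf (B : Euc N →L[ℝ] Euc N) : (matrixOf N B).trace = trace B := by
  simp only [trace, matrixOf, Matrix.trace]
  refine Finset.sum_congr rfl fun i _ => ?_
  simp [LinearMap.toMatrix_apply, EuclideanSpace.inner_single_left]

lemma contDiff_det : ContDiff ℝ 1 (fun B : Euc N →L[ℝ] Euc N => B.det) := by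
  simp only [det_eq_det_matrixOf, Matrix.det_apply]
  refine ContDiff.sum fun σ _ => ContDiff.const_smul _ (contDiff_prod fun i _ => ?_)
  exact (LinearMap.toContinuousLinearMap
    ((LinearMap.proj i).comp ((LinearMap.proj (R := ℝ) (φ := fun _ : Fin N => Fin N → ℝ) (σ i)).comp
      (Matrix.ofLinearEquiv ℝ).symm.toLinearMap ∘ₗ matrixOf N))).contDiff

/-- The determinant is polynomial, hence differentiable, so its derivative may be identified along
lines `1 + s B`. There the coefficient of `s` in the characteristic-type polynomial is the trace. -/
lemma hasFDerivAt_det_one_add : ∃ ℓ : (Euc N →L[ℝ] Euc N) →L[ℝ] ℝ, (∀ B, ℓ B = trace B) ∧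
    HasFDerivAt (fun B : Euc N →L[ℝ] Euc N => (1 + B).det) ℓ 0 := by
  have h1 : Differentiable ℝ (fun B : Euc N →L[ℝ] Euc N => (1 + B).det) :=
    (contDiff_det.differentiable one_ne_zero).comp (differentiable_id.const_add 1)
  refine ⟨_, fun B => ?_, (h1 0).hasFDerivAt⟩
  have h2 : HasDerivAt (fun s : ℝ => (1 + s • B).det)
      (fderiv ℝ (fun B : Euc N →L[ℝ] Euc N => (1 + B).det) 0 B) 0 := by
    have hs : HasDerivAt (fun s : ℝ => s • B) B 0 := by
      simpa using (hasDerivAt_id (0 : ℝ)).smul_const B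
    have h0 : (0 : Euc N →L[ℝ] Euc N) = (0 : ℝ) • B := (zero_smul ℝ B).symm
    have h4 := (h1 0).hasFDerivAt
    rw [h0] at h4
    have h5 := HasFDerivAt.comp_hasDerivAt (0 : ℝ) h4 hs
    rwa [← h0] at h5
  have h3 : HasDerivAt (fun s : ℝ => (1 + s • B).det) (trace B) 0 := by
    have e : (fun s : ℝ => (1 + s • B).det) = fun s => 1 + trace B * s + Polynomial.eval s
        (1 + (Polynomial.X : Polynomial ℝ) • (matrixOf N B).map Polynomial.C).det.divX.divX * s ^ 2 := by
      ext s
      rw [det_eq_det_matrixOf, map_add, map_smul, matrixOf_one, Matrix.det_one_add_smul,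
        trace_matrixOf]
    rw [e]
    set P := (1 + (Polynomial.X : Polynomial ℝ) • (matrixOf N B).map Polynomial.C).det.divX.divX
    have := (((hasDerivAt_id (0 : ℝ)).const_mul (trace B)).const_add 1).add
      ((P.hasDerivAt 0).mul (hasDerivAt_pow 2 (0 : ℝ)))
    refine this.congr_deriv ?_
    simp
  exact h2.unique h3

lemma abs_det_one_add_sub_le {η : ℝ} (hη : 0 < η) :
    ∃ δ > 0, ∀ B : Euc N →L[ℝ] Euc N, ‖B‖ ≤ δ → |(1 + B).det - 1 - trace B| ≤ η * ‖B‖ := by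
  obtain ⟨ℓ, hℓ, h⟩ := hasFDerivAt_det_one_add (N := N)
  rw [hasFDerivAt_iff_isLittleO_nhds_zero] at h
  have h' := h.def hη
  obtain ⟨δ, hδ, hb⟩ := Metric.eventually_nhds_iff.1 h'
  refine ⟨δ / 2, by positivity, fun B hB => ?_⟩
  have := hb (y := B) (by rw [dist_zero_right]; linarith)
  simpa [hℓ, ContinuousLinearMap.det] using this

/-- Here `g = (1 + B)ᵀ p`. Testing this relation with `e = p`, `e = g` and `e = g - p` gives `|p|² =
|g|² - 2 ⟨B g, g⟩ + O(‖B‖² |g|²)` without inverting `1 + B`. -/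
lemma abs_norm_sq_sub_le {B : Euc N →L[ℝ] Euc N} (hbhalf : ‖B‖ ≤ 1 / 2) {g p : Euc N}
    (hgp : ∀ e, inner ℝ g e = inner ℝ p (e + B e)) :
    |‖p‖ ^ 2 - ‖g‖ ^ 2 + 2 * inner ℝ (B g) g| ≤ 8 * ‖B‖ ^ 2 * ‖g‖ ^ 2 := by
  have hb0 := norm_nonneg B
  set b := ‖B‖ with hbdef
  have hgp_le : ‖g - p‖ ≤ b * ‖p‖ := by
    have h2 : ‖g - p‖ ^ 2 ≤ ‖p‖ * (b * ‖g - p‖) := by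
      rw [← real_inner_self_eq_norm_sq]
      have : inner ℝ (g - p) (g - p) = inner ℝ p (B (g - p)) := by
        rw [inner_sub_left, hgp (g - p), inner_add_right]; ring
      rw [this]
      exact (real_inner_le_norm _ _).trans
        (mul_le_mul_of_nonneg_left (B.le_opNorm _) (norm_nonneg _))
    rcases (norm_nonneg (g - p)).eq_or_lt with h0 | h0
    · rw [← h0]; positivity
    · refine le_of_mul_le_mul_right ?_ h0
      nlinarith
  have hp : ‖p‖ ≤ 2 * ‖g‖ := by
    have : ‖p‖ ≤ ‖g‖ + ‖g - p‖ := by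
      have := norm_sub_le g (g - p)
      simpa using this
    nlinarith [norm_nonneg p]
  have hgp2 : ‖g - p‖ ≤ 2 * b * ‖g‖ := by nlinarith [norm_nonneg p]
  set β := inner ℝ (B g) g with hβ
  have hβ' : inner ℝ g (B g) = β := real_inner_comm _ _
  have hsq : ‖p‖ ^ 2 = ‖g‖ ^ 2 - inner ℝ p (B p) - inner ℝ p (B g) := by
    have e1 := hgp p
    have e2 := hgp g
    rw [inner_add_right, real_inner_self_eq_norm_sq] at e1 e2
    rw [real_inner_comm] at e1
    linarith
  have k1 : |inner ℝ p (B p) - β| ≤ 6 * b ^ 2 * ‖g‖ ^ 2 := by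
    have : inner ℝ p (B p) - β = -(inner ℝ (g - p) (B p)) - inner ℝ g (B (g - p)) := by
      rw [map_sub, inner_sub_left, inner_sub_right, hβ']; ring
    rw [this]
    have a1 : |inner ℝ (g - p) (B p)| ≤ (2 * b * ‖g‖) * (b * (2 * ‖g‖)) :=
      (abs_real_inner_le_norm _ _).trans (mul_le_mul hgp2
        ((B.le_opNorm _).trans (mul_le_mul_of_nonneg_left hp hb0)) (norm_nonneg _) (by positivity))
    have a2 : |inner ℝ g (B (g - p))| ≤ ‖g‖ * (b * (2 * b * ‖g‖)) :=
      (abs_real_inner_le_norm _ _).trans (mul_le_mul_of_nonneg_left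
        ((B.le_opNorm _).trans (mul_le_mul_of_nonneg_left hgp2 hb0)) (norm_nonneg _))
    refine (abs_sub _ _).trans ?_
    rw [abs_neg]
    exact (add_le_add a1 a2).trans (le_of_eq (by ring))
  have k2 : |inner ℝ p (B g) - β| ≤ 2 * b ^ 2 * ‖g‖ ^ 2 := by
    have : inner ℝ p (B g) - β = -(inner ℝ (g - p) (B g)) := by
      rw [inner_sub_left, hβ']; ring
    rw [this, abs_neg]
    refine (abs_real_inner_le_norm _ _).trans ((mul_le_mul hgp2 (B.le_opNorm _) (norm_nonneg _)
      (by positivity)).trans (le_of_eq ?_))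
    ring
  have : ‖p‖ ^ 2 - ‖g‖ ^ 2 + 2 * β = -(inner ℝ p (B p) - β) - (inner ℝ p (B g) - β) := by
    rw [hsq]; ring
  rw [this]
  refine (abs_sub _ _).trans ?_
  rw [abs_neg]
  linarith

/-- The arithmetic of the expansion: `D`, `τ`, `P`, `G`, `β` stand for the determinant, the trace,
`|p|²`, `|g|²` and `⟨B g, g⟩`. -/
lemma abs_density_sub_le_aux {n b η ε τ D P G β s : ℝ} (hn : 0 ≤ n) (hb0 : 0 ≤ b) (hε : 0 < ε)
    (hηε : η ≤ ε / 2) (hb3 : b * (8 + 6 * (n + 1)) ≤ ε)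
    (hb1 : |D - 1 - τ| ≤ η * b) (hD1 : |D - 1| ≤ (n + 1) * b) (hG : 0 ≤ G)
    (k4 : |P - G + 2 * β| ≤ 8 * b ^ 2 * G) (k5 : |P - G| ≤ 6 * b * G) :
    |D * (1 / 2 * P + s) - (1 / 2 * G + s) - ((1 / 2 * G + s) * τ - β)| ≤
      ε * b * (G + |s|) := by
  have e : D * (1 / 2 * P + s) - (1 / 2 * G + s) - ((1 / 2 * G + s) * τ - β) =
      s * (D - 1 - τ) + 1 / 2 * ((P - G + 2 * β) + (D - 1) * (P - G) +
        (D - 1 - τ) * G) := by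
    ring
  rw [e]
  have l1 : |s * (D - 1 - τ)| ≤ |s| * (η * b) := by
    rw [abs_mul]; exact mul_le_mul_of_nonneg_left hb1 (abs_nonneg _)
  have l2 : |(D - 1) * (P - G)| ≤ ((n + 1) * b) * (6 * b * G) := by
    rw [abs_mul]; exact mul_le_mul hD1 k5 (abs_nonneg _) (by positivity)
  have l3 : |(D - 1 - τ) * G| ≤ η * b * G := by
    rw [abs_mul, abs_of_nonneg hG]; exact mul_le_mul_of_nonneg_right hb1 hG
  refine (abs_add_le _ _).trans ?_
  rw [abs_mul (1 / 2 : ℝ), abs_of_nonneg (by norm_num : (0 : ℝ) ≤ 1 / 2)]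
  have l4 := abs_add_three (P - G + 2 * β) ((D - 1) * (P - G)) ((D - 1 - τ) * G)
  have l5 : b * (8 + 6 * (n + 1)) * (b * G) ≤ ε * (b * G) :=
    mul_le_mul_of_nonneg_right hb3 (by positivity)
  have l6 : η * b * G ≤ ε / 2 * b * G := by gcongr
  have l7 : |s| * (η * b) ≤ |s| * (ε / 2 * b) := by gcongr
  have l8 : 0 ≤ ε * b * |s| := by positivity
  have l9 : 0 ≤ ε * b * G := by positivity
  have l10 : b * (8 + 6 * (n + 1)) * (b * G) = 8 * b ^ 2 * G + (n + 1) * b * (6 * b * G) := by ring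
  linarith

/-- Pulled-back Dirichlet integrand: if `g = (1 + B)ᵀ p` then, to first order in `B`, the density
`|det (1 + B)| (½ |p|² + s)` is `(½ |g|² + s) (1 + tr B) - ⟨B g, g⟩`. -/
lemma abs_density_sub_le {ε : ℝ} (hε : 0 < ε) :
    ∃ δ > 0, ∀ B : Euc N →L[ℝ] Euc N, ‖B‖ ≤ δ → ∀ (g p : Euc N) (s : ℝ),
      (∀ e, inner ℝ g e = inner ℝ p (e + B e)) →
      |(|(1 + B).det| * (1 / 2 * ‖p‖ ^ 2 + s) - (1 / 2 * ‖g‖ ^ 2 + s) -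
        ((1 / 2 * ‖g‖ ^ 2 + s) * trace B - inner ℝ (B g) g))| ≤
        ε * ‖B‖ * (‖g‖ ^ 2 + |s|) := by
  set η := min (ε / 2) 1 with hη
  have hη0 : 0 < η := lt_min (by positivity) one_pos
  have hη1 : η ≤ 1 := min_le_right _ _
  have hηε : η ≤ ε / 2 := min_le_left _ _
  obtain ⟨δ₁, hδ₁, h₁⟩ := abs_det_one_add_sub_le (N := N) hη0
  -- The first bound serves the expansion of the determinant. The second gives `‖B‖ ≤ 1/2` and `|det
  -- - 1| ≤ 1/2`, so that the absolute value can be dropped. The third absorbs the terms of second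
  -- order in `B`.
  set δ := min δ₁ (min (1 / (2 * ((N : ℝ) + 1))) (ε / (8 + 6 * ((N : ℝ) + 1)))) with hδ
  refine ⟨δ, lt_min hδ₁ (lt_min (by positivity) (by positivity)), fun B hB g p s hgp => ?_⟩
  have hN : (0 : ℝ) ≤ N := Nat.cast_nonneg N
  have hb1 := h₁ B (hB.trans (min_le_left _ _))
  have hb2 : ‖B‖ * (2 * ((N : ℝ) + 1)) ≤ 1 := by
    have := hB.trans ((min_le_right _ _).trans (min_le_left _ _))
    rwa [le_div_iff₀ (by positivity)] at this
  have hb3 : ‖B‖ * (8 + 6 * ((N : ℝ) + 1)) ≤ ε := by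
    have := hB.trans ((min_le_right _ _).trans (min_le_right _ _))
    rwa [le_div_iff₀ (by positivity)] at this
  have htr := abs_trace_le B
  have hb0 := norm_nonneg B
  set b := ‖B‖ with hbdef
  set τ := trace B
  set D := (1 + B).det
  have hbhalf : b ≤ 1 / 2 := by nlinarith
  have hD1 : |D - 1| ≤ ((N : ℝ) + 1) * b := by
    have : D - 1 = (D - 1 - τ) + τ := by ring
    rw [this]
    refine (abs_add_le _ _).trans ?_
    nlinarith
  have hDpos : |D| = D := by
    refine abs_of_nonneg ?_
    have := (abs_le.1 hD1).1
    nlinarith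
  have k4 := abs_norm_sq_sub_le hbhalf hgp
  set β := inner ℝ (B g) g with hβ
  have k3 : |β| ≤ b * ‖g‖ ^ 2 := by
    refine (abs_real_inner_le_norm _ _).trans ?_
    have := B.le_opNorm g
    nlinarith [norm_nonneg g]
  have hG := sq_nonneg ‖g‖
  set G := ‖g‖ ^ 2
  have k5 : |‖p‖ ^ 2 - G| ≤ 6 * b * G := by
    have : ‖p‖ ^ 2 - G = (‖p‖ ^ 2 - G + 2 * β) - 2 * β := by ring
    rw [this]
    refine (abs_sub _ _).trans ?_
    rw [abs_mul, abs_two]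
    have : b ^ 2 * G ≤ 1 / 2 * b * G := by
      refine mul_le_mul_of_nonneg_right ?_ hG
      nlinarith
    linarith
  rw [hDpos]
  exact abs_density_sub_le_aux hN hb0 hε hηε hb3 hb1 hD1 hG k4 k5

end LinearAlgebra

/-! ### Lipschitz perturbations of the identity as changes of variables -/

section BiLipschitz

variable {N : ℕ} {R : Euc N → Euc N} {κ : NNReal}

lemma norm_sub_le_two_mul (hR : LipschitzWith κ R) (hκ : κ ≤ 1 / 2) (x y : Euc N) :
    ‖x - y‖ ≤ 2 * ‖(x + R x) - (y + R y)‖ := by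
  have h1 := hR.norm_sub_le x y
  have h2 : (κ : ℝ) ≤ 1 / 2 := by exact_mod_cast hκ
  have h3 : ‖x - y‖ ≤ ‖(x + R x) - (y + R y)‖ + ‖R x - R y‖ := by
    have := norm_sub_le ((x + R x) - (y + R y)) (R x - R y)
    simpa [add_sub_add_comm] using this
  nlinarith [norm_nonneg (x - y)]

lemma injective_id_add (hR : LipschitzWith κ R) (hκ : κ ≤ 1 / 2) :
    Function.Injective fun x => x + R x := fun x y hxy => by
  have := norm_sub_le_two_mul hR hκ x y
  simp only at hxy
  rw [hxy, sub_self, norm_zero, mul_zero] at this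
  exact sub_eq_zero.1 (norm_le_zero_iff.1 this)

/-- A preimage of `y` is a fixed point of the contraction `z ↦ y - R z`. -/
lemma surjective_id_add (hR : LipschitzWith κ R) (hκ : κ ≤ 1 / 2) :
    Function.Surjective fun x => x + R x := fun y => by
  have hc : ContractingWith κ fun z => y - R z := by
    refine ⟨hκ.trans_lt (by rw [← NNReal.coe_lt_coe]; norm_num), ?_⟩
    refine LipschitzWith.of_dist_le_mul fun a b => ?_
    rw [dist_eq_norm, sub_sub_sub_cancel_left, ← dist_eq_norm, dist_comm]
    exact hR.dist_le_mul a b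
  refine ⟨hc.fixedPoint, ?_⟩
  have h := hc.fixedPoint_isFixedPt
  have h' : y - R hc.fixedPoint = hc.fixedPoint := h
  simp only
  nth_rw 1 [← h']
  simp

lemma lipschitzWith_id_add (hR : LipschitzWith κ R) : LipschitzWith (1 + κ) fun x => x + R x :=
  LipschitzWith.id.add hR

/-- The inverse of `x ↦ x + R x`. -/
lemma exists_inverse_id_add (hR : LipschitzWith κ R) (hκ : κ ≤ 1 / 2) :
    ∃ S : Euc N → Euc N, LipschitzWith 2 S ∧ (∀ x, S (x + R x) = x) ∧ ∀ y, S y + R (S y) = y := by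
  choose S hS using surjective_id_add hR hκ
  refine ⟨S, ?_, fun x => injective_id_add hR hκ (hS _), hS⟩
  refine LipschitzWith.of_dist_le_mul fun a b => ?_
  have := norm_sub_le_two_mul hR hκ (S a) (S b)
  simp only at hS
  rw [hS, hS] at this
  rw [dist_eq_norm, dist_eq_norm]
  exact_mod_cast this

lemma isOpen_image_id_add (hR : LipschitzWith κ R) (hκ : κ ≤ 1 / 2) {U : Set (Euc N)}
    (hU : IsOpen U) : IsOpen ((fun x => x + R x) '' U) := by
  obtain ⟨S, hS, h1, h2⟩ := exists_inverse_id_add hR hκ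
  rw [image_eq_preimage_of_inverse (g := S) h1 h2]
  exact hU.preimage hS.continuous

lemma isBounded_image_id_add (hR : LipschitzWith κ R) {U : Set (Euc N)}
    (hU : Bornology.IsBounded U) : Bornology.IsBounded ((fun x => x + R x) '' U) :=
  (lipschitzWith_id_add hR).isBounded_image hU

/-- Lipschitz maps do not increase null sets of the Hausdorff measure of full dimension, which has
the same null sets as Lebesgue measure. -/
lemma LipschitzWith.image_null {C : NNReal} {T : Euc N → Euc N} (hT : LipschitzWith C T)
    {s : Set (Euc N)} (hs : volume s = 0) : volume (T '' s) = 0 := by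
  set m : Measure (Euc N) := MeasureTheory.Measure.hausdorffMeasure (Module.finrank ℝ (Euc N))
  have h1 : (volume : Measure (Euc N)) ≪ m := Measure.absolutelyContinuous_isAddHaarMeasure _ _
  have h2 : m ≪ (volume : Measure (Euc N)) := Measure.absolutelyContinuous_isAddHaarMeasure _ _
  refine h1 (le_antisymm ?_ zero_le)
  have := hT.hausdorffMeasure_image_le (d := Module.finrank ℝ (Euc N)) (Nat.cast_nonneg _) s
  refine this.trans (le_of_eq ?_)
  rw [show MeasureTheory.Measure.hausdorffMeasure _ s = 0 from h2 hs, mul_zero]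

/-- By Rademacher's theorem the points where `R` is not differentiable form a null set, and so does
their image. Off this set the usual formula for injective differentiable maps applies. -/
lemma setIntegral_image_id_add (hR : LipschitzWith κ R) (hκ : κ ≤ 1 / 2) {U : Set (Euc N)}
    (hU : MeasurableSet U) (f : Euc N → ℝ) :
    ∫ y in (fun x => x + R x) '' U, f y = ∫ x in U, |(1 + fderiv ℝ R x).det| * f (x + R x) := by
  set T : Euc N → Euc N := fun x => x + R x with hT
  set D := {x | DifferentiableAt ℝ R x} with hD
  have hDm : MeasurableSet D := measurableSet_of_differentiableAt ℝ R
  have hD0 : volume Dᶜ = 0 := hR.ae_differentiableAt (μ := (volume : Measure (Euc N)))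
  have e1 : (T '' U : Set (Euc N)) =ᵐ[volume] (T '' (U ∩ D) : Set (Euc N)) := by
    refine (ae_eq_set.2 ⟨?_, ?_⟩)
    · refine measure_mono_null ?_ (LipschitzWith.image_null (lipschitzWith_id_add hR) hD0)
      rintro _ ⟨⟨x, hx, rfl⟩, h⟩
      exact ⟨x, fun hxD => h ⟨x, ⟨hx, hxD⟩, rfl⟩, rfl⟩
    · rw [sdiff_eq_empty.2 (image_mono inter_subset_left)]
      exact measure_empty
  have e2 : (U : Set (Euc N)) =ᵐ[volume] (U ∩ D : Set (Euc N)) := by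
    refine (ae_eq_set.2 ⟨measure_mono_null ?_ hD0, ?_⟩)
    · exact fun x hx h => hx.2 ⟨hx.1, h⟩
    · rw [sdiff_eq_empty.2 inter_subset_left]
      exact measure_empty
  rw [setIntegral_congr_set e1, setIntegral_congr_set e2,
    integral_image_eq_integral_abs_det_fderiv_smul volume (hU.inter hDm)
      (f' := fun x => 1 + fderiv ℝ R x)]
  · rfl
  · exact fun x hx => ((hasFDerivAt_id x).add hx.2.hasFDerivAt).hasFDerivWithinAt
  · exact (injective_id_add hR hκ).injOn

lemma norm_fderiv_le_half (hR : LipschitzWith κ R) (hκ : κ ≤ 1 / 2) (x : Euc N) :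
    ‖fderiv ℝ R x‖ ≤ 1 / 2 :=
  (norm_fderiv_le_of_lipschitz ℝ hR).trans (by exact_mod_cast hκ)

/-- `1 + DR` is invertible by the Neumann series since `‖DR‖ ≤ 1/2`; with a continuous inverse map
this suffices at a single point, without `C¹` regularity. -/
lemma differentiableAt_inverse (hR : LipschitzWith κ R) (hκ : κ ≤ 1 / 2) {S : Euc N → Euc N}
    (hS : LipschitzWith 2 S) (h1 : ∀ x, S (x + R x) = x) (h2 : ∀ y, S y + R (S y) = y)
    {x : Euc N} (hx : DifferentiableAt ℝ R x) : DifferentiableAt ℝ S (x + R x) := by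
  have hlt : ‖-fderiv ℝ R x‖ < 1 := by
    rw [norm_neg]; exact (norm_fderiv_le_half hR hκ x).trans_lt (by norm_num)
  set e := ContinuousLinearEquiv.unitsEquiv ℝ (Euc N) (Units.oneSub (-fderiv ℝ R x) hlt) with he
  have he' : (e : Euc N →L[ℝ] Euc N) = 1 + fderiv ℝ R x := by
    ext1 v
    simp [he]
  refine (HasFDerivAt.of_local_left_inverse (f := fun x => x + R x) (f' := e)
    hS.continuous.continuousAt ?_ (Eventually.of_forall h2)).differentiableAt
  rw [h1, he']
  exact (hasFDerivAt_id x).add hx.hasFDerivAt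

lemma inner_gradient_comp (hx : DifferentiableAt ℝ R x) {φ : Euc N → ℝ}
    (hφ : DifferentiableAt ℝ φ (x + R x)) (e : Euc N) :
    inner ℝ (gradient (fun x => φ (x + R x)) x) e =
      inner ℝ (gradient φ (x + R x)) (e + fderiv ℝ R x e) := by
  have h : HasFDerivAt (fun x => φ (x + R x)) _ x :=
    hφ.hasFDerivAt.comp x ((hasFDerivAt_id x).add hx.hasFDerivAt)
  rw [inner_gradient, inner_gradient, h.fderiv]
  simp

end BiLipschitz

/-! ### Transport of test functions and of the energy -/

section

variable {N : ℕ} {μ : Measure (Euc N)} {U : Set (Euc N)} {R : Euc N → Euc N} {κ : NNReal}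

lemma trace_sub (A B : Euc N →L[ℝ] Euc N) : trace (A - B) = trace A - trace B := by
  simp [trace, inner_sub_right, Finset.sum_sub_distrib]

/-- The map `x ↦ x + R x` as a homeomorphism. -/
lemma exists_homeomorph_id_add (hR : LipschitzWith κ R) (hκ : κ ≤ 1 / 2) :
    ∃ e : Euc N ≃ₜ Euc N, (∀ x, e x = x + R x) ∧ LipschitzWith 2 e.symm := by
  obtain ⟨S, hS, h1, h2⟩ := exists_inverse_id_add hR hκ
  exact ⟨⟨⟨fun x => x + R x, S, h1, h2⟩, (lipschitzWith_id_add hR).continuous, hS.continuous⟩,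
    fun _ => rfl, hS⟩

/-- `φ` on the image of `U` under `x ↦ x + R x` and its pull-back `ψ` to `U`. -/
structure IsTransport (U : Set (Euc N)) (R : Euc N → Euc N) (φ ψ : Euc N → ℝ) : Prop where
  lipschitz : ∃ C, LipschitzWith C φ
  compact : HasCompactSupport φ
  subset : tsupport φ ⊆ (fun x => x + R x) '' U
  lipschitz' : ∃ C, LipschitzWith C ψ
  compact' : HasCompactSupport ψ
  subset' : tsupport ψ ⊆ U
  eq : ∀ x, ψ x = φ (x + R x)
  inner_eq : ∀ᵐ x, ∀ e,
    inner ℝ (gradient ψ x) e = inner ℝ (gradient φ (x + R x)) (e + fderiv ℝ R x e)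

/-- The direction used for lower bounds: competitors on the image are pulled back to `U`.
Rademacher's theorem for `R` gives the relation between the gradients almost everywhere. -/
lemma IsTest.isTransport (hR : LipschitzWith κ R) (hκ : κ ≤ 1 / 2) {φ : Euc N → ℝ}
    (hφ : IsTest ((fun x => x + R x) '' U) φ) : IsTransport U R φ fun x => φ (x + R x) := by
  obtain ⟨e, he, -⟩ := exists_homeomorph_id_add hR hκ
  obtain ⟨C, hC⟩ := hφ.1.lipschitzWith_of_hasCompactSupport hφ.2.1 (by simp)
  have heq : (fun x => φ (x + R x)) = φ ∘ e := funext fun x => by simp [he]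
  refine ⟨⟨C, hC⟩, hφ.2.1, hφ.2.2, ⟨_, hC.comp (lipschitzWith_id_add hR)⟩, ?_, ?_, fun _ => rfl, ?_⟩
  · rw [heq]; exact hφ.2.1.comp_homeomorph e
  · rw [heq, tsupport_comp_eq_preimage]
    intro x hx
    obtain ⟨y, hy, hyx⟩ := hφ.2.2 hx
    have hyx' : y + R y = x + R x := by rw [← he x]; exact hyx
    rwa [← injective_id_add hR hκ hyx']
  · filter_upwards [hR.ae_differentiableAt (μ := (volume : Measure (Euc N)))] with x hx v
    exact inner_gradient_comp hx (hφ.differentiable _) v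

/-- The direction used for upper bounds: competitors on `U` are pushed forward by the Lipschitz
inverse. -/
lemma IsTest.exists_isTransport (hR : LipschitzWith κ R) (hκ : κ ≤ 1 / 2) {ψ : Euc N → ℝ}
    (hψ : IsTest U ψ) : ∃ φ, IsTransport U R φ ψ := by
  obtain ⟨e, he, hS⟩ := exists_homeomorph_id_add hR hκ
  obtain ⟨C, hC⟩ := hψ.1.lipschitzWith_of_hasCompactSupport hψ.2.1 (by simp)
  have h1 : ∀ x, e.symm (x + R x) = x := fun x => by rw [← he, e.symm_apply_apply]
  have h2 : ∀ y, e.symm y + R (e.symm y) = y := fun y => by rw [← he, e.apply_symm_apply]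
  have hcomp : ∀ x, (ψ ∘ e.symm) (x + R x) = ψ x := fun x => by simp [h1]
  refine ⟨ψ ∘ e.symm, ⟨_, hC.comp hS⟩, hψ.2.1.comp_homeomorph e.symm, ?_, ⟨C, hC⟩, hψ.2.1, hψ.2.2,
    fun x => (hcomp x).symm, ?_⟩
  · rw [tsupport_comp_eq_preimage]
    intro x hx
    exact ⟨e.symm x, hψ.2.2 hx, h2 x⟩
  · filter_upwards [hR.ae_differentiableAt (μ := (volume : Measure (Euc N)))] with x hx v
    have hd : DifferentiableAt ℝ (ψ ∘ e.symm) (x + R x) :=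
      (hψ.differentiable _).comp _ (differentiableAt_inverse hR hκ hS h1 h2 hx)
    rw [← inner_gradient_comp hx hd v]
    simp only [hcomp]

lemma IsTransport.memH10 [IsFiniteMeasure μ] {φ ψ : Euc N → ℝ} (h : IsTransport U R φ ψ)
    (hR : LipschitzWith κ R) (hκ : κ ≤ 1 / 2) (hU : IsOpen U) :
    MemH10 μ ((fun x => x + R x) '' U) φ (gradient φ) := by
  obtain ⟨C, hC⟩ := h.lipschitz
  exact memH10_of_lipschitz (isOpen_image_id_add hR hκ hU) hC h.compact h.subset

lemma IsTransport.memH10' [IsFiniteMeasure μ] {φ ψ : Euc N → ℝ} (h : IsTransport U R φ ψ)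
    (hU : IsOpen U) : MemH10 μ U ψ (gradient ψ) := by
  obtain ⟨C, hC⟩ := h.lipschitz'
  exact memH10_of_lipschitz hU hC h.compact' h.subset'

lemma ae_mem_of_support_subset {V : Set (Euc N)} (h : μ.support ⊆ V) : ∀ᵐ x ∂μ, x ∈ V := by
  have : ∀ᵐ x ∂μ, x ∈ μ.support := Measure.support_mem_ae
  filter_upwards [this] with x hx using h hx

/-- Since `R` vanishes on the support of `μ`, the load against `μ` does not feel the deformation;
the volume integrals change by the Jacobian. -/
lemma IsTransport.energy_image [IsFiniteMeasure μ] {φ ψ : Euc N → ℝ} (h : IsTransport U R φ ψ)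
    (hR : LipschitzWith κ R) (hκ : κ ≤ 1 / 2) (hU : IsOpen U)
    (hμU : μ.support ⊆ U) (hR0 : ∀ x ∈ μ.support, R x = 0) :
    energy μ ((fun x => x + R x) '' U) φ (gradient φ) =
      (∫ x in U, |(1 + fderiv ℝ R x).det| * (1 / 2 * ‖gradient φ (x + R x)‖ ^ 2 + ψ x)) -
        ∫ x in U, ψ x ∂μ := by
  have hm := h.memH10 (μ := μ) hR hκ hU
  have e1 : (∫ x in (fun x => x + R x) '' U, φ x ∂μ) = ∫ x in U, ψ x ∂μ := by
    have a1 : μ.restrict ((fun x => x + R x) '' U) = μ :=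
      Measure.restrict_eq_self_of_ae_mem (ae_mem_of_support_subset fun x hx =>
        ⟨x, hμU hx, by simp [hR0 x hx]⟩)
    have a2 : μ.restrict U = μ :=
      Measure.restrict_eq_self_of_ae_mem (ae_mem_of_support_subset hμU)
    rw [a1, a2]
    refine integral_congr_ae ?_
    filter_upwards [ae_mem_of_support_subset (μ := μ) le_rfl] with x hx
    rw [h.eq, hR0 x hx, add_zero]
  have hφi : Integrable φ := by
    obtain ⟨C, hC⟩ := h.lipschitz
    exact hC.continuous.integrable_of_hasCompactSupport h.compact
  rw [energy, e1, ← add_sub_assoc, ← integral_add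
    ((integrable_norm_sq_of_memLp hm.2.1).const_mul _).integrableOn hφi.integrableOn,
    setIntegral_image_id_add hR hκ hU.measurableSet]
  simp only [h.eq]

/-- The first variation of the energy in the direction of the field `Y`. -/
noncomputable def shapeGrad (U : Set (Euc N)) (w : Euc N → ℝ) (H Y : Euc N → Euc N) : ℝ :=
  ∫ x in U, ((1 / 2 * ‖H x‖ ^ 2 + w x) * trace (fderiv ℝ Y x) - inner ℝ (fderiv ℝ Y x (H x)) (H x))

lemma abs_trace_sub_inner_le (B : Euc N →L[ℝ] Euc N) (g : Euc N) (s : ℝ) :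
    |(1 / 2 * ‖g‖ ^ 2 + s) * trace B - inner ℝ (B g) g| ≤
      ((N : ℝ) + 1) * ‖B‖ * (‖g‖ ^ 2 + |s|) := by
  refine (abs_sub _ _).trans ?_
  have h1 : |inner ℝ (B g) g| ≤ ‖B‖ * ‖g‖ ^ 2 := by
    refine (abs_real_inner_le_norm _ _).trans ?_
    have := B.le_opNorm g
    nlinarith [norm_nonneg g]
  have h2 : |(1 / 2 * ‖g‖ ^ 2 + s) * trace B| ≤ (‖g‖ ^ 2 + |s|) * (N * ‖B‖) := by
    rw [abs_mul]
    refine mul_le_mul ?_ (abs_trace_le B) (abs_nonneg _) (by positivity)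
    refine (abs_add_le _ _).trans (add_le_add ?_ le_rfl)
    rw [abs_of_nonneg (by positivity)]
    nlinarith [sq_nonneg ‖g‖]
  have h3 : 0 ≤ ‖B‖ * |s| := by positivity
  nlinarith

lemma integrableOn_shapeGrad {w : Euc N → ℝ} {H Y : Euc N → Euc N} (hU : Bornology.IsBounded U)
    (hw : MemLp w 2 volume) (hH : MemLp H 2 volume) (hY : ContDiff ℝ 1 Y) {a : ℝ}
    (ha : ∀ x, ‖fderiv ℝ Y x‖ ≤ a) :
    IntegrableOn (fun x => (1 / 2 * ‖H x‖ ^ 2 + w x) * trace (fderiv ℝ Y x) -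
      inner ℝ (fderiv ℝ Y x (H x)) (H x)) U := by
  have hfin : IsFiniteMeasure (volume.restrict U) := ⟨by simpa using hU.measure_lt_top⟩
  have hcY := hY.continuous_fderiv one_ne_zero
  have hct : Continuous fun x => trace (fderiv ℝ Y x) := by
    unfold trace
    exact continuous_finsetSum _ fun i _ =>
      continuous_const.inner (hcY.clm_apply continuous_const)
  have hwi : IntegrableOn w U := (hw.restrict U).integrable (by norm_num)
  refine Integrable.mono' (g := fun x => ((N : ℝ) + 1) * a * (‖H x‖ ^ 2 + |w x|)) ?_ ?_ ?_
  · exact ((integrable_norm_sq_of_memLp (hH.restrict U)).add hwi.abs).const_mul _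
  · refine AEStronglyMeasurable.sub ?_ ?_
    · exact ((((hH.restrict U).1.norm.pow 2).const_mul _).add (hw.restrict U).1).mul
        hct.aestronglyMeasurable
    · refine AEStronglyMeasurable.inner ?_ (hH.restrict U).1
      exact (ContinuousLinearMap.apply ℝ (Euc N)).flip.aestronglyMeasurable_comp₂
        hcY.aestronglyMeasurable (hH.restrict U).1
  · refine Eventually.of_forall fun x => ?_
    rw [Real.norm_eq_abs]
    refine (abs_trace_sub_inner_le _ _ _).trans ?_
    have := ha x
    gcongr

/-- The pointwise expansion is applied with `B = DR`, and then `DR` is replaced by `t DY` in its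
first order part, which is linear in `B`. The threshold `δ` depends only on `Y`, `a`, `ε` and the
dimension, so the estimate is uniform over all competitors. -/
lemma IsTransport.abs_energy_sub_le {Y : Euc N → Euc N} (hY : ContDiff ℝ 1 Y) {a : ℝ}
    (ha : ∀ x, ‖fderiv ℝ Y x‖ ≤ a) {ε : ℝ} (hε : 0 < ε) :
    ∃ δ > 0, ∀ (μ : Measure (Euc N)) (_ : IsFiniteMeasure μ) (U : Set (Euc N)) (R : Euc N → Euc N)
      (κ : NNReal) (t : ℝ) (φ ψ : Euc N → ℝ), |t| ≤ δ → LipschitzWith κ R → κ ≤ 1 / 2 →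
      (∀ x ∈ μ.support, R x = 0) →
      (∀ᵐ x, ‖fderiv ℝ R x - t • fderiv ℝ Y x‖ ≤ δ * |t|) → IsOpen U → Bornology.IsBounded U →
      μ.support ⊆ U → IsTransport U R φ ψ →
      |energy μ ((fun x => x + R x) '' U) φ (gradient φ) - energy μ U ψ (gradient ψ) -
        t * shapeGrad U ψ (gradient ψ) Y| ≤
        ε * |t| * ∫ x in U, (‖gradient ψ x‖ ^ 2 + |ψ x|) := by
  have ha0 : 0 ≤ a := (norm_nonneg _).trans (ha 0)
  set ε₁ := ε / (2 * (a + 1)) with hε₁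
  have hε₁0 : 0 < ε₁ := by positivity
  obtain ⟨δ₁, hδ₁, hden⟩ := abs_density_sub_le (N := N) hε₁0
  -- With `δ ≤ 1` one has `‖DR‖ ≤ (a + 1) |t|`, which the second bound makes at most `δ₁`; the third
  -- bound handles the replacement of `DR` by `t DY`. Each of the two errors takes half of `ε`.
  set δ := min 1 (min (δ₁ / (a + 1)) (ε / (2 * ((N : ℝ) + 1)))) with hδ
  refine ⟨δ, lt_min one_pos (lt_min (by positivity) (by positivity)), ?_⟩
  intro μ _ U R κ t φ ψ ht hR hκ hR0 hRY hUo hU hμU h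
  have hδ1 : δ ≤ 1 := min_le_left _ _
  have hδ2 : δ * (a + 1) ≤ δ₁ := by
    rw [← le_div_iff₀ (by positivity)]; exact (min_le_right _ _).trans (min_le_left _ _)
  have hδ3 : δ * (2 * ((N : ℝ) + 1)) ≤ ε := by
    rw [← le_div_iff₀ (by positivity)]; exact (min_le_right _ _).trans (min_le_right _ _)
  have hm := h.memH10' (μ := μ) hUo
  have hfin : IsFiniteMeasure (volume.restrict U) := ⟨by simpa using hU.measure_lt_top⟩
  have hψi : IntegrableOn ψ U := (hm.1.restrict U).integrable (by norm_num)
  have hgi := integrable_norm_sq_of_memLp (hm.2.1.restrict U)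
  set h1 : Euc N → ℝ := fun x => |(1 + fderiv ℝ R x).det| *
    (1 / 2 * ‖gradient φ (x + R x)‖ ^ 2 + ψ x) with hh1
  set h2 : Euc N → ℝ := fun x => 1 / 2 * ‖gradient ψ x‖ ^ 2 + ψ x with hh2
  set h3 : Euc N → ℝ := fun x => (1 / 2 * ‖gradient ψ x‖ ^ 2 + ψ x) * trace (fderiv ℝ Y x) -
      inner ℝ (fderiv ℝ Y x (gradient ψ x)) (gradient ψ x) with hh3
  set h4 : Euc N → ℝ := fun x => ‖gradient ψ x‖ ^ 2 + |ψ x| with hh4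
  have i2 : IntegrableOn h2 U := (hgi.const_mul _).add hψi
  have i3 : IntegrableOn h3 U := integrableOn_shapeGrad hU hm.1 hm.2.1 hY ha
  have i4 : IntegrableOn h4 U := hgi.add hψi.abs
  have hpt : ∀ᵐ x ∂(volume.restrict U), |h1 x - h2 x - t * h3 x| ≤ ε * |t| * h4 x := by
    filter_upwards [ae_restrict_of_ae h.inner_eq, ae_restrict_of_ae hRY] with x hx1 hx2
    have hB : ‖fderiv ℝ R x‖ ≤ (a + 1) * |t| := by
      have e : fderiv ℝ R x = (fderiv ℝ R x - t • fderiv ℝ Y x) + t • fderiv ℝ Y x := by abel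
      rw [e]
      refine (norm_add_le _ _).trans ?_
      rw [norm_smul, Real.norm_eq_abs]
      nlinarith [abs_nonneg t, ha x]
    have hB1 : ‖fderiv ℝ R x‖ ≤ δ₁ := by nlinarith [abs_nonneg t]
    have k1 := hden _ hB1 _ _ (ψ x) hx1
    have k2 := abs_trace_sub_inner_le (fderiv ℝ R x - t • fderiv ℝ Y x) (gradient ψ x) (ψ x)
    have hh4x : 0 ≤ h4 x := by positivity
    have e : h1 x - h2 x - t * h3 x = (h1 x - h2 x - ((1 / 2 * ‖gradient ψ x‖ ^ 2 + ψ x) *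
        trace (fderiv ℝ R x) - inner ℝ (fderiv ℝ R x (gradient ψ x)) (gradient ψ x))) +
        ((1 / 2 * ‖gradient ψ x‖ ^ 2 + ψ x) * trace (fderiv ℝ R x - t • fderiv ℝ Y x) -
          inner ℝ ((fderiv ℝ R x - t • fderiv ℝ Y x) (gradient ψ x)) (gradient ψ x)) := by
      have : trace (fderiv ℝ R x - t • fderiv ℝ Y x) =
          trace (fderiv ℝ R x) - t * trace (fderiv ℝ Y x) := by
        rw [trace_sub, trace_smul]
      rw [this, FunLike.coe_sub, Pi.sub_apply, FunLike.coe_smul, Pi.smul_apply,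
        inner_sub_left, real_inner_smul_left]
      simp only [hh3]
      ring
    rw [e]
    refine (abs_add_le _ _).trans ((add_le_add k1 k2).trans ?_)
    change ε₁ * _ * h4 x + _ * _ * h4 x ≤ _
    rw [← add_mul]
    refine mul_le_mul_of_nonneg_right ?_ hh4x
    have m1 : ε₁ * ‖fderiv ℝ R x‖ ≤ ε / 2 * |t| := by
      have : ε₁ * ((a + 1) * |t|) = ε / 2 * |t| := by rw [hε₁]; field_simp
      rw [← this]
      exact mul_le_mul_of_nonneg_left hB hε₁0.le
    have m2 : ((N : ℝ) + 1) * ‖fderiv ℝ R x - t • fderiv ℝ Y x‖ ≤ ε / 2 * |t| := by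
      have hn : (0 : ℝ) ≤ (N : ℝ) + 1 := by positivity
      nlinarith [abs_nonneg t, mul_le_mul_of_nonneg_left hx2 hn]
    linarith
  -- Integrability of the transported density follows from the expansion itself, which dominates it
  -- by integrable functions.
  have i1 : IntegrableOn h1 U := by
    have hmeas : Measurable h1 := by
      have hRc := hR.continuous
      obtain ⟨C, hC⟩ := h.lipschitz'
      refine Measurable.mul ?_ ?_
      · exact ((contDiff_det.continuous.measurable).comp
          ((measurable_fderiv ℝ R).const_add 1)).abs
      · refine Measurable.add ?_ hC.continuous.measurable
        exact (((measurable_gradient φ).comp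
          (continuous_id.add hRc).measurable).norm.pow_const 2).const_mul _
    refine Integrable.mono' (((i2.abs).add ((i3.abs).const_mul |t|)).add (i4.const_mul (ε * |t|)))
      hmeas.aestronglyMeasurable ?_
    filter_upwards [hpt] with x hx
    rw [Real.norm_eq_abs]
    have e : h1 x = h2 x + t * h3 x + (h1 x - h2 x - t * h3 x) := by ring
    rw [e]
    refine (abs_add_three _ _ _).trans ?_
    rw [abs_mul]
    simp only [Pi.add_apply]
    linarith
  rw [h.energy_image hR hκ hUo hμU hR0]
  have e2 : energy μ U ψ (gradient ψ) = (∫ x in U, h2 x) - ∫ x in U, ψ x ∂μ := by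
    rw [energy, ← add_sub_assoc, ← integral_add (hgi.const_mul _) hψi]
  have e3 : shapeGrad U ψ (gradient ψ) Y = ∫ x in U, h3 x := rfl
  have e4 : (∫ x in U, h1 x) - (∫ x in U, ψ x ∂μ) - ((∫ x in U, h2 x) - ∫ x in U, ψ x ∂μ) -
      t * (∫ x in U, h3 x) = ∫ x in U, (h1 x - h2 x - t * h3 x) := by
    rw [integral_sub (f := fun x => h1 x - h2 x) (i1.sub i2) (i3.const_mul t), integral_sub i1 i2, integral_const_mul]
    ring
  rw [e2, e3, e4, ← integral_const_mul]
  refine (abs_integral_le_integral_abs).trans ?_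
  exact integral_mono_ae ((i1.sub i2).sub (i3.const_mul t)).abs (i4.const_mul _) hpt

end

/-! ### Differentiability of the shape functional -/

section

variable {N : ℕ} {μ : Measure (Euc N)} {U : Set (Euc N)}

lemma integral_abs_le_sqrt (hU : Bornology.IsBounded U) {f : Euc N → ℝ} (hf : MemLp f 2 volume) :
    ∫ x in U, |f x| ≤ Real.sqrt ((volume U).toReal * ∫ x in U, f x ^ 2) := by
  have h := sq_setIntegral_le (ν := volume) hU.measure_lt_top.ne (hf.abs.restrict U)
  refine Real.le_sqrt_of_sq_le (h.trans (le_of_eq ?_))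
  congr 1
  refine integral_congr_ae (Eventually.of_forall fun x => ?_)
  simp

lemma integral_norm_mul_norm_le {F : Type*} [NormedAddCommGroup F] [InnerProductSpace ℝ F]
    {ν : Measure (Euc N)} {G H : Euc N → F}
    (hG : MemLp G 2 ν) (hH : MemLp H 2 ν) :
    ∫ x, ‖G x‖ * ‖H x‖ ∂ν ≤
      Real.sqrt (∫ x, ‖G x‖ ^ 2 ∂ν) * Real.sqrt (∫ x, ‖H x‖ ^ 2 ∂ν) := by
  rw [← Real.sqrt_mul (integral_nonneg fun _ => sq_nonneg _)]
  refine Real.le_sqrt_of_sq_le ?_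
  have := sq_integral_inner_le hG.norm hH.norm
  simpa [mul_comm] using this

/-- The first variation is quadratic in the gradient and affine in the function. Its increment is
therefore bounded by the `L²` distance of the gradients and its square, with Poincaré's inequality
for the zeroth order term. -/
lemma exists_abs_shapeGrad_sub_le (hN : 1 ≤ N) [IsFiniteMeasure μ] (hμ : HasFiniteEnergy μ)
    (hU : Bornology.IsBounded U) {u : Euc N → ℝ} {G : Euc N → Euc N} (hu : MemH10 μ U u G)
    {Y : Euc N → Euc N} (hY : ContDiff ℝ 1 Y) {a : ℝ} (ha : ∀ x, ‖fderiv ℝ Y x‖ ≤ a) :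
    ∃ C, 0 ≤ C ∧ ∀ w H, MemH10 μ U w H →
      |shapeGrad U w H Y - shapeGrad U u G Y| ≤
        C * (Real.sqrt (∫ x in U, ‖H x - G x‖ ^ 2) + ∫ x in U, ‖H x - G x‖ ^ 2) := by
  have ha0 : 0 ≤ a := (norm_nonneg _).trans (ha 0)
  obtain ⟨K, hK0, hK⟩ := exists_poincare_sub hN hμ hU
  set V := (volume U).toReal
  set g := Real.sqrt (∫ x in U, ‖G x‖ ^ 2)
  set A := ((N : ℝ) + 2) * a with hA
  have hA0 : 0 ≤ A := by positivity
  refine ⟨A * (g + 1 + Real.sqrt (V * K)), by positivity, fun w H hw => ?_⟩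
  have hfin : IsFiniteMeasure (volume.restrict U) := ⟨by simpa using hU.measure_lt_top⟩
  have hm := hw.2.1.sub hu.2.1
  have hmw := hw.1.sub hu.1
  have i1 : IntegrableOn (fun x => ‖G x‖ * ‖H x - G x‖) U := by
    have := integrable_inner_of_memLp (hm.norm.restrict U) (hu.2.1.norm.restrict U)
    simpa [IntegrableOn] using this
  have i2 : IntegrableOn (fun x => ‖H x - G x‖ ^ 2) U :=
    integrable_norm_sq_of_memLp (hm.restrict U)
  have i3 : IntegrableOn (fun x => |w x - u x|) U :=
    ((hmw.restrict U).integrable (by norm_num)).abs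
  have hsplit : |shapeGrad U w H Y - shapeGrad U u G Y| ≤
      ∫ x in U, A * (‖G x‖ * ‖H x - G x‖ + ‖H x - G x‖ ^ 2 + |w x - u x|) := by
    rw [shapeGrad, shapeGrad, ← integral_sub (integrableOn_shapeGrad hU hw.1 hw.2.1 hY ha)
      (integrableOn_shapeGrad hU hu.1 hu.2.1 hY ha)]
    refine (abs_integral_le_integral_abs).trans ?_
    refine integral_mono ((integrableOn_shapeGrad hU hw.1 hw.2.1 hY ha).sub
      (integrableOn_shapeGrad hU hu.1 hu.2.1 hY ha)).abs (((i1.add i2).add i3).const_mul _)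
      fun x => ?_
    simp only
    set B := fderiv ℝ Y x
    set d := H x - G x with hd
    have hH : H x = G x + d := by rw [hd]; abel
    have e : (1 / 2 * ‖H x‖ ^ 2 + w x) * trace B - inner ℝ (B (H x)) (H x) -
        ((1 / 2 * ‖G x‖ ^ 2 + u x) * trace B - inner ℝ (B (G x)) (G x)) =
        (inner ℝ (G x) d + 1 / 2 * ‖d‖ ^ 2 + (w x - u x)) * trace B -
          (inner ℝ (B (G x)) d + inner ℝ (B d) (G x) + inner ℝ (B d) d) := by
      rw [hH, norm_add_sq_real, map_add, inner_add_left, inner_add_right, inner_add_right]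
      ring
    rw [e]
    have t1 : |trace B| ≤ N * a :=
      (abs_trace_le B).trans (mul_le_mul_of_nonneg_left (ha x) (Nat.cast_nonneg N))
    have t2 : |inner ℝ (G x) d + 1 / 2 * ‖d‖ ^ 2 + (w x - u x)| ≤
        ‖G x‖ * ‖d‖ + ‖d‖ ^ 2 + |w x - u x| := by
      refine (abs_add_three _ _ _).trans ?_
      rw [abs_of_nonneg (by positivity : 0 ≤ 1 / 2 * ‖d‖ ^ 2)]
      nlinarith [abs_real_inner_le_norm (G x) d, sq_nonneg ‖d‖]
    have t3 : ∀ p q : Euc N, |inner ℝ (B p) q| ≤ a * (‖p‖ * ‖q‖) := fun p q => by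
      refine (abs_real_inner_le_norm _ _).trans ?_
      have := (B.le_opNorm p).trans (mul_le_mul_of_nonneg_right (ha x) (norm_nonneg p))
      nlinarith [norm_nonneg q]
    refine (abs_sub _ _).trans ?_
    rw [abs_mul]
    have t4 := mul_le_mul t2 t1 (abs_nonneg _) (by positivity)
    have t5 := abs_add_three (inner ℝ (B (G x)) d) (inner ℝ (B d) (G x)) (inner ℝ (B d) d)
    have t6 := t3 (G x) d
    have t7 := t3 d (G x)
    have t8 := t3 d d
    have t9 : 0 ≤ a * |w x - u x| := by positivity
    have t10 : 0 ≤ a * ‖d‖ ^ 2 := by positivity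
    rw [hA]
    nlinarith
  refine hsplit.trans ?_
  rw [integral_const_mul, integral_add (by exact i1.add i2) i3, integral_add i1 i2, mul_assoc A]
  refine mul_le_mul_of_nonneg_left ?_ hA0
  have n1 := integral_norm_mul_norm_le (hu.2.1.restrict U) (hm.restrict U)
  have n2 := integral_abs_le_sqrt hU hmw
  have n3 := hK u G w H hu hw
  simp only [Pi.sub_apply] at n1 n2
  set D := ∫ x in U, ‖H x - G x‖ ^ 2
  have hD : 0 ≤ D := integral_nonneg fun _ => sq_nonneg _
  have n4 : Real.sqrt (V * ∫ x in U, (w x - u x) ^ 2) ≤ Real.sqrt (V * K) * Real.sqrt D := by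
    rw [← Real.sqrt_mul (by positivity)]
    refine Real.sqrt_le_sqrt ?_
    rw [mul_assoc]
    exact mul_le_mul_of_nonneg_left n3 ENNReal.toReal_nonneg
  have n5 : 0 ≤ g * D := by positivity
  have n6 : 0 ≤ Real.sqrt (V * K) * D := by positivity
  have n7 := Real.sqrt_nonneg D
  change ∫ x in U, ‖G x‖ * ‖H x - G x‖ ≤ g * Real.sqrt D at n1
  nlinarith

/-- The quantitative expansion of the energy of transported functions around the state. -/
lemma exists_abs_energy_transport_le (hN : 1 ≤ N) [IsFiniteMeasure μ] (hμ : HasFiniteEnergy μ)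
    (hUo : IsOpen U) (hU : Bornology.IsBounded U) (hμU : μ.support ⊆ U) {u : Euc N → ℝ}
    {G : Euc N → Euc N} (hu : IsState μ U u G) {Y : Euc N → Euc N} (hY : ContDiff ℝ 1 Y) {a : ℝ}
    (ha : ∀ x, ‖fderiv ℝ Y x‖ ≤ a) :
    ∃ C, 0 ≤ C ∧ ∀ ε > 0, ∃ δ > 0, ∀ (R : Euc N → Euc N) (κ : NNReal) (t : ℝ) (φ ψ : Euc N → ℝ),
      |t| ≤ δ → LipschitzWith κ R → κ ≤ 1 / 2 → (∀ x ∈ μ.support, R x = 0) →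
      (∀ᵐ x, ‖fderiv ℝ R x - t • fderiv ℝ Y x‖ ≤ δ * |t|) → IsTransport U R φ ψ →
      |energy μ ((fun x => x + R x) '' U) φ (gradient φ) - energy μ U u G -
        1 / 2 * (∫ x in U, ‖gradient ψ x - G x‖ ^ 2) - t * shapeGrad U u G Y| ≤
        |t| * (C * (Real.sqrt (∫ x in U, ‖gradient ψ x - G x‖ ^ 2) +
          ∫ x in U, ‖gradient ψ x - G x‖ ^ 2) +
          ε * (1 + ∫ x in U, ‖gradient ψ x - G x‖ ^ 2)) := by
  obtain ⟨K, hK0, hK⟩ := exists_poincare_sub hN hμ hU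
  obtain ⟨C, hC0, hC⟩ := exists_abs_shapeGrad_sub_le hN hμ hU hu.1 hY ha
  have hfin : IsFiniteMeasure (volume.restrict U) := ⟨by simpa using hU.measure_lt_top⟩
  set V := (volume U).toReal
  set I := ∫ x in U, ‖G x‖ ^ 2
  set J := ∫ x in U, u x ^ 2
  have hI : 0 ≤ I := integral_nonneg fun _ => sq_nonneg _
  have hJ : 0 ≤ J := integral_nonneg fun _ => sq_nonneg _
  -- Chosen so that `∫_U (|∇ψ|² + |ψ|) ≤ M (1 + D)`, using `|∇ψ|² ≤ 2|G|² + 2|∇ψ - G|²` and `|ψ| ≤ 1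
  -- + 2u² + 2(ψ - u)²`.
  set M := 2 * I + V + 2 * J + (2 + 2 * K) with hM
  have hM0 : 0 < M := by positivity
  refine ⟨C, hC0, fun ε hε => ?_⟩
  obtain ⟨δ, hδ, h⟩ := IsTransport.abs_energy_sub_le hY ha (ε := ε / M) (by positivity)
  refine ⟨δ, hδ, fun R κ t φ ψ ht hR hκ hR0 hRY hT => ?_⟩
  have h1 := h μ inferInstance U R κ t φ ψ ht hR hκ hR0 hRY hUo hU hμU hT
  have hm := hT.memH10' (μ := μ) hUo
  have h2 := hC _ _ hm
  have h3 := hu.energy_eq_add hU hm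
  have h4 := hK u G _ _ hu.1 hm
  have j1 := integrable_norm_sq_of_memLp (hm.2.1.restrict U)
  have j2 : Integrable (fun x => ψ x ^ 2) (volume.restrict U) := by
    simpa using integrable_norm_sq_of_memLp (hm.1.restrict U)
  have j3 : IntegrableOn ψ U := (hm.1.restrict U).integrable (by norm_num)
  have j4 := integrable_norm_sq_of_memLp ((hm.2.1.sub hu.1.2.1).restrict U)
  have j5 : Integrable (fun x => (ψ x - u x) ^ 2) (volume.restrict U) := by
    simpa using integrable_norm_sq_of_memLp ((hm.1.sub hu.1.1).restrict U)
  have j6 := integrable_norm_sq_of_memLp (hu.1.2.1.restrict U)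
  have j7 : Integrable (fun x => u x ^ 2) (volume.restrict U) := by
    simpa using integrable_norm_sq_of_memLp (hu.1.1.restrict U)
  set D := ∫ x in U, ‖gradient ψ x - G x‖ ^ 2
  have hD : 0 ≤ D := integral_nonneg fun _ => sq_nonneg _
  have h5 : ∫ x in U, (‖gradient ψ x‖ ^ 2 + |ψ x|) ≤ M * (1 + D) := by
    rw [integral_add j1 j3.abs]
    have l1 : ∫ x in U, ‖gradient ψ x‖ ^ 2 ≤ 2 * I + 2 * D := by
      rw [← integral_const_mul, ← integral_const_mul, ← integral_add (j6.const_mul _)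
        (by exact j4.const_mul _)]
      refine integral_mono j1 ((j6.const_mul _).add (j4.const_mul _)) fun x => ?_
      have : gradient ψ x = G x + (gradient ψ x - G x) := by abel
      have h' := norm_add_le (G x) (gradient ψ x - G x)
      rw [← this] at h'
      nlinarith [sq_nonneg (‖G x‖ - ‖gradient ψ x - G x‖), norm_nonneg (gradient ψ x)]
    have l2 : ∫ x in U, |ψ x| ≤ V + (2 * J + 2 * ∫ x in U, (ψ x - u x) ^ 2) := by
      have hV : V = ∫ x in U, (1 : ℝ) := by simp [V, Measure.real]
      rw [hV, ← integral_const_mul, ← integral_const_mul, ← integral_add (j7.const_mul _)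
        (j5.const_mul _), ← integral_add (integrable_const _)
        (by exact (j7.const_mul _).add (j5.const_mul _))]
      refine integral_mono j3.abs ((integrable_const _).add ((j7.const_mul _).add (j5.const_mul _)))
        fun x => ?_
      rcases abs_cases (ψ x) with ⟨h0, _⟩ | ⟨h0, _⟩ <;> rw [h0] <;>
        nlinarith [sq_nonneg (ψ x - 1), sq_nonneg (ψ x + 1), sq_nonneg (ψ x - 2 * u x)]
    have hV0 : 0 ≤ V := ENNReal.toReal_nonneg
    have : 0 ≤ (2 * I + V + 2 * J) * D := by positivity
    rw [hM]
    nlinarith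
  have h6 : ε / M * |t| * (∫ x in U, (‖gradient ψ x‖ ^ 2 + |ψ x|)) ≤ |t| * (ε * (1 + D)) := by
    refine (mul_le_mul_of_nonneg_left h5 (by positivity)).trans (le_of_eq ?_)
    field_simp
  have e : energy μ ((fun x => x + R x) '' U) φ (gradient φ) - energy μ U u G -
        1 / 2 * D - t * shapeGrad U u G Y =
      (energy μ ((fun x => x + R x) '' U) φ (gradient φ) - energy μ U ψ (gradient ψ) -
        t * shapeGrad U ψ (gradient ψ) Y) +
      t * (shapeGrad U ψ (gradient ψ) Y - shapeGrad U u G Y) := by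
    rw [h3]; ring
  rw [e]
  refine (abs_add_le _ _).trans ?_
  rw [abs_mul]
  have h7 := mul_le_mul_of_nonneg_left h2 (abs_nonneg t)
  linarith [h1.trans h6]

/-- **Differentiability of the shape functional.**  If `x ↦ x + R t x` is a perturbation of the
identity that is Lipschitz-close to `x + t Y x` and fixes the support of `μ`, then
`t ↦ E((id + R t)(U))` has derivative `shapeGrad U u G Y` at `0`. -/
theorem hasDerivAt_shapeEnergy (hN : 1 ≤ N) [IsFiniteMeasure μ] (hμ : HasFiniteEnergy μ)
    (hUo : IsOpen U) (hU : Bornology.IsBounded U) (hμU : μ.support ⊆ U) {u : Euc N → ℝ}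
    {G : Euc N → Euc N} (hu : IsState μ U u G) {Y : Euc N → Euc N} (hY : ContDiff ℝ 1 Y)
    (hYc : HasCompactSupport Y) {R : ℝ → Euc N → Euc N} (hR0 : ∀ t, ∀ x ∈ μ.support, R t x = 0)
    (hR : ∀ ε > 0, ∀ᶠ t in 𝓝 (0 : ℝ), ∃ κ : NNReal, (κ : ℝ) ≤ ε * |t| ∧
      LipschitzWith κ fun x => R t x - t • Y x) :
    HasDerivAt (fun t => shapeEnergy μ ((fun x => x + R t x) '' U)) (shapeGrad U u G Y) 0 := by
  obtain ⟨L, hL⟩ := hY.lipschitzWith_of_hasCompactSupport hYc one_ne_zero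
  have ha : ∀ x, ‖fderiv ℝ Y x‖ ≤ L := fun x => norm_fderiv_le_of_lipschitz ℝ hL
  obtain ⟨C, hC0, hC⟩ := exists_abs_energy_transport_le hN hμ hUo hU hμU hu hY ha
  -- the two-sided expansion
  have main : ∀ ε > 0, ∀ᶠ t in 𝓝 (0 : ℝ), |shapeEnergy μ ((fun x => x + R t x) '' U) -
      energy μ U u G - t * shapeGrad U u G Y| ≤ ε * |t| := by
    intro ε hε
    obtain ⟨δ, hδ, h⟩ := hC (ε / 2) (by positivity)
    have ev1 : ∀ᶠ t in 𝓝 (0 : ℝ), |t| ≤ δ :=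
      (continuous_abs.tendsto' (0 : ℝ) 0 abs_zero).eventually (ge_mem_nhds hδ)
    have ev2 : ∀ᶠ t in 𝓝 (0 : ℝ), (1 + (L : ℝ)) * |t| ≤ 1 / 2 :=
      ((continuous_const.mul continuous_abs).tendsto' (0 : ℝ) 0 (by simp)).eventually
        (ge_mem_nhds (by norm_num))
    -- This and the next smallness condition are for the lower bound: errors linear in `D` use up
    -- half of `D/2`, and completing the square in `√D` costs `C² t² ≤ (ε/2) |t|`.
    have ev3 : ∀ᶠ t in 𝓝 (0 : ℝ), (C + ε) * |t| ≤ 1 / 4 :=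
      ((continuous_const.mul continuous_abs).tendsto' (0 : ℝ) 0 (by simp)).eventually
        (ge_mem_nhds (by norm_num))
    have ev4 : ∀ᶠ t in 𝓝 (0 : ℝ), C ^ 2 * |t| ≤ ε / 2 :=
      ((continuous_const.mul continuous_abs).tendsto' (0 : ℝ) 0 (by simp)).eventually
        (ge_mem_nhds (by positivity))
    filter_upwards [ev1, ev2, ev3, ev4, hR δ hδ, hR 1 one_pos] with t ht1 ht2 ht3 ht4 ht5 ht6
    obtain ⟨κ', hκ', hlip'⟩ := ht5
    obtain ⟨κ₁, hκ₁, hlip₁⟩ := ht6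
    -- `R t` is Lipschitz with a small constant
    obtain ⟨κ, hlip, hκ⟩ : ∃ κ : NNReal, LipschitzWith κ (R t) ∧ κ ≤ 1 / 2 := by
      have h1 : LipschitzWith (κ₁ + ‖t‖₊ * L) (R t) := by
        have := hlip₁.add ((lipschitzWith_smul t).comp hL)
        simpa [Function.comp_def] using this
      refine ⟨_, h1, ?_⟩
      rw [← NNReal.coe_le_coe]
      push_cast
      rw [Real.norm_eq_abs]
      linarith
    have hae : ∀ᵐ x, ‖fderiv ℝ (R t) x - t • fderiv ℝ Y x‖ ≤ δ * |t| := by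
      filter_upwards [hlip.ae_differentiableAt (μ := (volume : Measure (Euc N)))] with x hx
      have hdY : DifferentiableAt ℝ Y x := hY.differentiable one_ne_zero x
      have := norm_fderiv_le_of_lipschitz ℝ (x₀ := x) hlip'
      have hdtY : DifferentiableAt ℝ (fun x => t • Y x) x := hdY.const_smul t
      rw [fderiv_fun_sub hx hdtY, fderiv_fun_const_smul hdY] at this
      exact this.trans hκ'
    set T : Euc N → Euc N := fun x => x + R t x with hT
    have hTo : IsOpen (T '' U) := isOpen_image_id_add hlip hκ hUo
    have hTb : Bornology.IsBounded (T '' U) := isBounded_image_id_add hlip hU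
    obtain ⟨v, H, hv⟩ := exists_isState hN hμ hTb
    rw [shapeEnergy_eq hTb hv]
    have key := fun φ ψ (hφψ : IsTransport U (R t) φ ψ) =>
      h (R t) κ t φ ψ ht1 hlip hκ (hR0 t) hae hφψ
    have ht0 := abs_nonneg t
    rw [abs_le]
    constructor
    · -- lower bound
      obtain ⟨φ, hφ, hφl⟩ := memH10_iff.1 hv.1
      have hlim := hφl.tendsto_energy hφ hTb
      have hb : ∀ n, energy μ U u G + t * shapeGrad U u G Y - ε * |t| ≤
          energy μ (T '' U) (φ n) (gradient (φ n)) := fun n => by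
        have k := (abs_le.1 (key _ _ ((hφ n).isTransport hlip hκ))).1
        set D := ∫ x in U, ‖gradient (fun x => φ n (x + R t x)) x - G x‖ ^ 2
        have hD : 0 ≤ D := integral_nonneg fun _ => sq_nonneg _
        have hs := Real.sq_sqrt hD
        set d := Real.sqrt D
        have q1 : (C + ε) * |t| * D ≤ 1 / 4 * D := mul_le_mul_of_nonneg_right ht3 hD
        have q2 : C ^ 2 * |t| * |t| ≤ ε / 2 * |t| := mul_le_mul_of_nonneg_right ht4 ht0
        have q3 : 0 ≤ ε * |t| * D := by positivity
        -- The remaining `d²/4` dominates `C |t| d` up to `C² t²`. No information on how close the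
        -- pulled-back state is to `u` is needed.
        nlinarith [sq_nonneg (1 / 2 * d - C * |t|)]
      have := ge_of_tendsto' hlim hb
      linarith
    · -- upper bound
      obtain ⟨ψ, hψ, hψl⟩ := memH10_iff.1 hu.1
      have hd : Tendsto (fun n => ∫ x in U, ‖gradient (ψ n) x - G x‖ ^ 2) atTop (𝓝 0) :=
        (tendsto_eLpNorm_two_iff fun n =>
          (((hψ n).memLp_gradient 2 volume).sub hu.1.2.1).restrict U).1
          (tendsto_eLpNorm_restrict U hψl.tendsto_grad)
      have hlim : Tendsto (fun n => energy μ U u G + 1 / 2 * (∫ x in U, ‖gradient (ψ n) x - G x‖ ^ 2)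
          + t * shapeGrad U u G Y + |t| * (C * (Real.sqrt (∫ x in U, ‖gradient (ψ n) x - G x‖ ^ 2) +
          ∫ x in U, ‖gradient (ψ n) x - G x‖ ^ 2) +
          ε / 2 * (1 + ∫ x in U, ‖gradient (ψ n) x - G x‖ ^ 2))) atTop
          (𝓝 (energy μ U u G + 1 / 2 * 0 + t * shapeGrad U u G Y +
            |t| * (C * (Real.sqrt 0 + 0) + ε / 2 * (1 + 0)))) :=
        (((tendsto_const_nhds.add (hd.const_mul _)).add_const _).add
          ((((hd.sqrt.add hd).const_mul C).add ((hd.const_add 1).const_mul _)).const_mul |t|))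
      -- The pushed-forward approximations of `u` compete with the state of the image, and for them
      -- `D → 0`.
      have hb := ge_of_tendsto' hlim (b := energy μ (T '' U) v H) fun n => by
        obtain ⟨φ, hφ⟩ := (hψ n).exists_isTransport hlip hκ
        have k := (abs_le.1 (key _ _ hφ)).2
        have k2 := hv.energy_le hTb (hφ.memH10 hlip hκ hUo)
        linarith
      rw [Real.sqrt_zero] at hb
      have : 0 ≤ ε * |t| := by positivity
      linarith
  -- The expansion holds at `t = 0` as well, where its error vanishes.
  have h0 : shapeEnergy μ ((fun x => x + R 0 x) '' U) = energy μ U u G := by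
    have := (main 1 one_pos).self_of_nhds
    simp only [abs_zero, mul_zero, zero_mul, sub_zero] at this
    exact sub_eq_zero.1 (abs_nonpos_iff.1 this)
  rw [hasDerivAt_iff_isLittleO_nhds_zero]
  refine Asymptotics.isLittleO_iff.2 fun ε hε => ?_
  filter_upwards [main ε hε] with t ht
  rw [zero_add, h0, smul_eq_mul, Real.norm_eq_abs, Real.norm_eq_abs]
  exact ht

end

/-! ### Lipschitz expansion of the flow of a tame field -/

section

section Flow

variable {E : Type*} [NormedAddCommGroup E] [NormedSpace ℝ E]

/-- A time-dependent field that is bounded, Lipschitz, and uniformly continuous together with its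
space derivative near time `0`. -/
structure IsTameField (F : ℝ → E → E) : Prop where
  bound : ∃ M, 0 ≤ M ∧ ∀ s, |s| ≤ 1 → ∀ x, ‖F s x‖ ≤ M
  lipschitz : ∃ L, 0 ≤ L ∧ ∀ s, |s| ≤ 1 → ∀ x y, ‖F s x - F s y‖ ≤ L * ‖x - y‖
  differentiable : ∀ s, Differentiable ℝ (F s)
  uniform : ∀ ε > 0, ∃ δ > 0, ∀ s a, |s| ≤ δ → ‖a‖ ≤ δ → ∀ x, ‖F s (x + a) - F 0 x‖ ≤ ε
  uniform_fderiv : ∀ ε > 0, ∃ δ > 0, ∀ s a, |s| ≤ δ → ‖a‖ ≤ δ →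
    ∀ x, ‖fderiv ℝ (F s) (x + a) - fderiv ℝ (F 0) x‖ ≤ ε

lemma IsTameField.neg {F : ℝ → E → E} (h : IsTameField F) :
    IsTameField fun s x => -F (-s) x := by
  refine ⟨?_, ?_, fun s => (h.differentiable (-s)).neg, fun ε hε => ?_, fun ε hε => ?_⟩
  · obtain ⟨M, h0, hM⟩ := h.bound
    exact ⟨M, h0, fun s hs x => by rw [norm_neg]; exact hM _ (by rwa [abs_neg]) x⟩
  · obtain ⟨L, h0, hL⟩ := h.lipschitz
    refine ⟨L, h0, fun s hs x y => ?_⟩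
    rw [neg_sub_neg, norm_sub_rev]
    exact hL _ (by rwa [abs_neg]) x y
  · obtain ⟨δ, hδ, H⟩ := h.uniform ε hε
    refine ⟨δ, hδ, fun s a hs ha x => ?_⟩
    rw [neg_sub_neg, norm_sub_rev, neg_zero]
    exact H _ a (by rwa [abs_neg]) ha x
  · obtain ⟨δ, hδ, H⟩ := h.uniform_fderiv ε hε
    refine ⟨δ, hδ, fun s a hs ha x => ?_⟩
    have e : ∀ s x, fderiv ℝ (fun x => -F (-s) x) x = -fderiv ℝ (F (-s)) x := fun s x =>
      fderiv_fun_neg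
    rw [e, e, neg_sub_neg, norm_sub_rev, neg_zero]
    exact H _ a (by rwa [abs_neg]) ha x

/-- Curves driven by a field that is bounded by `M` on a ball stay near their initial point. -/
lemma norm_sub_le_of_trajectory {V : ℝ → E → E} {M ρ τ : ℝ} (hM : 0 ≤ M) (hτ : (M + 1) * τ ≤ ρ)
    {x : E} (hV : ∀ s ∈ Icc 0 τ, ∀ z, ‖z - x‖ ≤ ρ → ‖V s z‖ ≤ M) {c : ℝ → E} (h0 : c 0 = x)
    (hc : ∀ s ∈ Icc 0 τ, HasDerivAt c (V s (c s)) s) {s : ℝ} (hs : s ∈ Icc 0 τ) :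
    ‖c s - x‖ ≤ (M + 1) * s := by
  refine image_norm_le_of_norm_deriv_right_lt_deriv_boundary (f := fun s => c s - x)
    (f' := fun s => V s (c s)) (a := 0) (b := τ) (B := fun s => (M + 1) * s) (B' := fun _ => M + 1)
    (fun s hs => (hc s hs).continuousAt.continuousWithinAt.sub continuousWithinAt_const)
    (fun s hs => ((hc s ⟨hs.1, hs.2.le⟩).sub_const x).hasDerivWithinAt) (by simp [h0])
    (fun s => by simpa using (hasDerivAt_id s).const_mul (M + 1)) (fun s hs h => ?_) hs
  refine (hV s ⟨hs.1, hs.2.le⟩ _ ?_).trans_lt (by linarith)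
  rw [h]
  exact (mul_le_mul_of_nonneg_left hs.2.le (by linarith)).trans hτ

/-- As long as the difference of the displacements is at most `‖x - y‖`, the curves are at distance
at most `2 ‖x - y‖`. Their velocities then differ by at most `2 L ‖x - y‖`, strictly below the slope
of the barrier since `x ≠ y`. -/
lemma norm_sub_sub_le_of_trajectory {F : ℝ → E → E} {L τ : ℝ} (hL : 0 ≤ L) 
    (hτ : (2 * L + 1) * τ ≤ 1) (hF : ∀ s ∈ Icc 0 τ, ∀ x y, ‖F s x - F s y‖ ≤ L * ‖x - y‖)
    {x y : E} (hxy : x ≠ y) {c d : ℝ → E} (hc0 : c 0 = x) (hd0 : d 0 = y)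
    (hc : ∀ s ∈ Icc 0 τ, HasDerivAt c (F s (c s)) s)
    (hd : ∀ s ∈ Icc 0 τ, HasDerivAt d (F s (d s)) s) {s : ℝ} (hs : s ∈ Icc 0 τ) :
    ‖(c s - x) - (d s - y)‖ ≤ (2 * L + 1) * ‖x - y‖ * s := by
  have hpos : 0 < ‖x - y‖ := norm_pos_iff.2 (sub_ne_zero.2 hxy)
  refine image_norm_le_of_norm_deriv_right_lt_deriv_boundary (f := fun s => (c s - x) - (d s - y))
    (f' := fun s => F s (c s) - F s (d s)) (a := 0) (b := τ)
    (B := fun s => (2 * L + 1) * ‖x - y‖ * s) (B' := fun _ => (2 * L + 1) * ‖x - y‖)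
    (fun s hs => (((hc s hs).sub_const x).sub ((hd s hs).sub_const y)).continuousAt.continuousWithinAt)
    (fun s hs => (((hc s ⟨hs.1, hs.2.le⟩).sub_const x).sub
      ((hd s ⟨hs.1, hs.2.le⟩).sub_const y)).hasDerivWithinAt) (by simp [hc0, hd0])
    (fun s => by simpa using (hasDerivAt_id s).const_mul ((2 * L + 1) * ‖x - y‖))
    (fun s hs h => ?_) hs
  have h1 : ‖c s - d s‖ ≤ ‖x - y‖ + ‖(c s - x) - (d s - y)‖ := by
    refine (le_of_eq ?_).trans (norm_add_le _ _)
    congr 1; abel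
  have h2 : (2 * L + 1) * ‖x - y‖ * s ≤ ‖x - y‖ := by
    have : (2 * L + 1) * s ≤ 1 := (mul_le_mul_of_nonneg_left hs.2.le (by linarith)).trans hτ
    nlinarith
  have h3 := hF s ⟨hs.1, hs.2.le⟩ (c s) (d s)
  have h4 : L * ‖c s - d s‖ ≤ L * (‖x - y‖ + ‖x - y‖) :=
    mul_le_mul_of_nonneg_left (h1.trans (by rw [h]; linarith)) hL
  linarith

/-- First order expansion of the trajectories of a tame field, with a Lipschitz remainder. -/
lemma IsTameField.expansion {F : ℝ → E → E} (hF : IsTameField F) {ρ : ℝ} (hρ : 0 < ρ) {ε : ℝ}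
    (hε : 0 < ε) : ∃ τ > 0, ∀ t ∈ Icc 0 τ, ∀ (V : ℝ → E → E) (x y : E) (c d : ℝ → E),
      c 0 = x → d 0 = y → (∀ s ∈ Icc 0 t, HasDerivAt c (V s (c s)) s) →
      (∀ s ∈ Icc 0 t, HasDerivAt d (V s (d s)) s) →
      (∀ s z, ‖z - x‖ ≤ ρ → V s z = F s z) → (∀ s z, ‖z - y‖ ≤ ρ → V s z = F s z) →
      ‖c t - x - t • F 0 x‖ ≤ ε * t ∧
      ‖(c t - x - t • F 0 x) - (d t - y - t • F 0 y)‖ ≤ ε * t * ‖x - y‖ := by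
  obtain ⟨M, hM0, hM⟩ := hF.bound
  obtain ⟨L, hL0, hL⟩ := hF.lipschitz
  obtain ⟨δ₁, hδ₁, h1⟩ := hF.uniform ε hε
  obtain ⟨δ₂, hδ₂, h2⟩ := hF.uniform_fderiv (ε / 2) (by positivity)
  -- Each smallness condition on the time has the form `s b ≤ 1` with `b` a summand of `A`, so the
  -- single time `1 / A` meets them all.
  set A := 1 + 1 / ρ * (M + 1) + (2 * L + 1) + (M + 2) / δ₁ + (M + 2) / δ₂ +
    2 * (L * (2 * L + 1)) / ε with hA
  have p1 : 0 ≤ 1 / ρ * (M + 1) := by positivity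
  have p2 : 0 ≤ 2 * L + 1 := by positivity
  have p3 : 0 ≤ (M + 2) / δ₁ := by positivity
  have p4 : 0 ≤ (M + 2) / δ₂ := by positivity
  have p5 : 0 ≤ 2 * (L * (2 * L + 1)) / ε := by positivity
  have hApos : 0 < A := by linarith
  refine ⟨1 / A, by positivity, fun t ht V x y c d hc0 hd0 hc hd hVx hVy => ?_⟩
  have key : ∀ s ∈ Icc 0 t, 0 ≤ s ∧ s ≤ 1 ∧ (M + 1) * s ≤ ρ ∧ (2 * L + 1) * s ≤ 1 ∧
      (M + 2) * s ≤ δ₁ ∧ (M + 2) * s ≤ δ₂ ∧ L * (2 * L + 1) * s ≤ ε / 2 := by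
    intro s hs
    have hs0 := hs.1
    have hsA : s * A ≤ 1 := by
      have := hs.2.trans ht.2
      rwa [le_div_iff₀ hApos] at this
    have aux : ∀ b, 0 ≤ b → b ≤ A → s * b ≤ 1 := fun b hb hbA =>
      (mul_le_mul_of_nonneg_left hbA hs0).trans hsA
    refine ⟨hs0, by simpa using aux 1 (by norm_num) (by linarith), ?_, ?_, ?_, ?_, ?_⟩
    · have := aux _ p1 (by linarith)
      have h : s * (1 / ρ * (M + 1)) = (M + 1) * s / ρ := by ring
      rwa [h, div_le_one hρ] at this
    · have := aux _ p2 (by linarith)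
      linarith
    · have := aux _ p3 (by linarith)
      have h : s * ((M + 2) / δ₁) = (M + 2) * s / δ₁ := by ring
      rwa [h, div_le_one hδ₁] at this
    · have := aux _ p4 (by linarith)
      have h : s * ((M + 2) / δ₂) = (M + 2) * s / δ₂ := by ring
      rwa [h, div_le_one hδ₂] at this
    · have := aux _ p5 (by linarith)
      have h : s * (2 * (L * (2 * L + 1)) / ε) = 2 * (L * (2 * L + 1) * s) / ε := by ring
      rw [h, div_le_one hε] at this
      linarith
  have htt : t ∈ Icc 0 t := ⟨ht.1, le_rfl⟩
  have habs : ∀ s ∈ Icc 0 t, |s| ≤ 1 := fun s hs => by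
    rw [abs_of_nonneg hs.1]; exact (key s hs).2.1
  have hcx : ∀ s ∈ Icc 0 t, ‖c s - x‖ ≤ (M + 1) * s := fun s hs =>
    norm_sub_le_of_trajectory hM0 (key t htt).2.2.1
      (fun s hs z hz => by rw [hVx s z hz]; exact hM s (habs s hs) z) hc0 hc hs
  have hdy : ∀ s ∈ Icc 0 t, ‖d s - y‖ ≤ (M + 1) * s := fun s hs =>
    norm_sub_le_of_trajectory hM0 (key t htt).2.2.1
      (fun s hs z hz => by rw [hVy s z hz]; exact hM s (habs s hs) z) hd0 hd hs
  -- The curve has not left the ball of radius `ρ`, so it is driven by the tame field as well.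
  have hc' : ∀ s ∈ Icc 0 t, HasDerivAt c (F s (c s)) s := fun s hs => by
    rw [← hVx s (c s) ((hcx s hs).trans (key s hs).2.2.1)]; exact hc s hs
  have hd' : ∀ s ∈ Icc 0 t, HasDerivAt d (F s (d s)) s := fun s hs => by
    rw [← hVy s (d s) ((hdy s hs).trans (key s hs).2.2.1)]; exact hd s hs
  have hsmall : ∀ s ∈ Icc 0 t, s ≤ (M + 2) * s ∧ (M + 1) * s ≤ (M + 2) * s := fun s hs => by
    have := hs.1
    constructor <;> nlinarith
  have hR : ∀ (c : ℝ → E) (x : E), (∀ s ∈ Icc 0 t, HasDerivAt c (F s (c s)) s) → ∀ s ∈ Icc 0 t,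
      HasDerivAt (fun s => c s - x - s • F 0 x) (F s (c s) - F 0 x) s := fun c x hc s hs => by
    have := ((hc s hs).sub_const x).sub ((hasDerivAt_id s).smul_const (F 0 x))
    simp only [id, one_smul] at this
    exact this
  constructor
  · have := norm_image_sub_le_of_norm_deriv_le_segment' (f := fun s => c s - x - s • F 0 x)
      (f' := fun s => F s (c s) - F 0 x) (a := 0) (b := t) (C := ε)
      (fun s hs => (hR c x hc' s hs).hasDerivWithinAt) (fun s hs => ?_) t htt
    · simpa [hc0] using this
    have hs' : s ∈ Icc 0 t := ⟨hs.1, hs.2.le⟩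
    have := h1 s (c s - x) (by
      rw [abs_of_nonneg hs.1]; exact (hsmall s hs').1.trans (key s hs').2.2.2.2.1)
      ((hcx s hs').trans ((hsmall s hs').2.trans (key s hs').2.2.2.2.1)) x
    simpa using this
  -- For equal initial points the claim is uniqueness of the trajectory; the barrier argument needs
  -- distinct points.
  · rcases eq_or_ne x y with rfl | hxy
    · have hcd : c t = d t := by
        by_contra hne
        have hu := ODE_solution_unique_of_mem_Icc_right (v := F) (s := fun _ => univ)
          (K := L.toNNReal) (f := c) (g := d) (a := 0) (b := t) (fun s hs => by
            refine LipschitzOnWith.of_dist_le_mul fun p _ q _ => ?_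
            rw [dist_eq_norm, dist_eq_norm, Real.coe_toNNReal _ hL0]
            exact hL s (habs s ⟨hs.1, hs.2.le⟩) p q)
          (fun s hs => (hc' s hs).continuousAt.continuousWithinAt)
          (fun s hs => (hc' s ⟨hs.1, hs.2.le⟩).hasDerivWithinAt) (fun _ _ => mem_univ _)
          (fun s hs => (hd' s hs).continuousAt.continuousWithinAt)
          (fun s hs => (hd' s ⟨hs.1, hs.2.le⟩).hasDerivWithinAt) (fun _ _ => mem_univ _)
          (hc0.trans hd0.symm)
        exact hne (hu htt)
      simp [hcd]
    · have hab : ∀ s ∈ Icc 0 t, ‖(c s - x) - (d s - y)‖ ≤ (2 * L + 1) * ‖x - y‖ * s := fun s hs =>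
        norm_sub_sub_le_of_trajectory hL0 (key t htt).2.2.2.1
          (fun s hs => hL s (habs s hs)) hxy hc0 hd0 hc' hd' hs
      have := norm_image_sub_le_of_norm_deriv_le_segment'
        (f := fun s => (c s - x - s • F 0 x) - (d s - y - s • F 0 y))
        (f' := fun s => (F s (c s) - F 0 x) - (F s (d s) - F 0 y)) (a := 0) (b := t)
        (C := ε * ‖x - y‖)
        (fun s hs => ((hR c x hc' s hs).sub (hR d y hd' s hs)).hasDerivWithinAt)
        (fun s hs => ?_) t htt
      · have h' : ε * t * ‖x - y‖ = ε * ‖x - y‖ * (t - 0) := by ring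
        rw [h']
        simpa [hc0, hd0] using this
      have hs' : s ∈ Icc 0 t := ⟨hs.1, hs.2.le⟩
      set a := c s - x with ha
      -- Both points are first shifted by the same displacement `a`. The mean value inequality then
      -- uses only uniform continuity of the space derivative, and the difference of the true
      -- displacements is left to the Lipschitz bound.
      have hH : ‖(F s (x + a) - F 0 x) - (F s (y + a) - F 0 y)‖ ≤ ε / 2 * ‖x - y‖ := by
        have hder : ∀ z, HasFDerivAt (fun z => F s (z + a) - F 0 z)
            (fderiv ℝ (F s) (z + a) - fderiv ℝ (F 0) z) z := fun z =>
          (((hF.differentiable s (z + a)).hasFDerivAt).comp z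
            ((hasFDerivAt_id z).add_const a)).sub (hF.differentiable 0 z).hasFDerivAt
        refine convex_univ.norm_image_sub_le_of_norm_hasFDerivWithin_le
          (f := fun z => F s (z + a) - F 0 z)
          (fun z _ => (hder z).hasFDerivWithinAt) (fun z _ => ?_) (mem_univ y) (mem_univ x)
        exact h2 s a (by
          rw [abs_of_nonneg hs.1]; exact (hsmall s hs').1.trans (key s hs').2.2.2.2.2.1)
          ((hcx s hs').trans ((hsmall s hs').2.trans (key s hs').2.2.2.2.2.1)) z
      have hG : ‖F s (y + a) - F s (d s)‖ ≤ ε / 2 * ‖x - y‖ := by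
        refine (hL s (habs s hs') _ _).trans ?_
        have e : y + a - d s = (c s - x) - (d s - y) := by rw [ha]; abel
        rw [e]
        refine (mul_le_mul_of_nonneg_left (hab s hs') hL0).trans ?_
        have := mul_le_mul_of_nonneg_right (key s hs').2.2.2.2.2.2 (norm_nonneg (x - y))
        linarith
      have e : (F s (c s) - F 0 x) - (F s (d s) - F 0 y) =
          ((F s (x + a) - F 0 x) - (F s (y + a) - F 0 y)) + (F s (y + a) - F s (d s)) := by
        rw [ha, add_sub_cancel]; abel
      rw [e]
      refine (norm_add_le _ _).trans ?_
      linarith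

end Flow

end

/-! ### Cutoffs and the expansion of deformations -/

section

variable {N : ℕ} {μ : Measure (Euc N)} {U D : Set (Euc N)}

open scoped Manifold in
lemma exists_cutoff {K : Set (Euc N)} (hK : IsCompact K) (hD : IsOpen D) (hKD : K ⊆ D) :
    ∃ χ : Euc N → ℝ, IsTest D χ ∧ (∃ ρ > 0, ∀ x ∈ K, ∀ z, ‖z - x‖ ≤ ρ → χ z = 1) ∧
      ∀ x, 0 ≤ χ x ∧ χ x ≤ 1 := by
  obtain ⟨L, hL, hKL, hLD⟩ := exists_compact_between hK hD hKD
  obtain ⟨f, hf1, hf0, hf⟩ := exists_contMDiffMap_one_nhds_of_subset_interior (n := ⊤)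
    (𝓘(ℝ, Euc N)) hK.isClosed hKL
  have hsupp : tsupport (f : Euc N → ℝ) ⊆ L :=
    closure_minimal (fun x hx => by_contra fun h => hx (hf0 x h)) hL.isClosed
  refine ⟨f, ⟨f.contMDiff.contDiff, hL.of_isClosed_subset isClosed_closure hsupp, hsupp.trans hLD⟩,
    ?_, hf⟩
  obtain ⟨O, hO, hKO, h1⟩ := mem_nhdsSet_iff_exists.1 hf1
  obtain ⟨ρ, hρ, hsub⟩ := hK.exists_cthickening_subset_open hO hKO
  exact ⟨ρ, hρ, fun x hx z hz => h1 (hsub (Metric.mem_cthickening_of_dist_le z x ρ K hx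
    (by rwa [dist_eq_norm])))⟩

section Tame

variable {G : Type*} [NormedAddCommGroup G] [NormedSpace ℝ G]

lemma continuous_of_eq_zero_off {g : ℝ × Euc N → G} {K : Set (Euc N)} (hK : IsClosed K)
    (hD : IsOpen D) (hKD : K ⊆ D) (hg : ContinuousOn g (univ ×ˢ D)) (h0 : ∀ s, ∀ x ∉ K, g (s, x) = 0) :
    Continuous g := by
  refine continuous_iff_continuousAt.2 fun p => ?_
  by_cases hp : p.2 ∈ D
  · exact hg.continuousAt ((isOpen_univ.prod hD).mem_nhds ⟨mem_univ _, hp⟩)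
  · have : ∀ᶠ q : ℝ × Euc N in 𝓝 p, g q = 0 := by
      filter_upwards [(isOpen_univ.prod hK.isOpen_compl).mem_nhds
        (show p ∈ univ ×ˢ Kᶜ from ⟨mem_univ _, fun h => hp (hKD h)⟩)] with q hq
      exact h0 q.1 q.2 hq.2
    exact continuousAt_const.congr (this.mono fun _ h => h.symm)

lemma uniform_of_compact_support {g : ℝ × Euc N → G} {K : Set (Euc N)} (hK : IsCompact K)
    (hg : Continuous g) (h0 : ∀ s, ∀ x ∉ K, g (s, x) = 0) :
    (∃ M, 0 ≤ M ∧ ∀ s, |s| ≤ 1 → ∀ x, ‖g (s, x)‖ ≤ M) ∧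
    ∀ ε > 0, ∃ δ > 0, ∀ s a, |s| ≤ δ → ‖a‖ ≤ δ → ∀ x, ‖g (s, x + a) - g (0, x)‖ ≤ ε := by
  -- A cutoff in time makes the field compactly supported in space-time without changing it for `|s|
  -- ≤ 1`; continuity then gives boundedness and uniform continuity.
  set b : ℝ → ℝ := fun s => max 0 (2 - |s|) ⊓ 1 with hb
  have hb1 : ∀ s, |s| ≤ 1 → b s = 1 := fun s hs => by
    rw [hb]; simp only
    rw [inf_eq_right]
    exact le_max_of_le_right (by linarith)
  have hb0 : ∀ s, s ∉ Icc (-2 : ℝ) 2 → b s = 0 := fun s hs => by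
    rw [mem_Icc, ← abs_le, not_le] at hs
    rw [hb]; simp only
    rw [max_eq_left (by linarith), inf_eq_left]
    norm_num
  have hcb : Continuous b := by fun_prop
  set h : ℝ × Euc N → G := fun p => b p.1 • g p with hh
  have hhc : Continuous h := (hcb.comp continuous_fst).smul hg
  have hcs : HasCompactSupport h := by
    refine HasCompactSupport.intro ((isCompact_Icc (a := (-2 : ℝ)) (b := 2)).prod hK) fun p hp => ?_
    rw [hh]; simp only
    by_cases h1 : p.1 ∈ Icc (-2 : ℝ) 2
    · rw [h0 p.1 p.2 fun h2 => hp ⟨h1, h2⟩, smul_zero]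
    · rw [hb0 _ h1, zero_smul]
  have hheq : ∀ s, |s| ≤ 1 → ∀ x, h (s, x) = g (s, x) := fun s hs x => by
    rw [hh]; simp only; rw [hb1 s hs, one_smul]
  constructor
  · obtain ⟨M, hM⟩ := hcs.exists_bound_of_continuous hhc
    exact ⟨M, (norm_nonneg _).trans (hM 0), fun s hs x => by rw [← hheq s hs x]; exact hM _⟩
  · intro ε hε
    obtain ⟨δ, hδ, H⟩ := Metric.uniformContinuous_iff_le.1
      (hcs.uniformContinuous_of_continuous hhc) ε hε
    refine ⟨min δ 1, by positivity, fun s a hs ha x => ?_⟩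
    rw [← hheq s (hs.trans (min_le_right _ _)), ← hheq 0 (by simp), ← dist_eq_norm]
    refine H ?_
    rw [Prod.dist_eq]
    refine max_le ?_ ?_
    · simpa using hs.trans (min_le_left _ _)
    · simpa [dist_eq_norm] using ha.trans (min_le_left _ _)

/-- The field is only known on `D` and with continuous derivatives; multiplication by a cutoff makes
it global, with uniform bounds, and does not alter trajectories that stay where the cutoff is `1`.
-/
lemma IsVelocityField.isTameField {V : ℝ → Euc N → Euc N} (hV : IsVelocityField D V)
    (hD : IsOpen D) {χ : Euc N → ℝ} (hχ : IsTest D χ) : IsTameField fun s x => χ x • V s x := by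
  have hχ0 : ∀ x ∉ tsupport χ, χ x = 0 := fun x hx => image_eq_zero_of_notMem_tsupport hx
  have hfd0 : ∀ s, ∀ x ∉ tsupport χ, fderiv ℝ (fun x => χ x • V s x) x = 0 := fun s x hx => by
    have : (fun x => χ x • V s x) =ᶠ[𝓝 x] fun _ => 0 := by
      filter_upwards [(isClosed_tsupport χ).isOpen_compl.mem_nhds hx] with y hy
      rw [hχ0 y hy, zero_smul]
    rw [this.fderiv_eq]; simp
  have hVd : ∀ s, ∀ x ∈ D, DifferentiableAt ℝ (V s) x := fun s x hx =>
    ((hV.contDiffOn s).contDiffAt (hD.mem_nhds hx)).differentiableAt one_ne_zero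
  have hfd : ∀ s, ∀ x ∈ D, fderiv ℝ (fun x => χ x • V s x) x =
      χ x • fderiv ℝ (V s) x + (fderiv ℝ χ x).smulRight (V s x) := fun s x hx =>
    fderiv_fun_smul (hχ.differentiable x) (hVd s x hx)
  have hdiff : ∀ s, Differentiable ℝ fun x => χ x • V s x := fun s x => by
    by_cases hx : x ∈ D
    · exact (hχ.differentiable x).smul (hVd s x hx)
    · have : (fun x => χ x • V s x) =ᶠ[𝓝 x] fun _ => 0 := by
        filter_upwards [(isClosed_tsupport χ).isOpen_compl.mem_nhds
          (fun h => hx (hχ.2.2 h))] with y hy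
        rw [hχ0 y hy, zero_smul]
      exact this.differentiableAt_iff.2 (differentiableAt_const 0)
  have hc1 : Continuous fun p : ℝ × Euc N => χ p.2 • V p.1 p.2 :=
    continuous_of_eq_zero_off (isClosed_tsupport χ) hD hχ.2.2
      ((hχ.continuous.comp continuous_snd).continuousOn.smul hV.continuousOn)
      (fun s x hx => by simp [hχ0 x hx])
  have hc2 : Continuous fun p : ℝ × Euc N => fderiv ℝ (fun x => χ x • V p.1 x) p.2 := by
    refine continuous_of_eq_zero_off (isClosed_tsupport χ) hD hχ.2.2 ?_ hfd0
    refine ContinuousOn.congr (f := fun p : ℝ × Euc N => χ p.2 • fderiv ℝ (V p.1) p.2 +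
      ContinuousLinearMap.smulRightL ℝ (Euc N) (Euc N) (fderiv ℝ χ p.2) (V p.1 p.2)) ?_
      (fun p hp => by rw [hfd p.1 p.2 hp.2]; rfl)
    refine ((hχ.continuous.comp continuous_snd).continuousOn.smul hV.continuousOn_fderiv).add ?_
    refine ContinuousOn.clm_apply ?_ hV.continuousOn
    exact ((ContinuousLinearMap.continuous _).comp
      (hχ.continuous_fderiv.comp continuous_snd)).continuousOn
  have u1 := uniform_of_compact_support hχ.2.1 hc1 (fun s x hx => by simp [hχ0 x hx])
  have u2 := uniform_of_compact_support hχ.2.1 hc2 hfd0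
  refine ⟨u1.1, ?_, hdiff, u1.2, u2.2⟩
  obtain ⟨L, hL0, hL⟩ := u2.1
  refine ⟨L, hL0, fun s hs x y => ?_⟩
  exact convex_univ.norm_image_sub_le_of_norm_fderiv_le (𝕜 := ℝ) (fun z _ => hdiff s z)
    (fun z _ => hL s hs z) (mem_univ y) (mem_univ x)

end Tame

/-- First order expansion `X t = id + t W + o(t)` on `U`, the remainder being small in the
Lipschitz norm. -/
def HasExpansion (U : Set (Euc N)) (X : ℝ → Euc N → Euc N) (W : Euc N → Euc N) : Prop :=
  ∀ ε > 0, ∀ᶠ t in 𝓝 (0 : ℝ), ∀ x ∈ U, ∀ y ∈ U, ‖X t x - x - t • W x‖ ≤ ε * |t| ∧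
    ‖(X t x - x - t • W x) - (X t y - y - t • W y)‖ ≤ ε * |t| * ‖x - y‖

lemma IsFlow.hasExpansion {V X : ℝ → Euc N → Euc N} (hX : IsFlow D V U X)
    (hV : IsVelocityField D V) (hD : IsOpen D) (hU : Bornology.IsBounded U) (hUD : closure U ⊆ D) :
    HasExpansion U X (V 0) := by
  obtain ⟨χ, hχ, ⟨ρ, hρ, hχ1⟩, -⟩ := exists_cutoff hU.isCompact_closure hD hUD
  have hF := hV.isTameField hD hχ
  obtain ⟨σ, hσ, hX⟩ := hX
  intro ε hε
  obtain ⟨τ₁, hτ₁, h1⟩ := hF.expansion hρ hε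
  obtain ⟨τ₂, hτ₂, h2⟩ := hF.neg.expansion hρ hε
  have hball : ∀ x ∈ U, ∀ s z, ‖z - x‖ ≤ ρ → V s z = χ z • V s z := fun x hx s z hz => by
    rw [hχ1 x (subset_closure hx) z hz, one_smul]
  have hone : ∀ x ∈ U, χ x = 1 := fun x hx => hχ1 x (subset_closure hx) x (by simpa using hρ.le)
  have hev : ∀ᶠ t in 𝓝 (0 : ℝ), |t| < min σ (min τ₁ τ₂) := by
    have : Tendsto (fun t : ℝ => |t|) (𝓝 0) (𝓝 0) := by
      simpa using (continuous_abs.tendsto (0 : ℝ))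
    exact this.eventually_lt_const (by positivity)
  filter_upwards [hev] with t ht x hx y hy
  obtain ⟨htσ, ht1, ht2⟩ : |t| < σ ∧ |t| < τ₁ ∧ |t| < τ₂ := by
    simpa [lt_min_iff] using ht
  rcases le_total 0 t with h0 | h0
  · rw [abs_of_nonneg h0] at htσ ht1 ⊢
    have hder : ∀ x ∈ U, ∀ s ∈ Icc 0 t, HasDerivAt (fun s => X s x) (V s (X s x)) s :=
      fun x hx s hs => ((hX x hx).2 s ⟨by linarith [hs.1], by linarith [hs.2]⟩).2
    have := h1 t ⟨h0, ht1.le⟩ V x y (fun s => X s x) (fun s => X s y) (hX x hx).1 (hX y hy).1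
      (hder x hx) (hder y hy) (hball x hx) (hball y hy)
    simpa [hone x hx, hone y hy] using this
  -- For negative times the reversed curve is driven by `-V(-s, ·)`, which is again tame.
  · rw [abs_of_nonpos h0] at htσ ht2 ⊢
    have hder : ∀ x ∈ U, ∀ s ∈ Icc 0 (-t), HasDerivAt (fun s => X (-s) x)
        (-V (-s) (X (-s) x)) s := fun x hx s hs => by
      have := ((hX x hx).2 (-s) ⟨by linarith [hs.2], by linarith [hs.1]⟩).2
      have h := this.scomp s (hasDerivAt_neg s)
      rw [neg_smul, one_smul] at h
      exact h
    have := h2 (-t) ⟨by linarith, ht2.le⟩ (fun s z => -V (-s) z) x y (fun s => X (-s) x)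
      (fun s => X (-s) y) (by simpa using (hX x hx).1) (by simpa using (hX y hy).1)
      (hder x hx) (hder y hy) (fun s z hz => by rw [← hball x hx (-s) z hz])
      (fun s z hz => by rw [← hball y hy (-s) z hz])
    simpa [hone x hx, hone y hy] using this

lemma IsDeformation.hasExpansion {V X : ℝ → Euc N → Euc N} (hX : IsDeformation D V U X)
    (hV : IsVelocityField D V) (hD : IsOpen D) (hU : Bornology.IsBounded U) (hUD : closure U ⊆ D) :
    HasExpansion U X (V 0) := by
  rcases hX with hX | hX
  · exact hX.hasExpansion hV hD hU hUD
  · refine fun ε hε => Eventually.of_forall fun t x hx y hy => ?_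
    rw [hX x hx, hX y hy]
    simp only [add_sub_cancel_left, sub_self, norm_zero]
    exact ⟨by positivity, by positivity⟩

end

/-! ### Localisation of the deformation near the boundary -/

section

variable {N : ℕ} {μ : Measure (Euc N)} {U D : Set (Euc N)}

/-- A cutoff in `D` that is `1` on `U` near the boundary of `U`, and `0` near the support of
`μ`. -/
structure IsBoundaryCutoff (μ : Measure (Euc N)) (U D : Set (Euc N)) (η : Euc N → ℝ) : Prop where
  isTest : IsTest D η
  nonneg : ∀ x, 0 ≤ η x
  le_one : ∀ x, η x ≤ 1
  disjoint : Disjoint (tsupport η) μ.support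
  eq_one : ∃ K, IsCompact K ∧ K ⊆ U ∧ ∀ x ∈ closure U \ K, η x = 1

lemma IsBoundaryCutoff.eq_zero {η : Euc N → ℝ} (h : IsBoundaryCutoff μ U D η) {x : Euc N}
    (hx : x ∈ μ.support) : η x = 0 :=
  image_eq_zero_of_notMem_tsupport fun h' => disjoint_left.1 h.disjoint h' hx

lemma exists_isBoundaryCutoff (hμ : IsCompact μ.support) (hUo : IsOpen U)
    (hU : Bornology.IsBounded U) (hμU : μ.support ⊆ U) (hD : IsOpen D) (hUD : closure U ⊆ D) :
    ∃ η, IsBoundaryCutoff μ U D η := by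
  obtain ⟨χ, hχ, ⟨ρ, hρ, hχ1⟩, hχ01⟩ := exists_cutoff hU.isCompact_closure hD hUD
  obtain ⟨ζ, hζ, ⟨ρ', hρ', hζ1⟩, hζ01⟩ := exists_cutoff hμ hUo hμU
  have hsub : tsupport (fun x => χ x * (1 - ζ x)) ⊆ tsupport χ := tsupport_mul_subset_left
  refine ⟨fun x => χ x * (1 - ζ x), ⟨hχ.1.mul (contDiff_const.sub hζ.1), hχ.2.1.mul_right,
    hsub.trans hχ.2.2⟩, fun x => ?_, fun x => ?_, ?_, ⟨tsupport ζ, hζ.2.1, hζ.2.2, fun x hx => ?_⟩⟩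
  · exact mul_nonneg (hχ01 x).1 (by linarith [(hζ01 x).2])
  · exact mul_le_one₀ (hχ01 x).2 (by linarith [(hζ01 x).2]) (by linarith [(hζ01 x).1])
  · refine disjoint_left.2 fun x hx hxμ => notMem_tsupport_iff_eventuallyEq.2 ?_ hx
    filter_upwards [Metric.closedBall_mem_nhds x hρ'] with y hy
    rw [hζ1 x hxμ y (by rwa [← dist_eq_norm])]
    simp
  · rw [hχ1 x hx.1 x (by simpa using hρ.le), image_eq_zero_of_notMem_tsupport hx.2]
    norm_num

/-- One extension, fixed before the Lipschitz constant is known, must serve every admissible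
constant, because the expansion of a deformation is stated for all `ε`. The least Lipschitz constant
is attained, so extending with it is enough. -/
lemma exists_lipschitz_extension (r : Euc N → Euc N) : ∃ ρ : Euc N → Euc N, EqOn r ρ U ∧
    ∀ k : NNReal, LipschitzOnWith k r U →
      LipschitzWith (lipschitzExtensionConstant (Euc N) * k) ρ := by
  set S : Set ℝ := {k | 0 ≤ k ∧ ∀ x ∈ U, ∀ y ∈ U, dist (r x) (r y) ≤ k * dist x y} with hS
  by_cases hne : S.Nonempty
  · have hbdd : BddBelow S := ⟨0, fun k hk => hk.1⟩
    have h0 : 0 ≤ sInf S := Real.sInf_nonneg fun k hk => hk.1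
    have hl : LipschitzOnWith (sInf S).toNNReal r U := by
      refine LipschitzOnWith.of_dist_le_mul fun x hx y hy => ?_
      rw [Real.coe_toNNReal _ h0]
      rcases (dist_nonneg (x := x) (y := y)).eq_or_lt with h | h
      · obtain ⟨k, hk⟩ := hne
        have := hk.2 x hx y hy
        rw [← h] at this ⊢
        simpa using this
      · rw [← div_le_iff₀ h]
        exact le_csInf hne fun k hk => by rw [div_le_iff₀ h]; exact hk.2 x hx y hy
    obtain ⟨g, hg, he⟩ := hl.extend_finite_dimension
    refine ⟨g, he, fun k hk => hg.weaken ?_⟩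
    gcongr
    rw [Real.toNNReal_le_iff_le_coe]
    exact csInf_le hbdd ⟨k.2, fun x hx y hy => hk.dist_le_mul x hx y hy⟩
  · exact ⟨r, fun _ _ => rfl, fun k hk =>
      (hne ⟨k, k.2, fun x hx y hy => hk.dist_le_mul x hx y hy⟩).elim⟩

/-- Moving interior points does not change the domain. If `x ∈ K`, the point `z` with `z + R' z = x
+ R x` lies within `2 ‖R x - R' x‖` of `x`, hence still in `U`. -/
lemma image_id_add_subset {R R' : Euc N → Euc N} {κ' : NNReal}
    (hR' : LipschitzWith κ' R') (hκ' : κ' ≤ 1 / 2)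
    {K : Set (Euc N)} {δ : ℝ} (hK : ∀ x ∈ K, ∀ z, ‖z - x‖ ≤ δ → z ∈ U)
    (heq : ∀ x ∈ U \ K, R x = R' x) (hclose : ∀ x ∈ K, 2 * ‖R x - R' x‖ ≤ δ) :
    (fun x => x + R x) '' U ⊆ (fun x => x + R' x) '' U := by
  rintro _ ⟨x, hx, rfl⟩
  by_cases hxK : x ∈ K
  · obtain ⟨z, hz⟩ := surjective_id_add hR' hκ' (x + R x)
    refine ⟨z, hK x hxK z ?_, hz⟩
    refine (norm_sub_le_two_mul hR' hκ' z x).trans ?_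
    simp only at hz
    rw [hz, add_sub_add_left_eq_sub]
    exact hclose x hxK
  · exact ⟨x, hx, by simp only; rw [heq x ⟨hx, hxK⟩]⟩

/-- The remainder is only bounded on bounded sets, so the product is estimated from a point in the
support of `η`; by symmetry either point may play this role. -/
lemma lipschitzWith_smul_of_tsupport {η : Euc N → ℝ} {ρ : Euc N → Euc N} {L κ : NNReal} {B : ℝ}
    (hB : 0 ≤ B) (hη : LipschitzWith L η) (h1 : ∀ x, |η x| ≤ 1) (hρ : LipschitzWith κ ρ)
    (hρB : ∀ x ∈ tsupport η, ‖ρ x‖ ≤ B) :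
    LipschitzWith (L * B.toNNReal + κ) fun x => η x • ρ x := by
  have key : ∀ x y, x ∈ tsupport η →
      ‖η x • ρ x - η y • ρ y‖ ≤ (L * B + κ) * ‖x - y‖ := fun x y hx => by
    have e : η x • ρ x - η y • ρ y = (η x - η y) • ρ x + η y • (ρ x - ρ y) := by
      rw [sub_smul, smul_sub]; abel
    rw [e]
    refine (norm_add_le _ _).trans ?_
    rw [norm_smul, norm_smul, add_mul]
    have a1 := hη.norm_sub_le x y
    have a2 := hρ.norm_sub_le x y
    refine add_le_add ?_ ?_
    · calc ‖η x - η y‖ * ‖ρ x‖ ≤ (L * ‖x - y‖) * B :=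
            mul_le_mul a1 (hρB x hx) (norm_nonneg _) (by positivity)
        _ = L * B * ‖x - y‖ := by ring
    · calc ‖η y‖ * ‖ρ x - ρ y‖ ≤ 1 * (κ * ‖x - y‖) :=
            mul_le_mul (h1 y) a2 (norm_nonneg _) (by norm_num)
        _ = κ * ‖x - y‖ := by ring
  refine LipschitzWith.of_dist_le_mul fun x y => ?_
  rw [dist_eq_norm, dist_eq_norm]
  push_cast
  rw [Real.coe_toNNReal _ hB]
  by_cases hx : x ∈ tsupport η
  · exact key x y hx
  by_cases hy : y ∈ tsupport η
  · rw [norm_sub_rev, norm_sub_rev x y]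
    exact key y x hy
  · rw [image_eq_zero_of_notMem_tsupport hx, image_eq_zero_of_notMem_tsupport hy]
    simp only [zero_smul, sub_self, norm_zero]
    positivity

lemma IsTest.contDiff_smul {χ : Euc N → ℝ} (hχ : IsTest D χ) (hD : IsOpen D) {W : Euc N → Euc N}
    (hW : ContDiffOn ℝ 1 W D) : ContDiff ℝ 1 fun x => χ x • W x := by
  refine contDiff_iff_contDiffAt.2 fun x => ?_
  by_cases hx : x ∈ D
  · exact (hχ.1.of_le (by simp)).contDiffAt.smul (hW.contDiffAt (hD.mem_nhds hx))
  · have : (fun x => χ x • W x) =ᶠ[𝓝 x] fun _ => 0 := by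
      filter_upwards [(isClosed_tsupport χ).isOpen_compl.mem_nhds fun h => hx (hχ.2.2 h)] with y hy
      rw [image_eq_zero_of_notMem_tsupport hy, zero_smul]
    exact contDiffAt_const.congr_of_eventuallyEq this

lemma HasExpansion.exists_extension {X : ℝ → Euc N → Euc N} {W : Euc N → Euc N}
    (hX : HasExpansion U X W) (hne : U.Nonempty) (hU : Bornology.IsBounded U) {A : Set (Euc N)}
    (hA : Bornology.IsBounded A) : ∃ ρ : ℝ → Euc N → Euc N,
      (∀ t, ∀ x ∈ U, X t x = x + (t • W x + ρ t x)) ∧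
      ∀ ε > 0, ∀ᶠ t in 𝓝 (0 : ℝ), LipschitzWith (Real.toNNReal (ε * |t|)) (ρ t) ∧
        ∀ x ∈ A, ‖ρ t x‖ ≤ ε * |t| := by
  choose ρ hρ hl using fun t => exists_lipschitz_extension (U := U) fun x => X t x - x - t • W x
  refine ⟨ρ, fun t x hx => ?_, fun ε hε => ?_⟩
  · rw [← hρ t hx]; simp only; module
  obtain ⟨x₀, hx₀⟩ := hne
  obtain ⟨r, hr⟩ := (hA.sub hU).exists_norm_le
  set c := lipschitzExtensionConstant (Euc N) with hc
  have hr0 : 0 ≤ |r| := abs_nonneg r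
  have hpos : 0 < 1 + (c : ℝ) + c * |r| := by positivity
  -- The extension loses the factor `c` in the Lipschitz constant, and its size on `A` is estimated
  -- by going to the base point `x₀ ∈ U` at distance at most `|r|`.
  have hε' : 0 < ε / (1 + c + c * |r|) := by positivity
  filter_upwards [hX _ hε'] with t ht
  set e := ε / (1 + c + c * |r|) * |t| with he
  have he0 : 0 ≤ e := by positivity
  have hmul : e * (1 + c + c * |r|) = ε * |t| := by
    rw [he]; field_simp
  have hlip : LipschitzWith (c * e.toNNReal) (ρ t) := by
    refine hl t _ (LipschitzOnWith.of_dist_le_mul fun x hx y hy => ?_)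
    rw [dist_eq_norm, dist_eq_norm, Real.coe_toNNReal _ he0]
    exact (ht x hx y hy).2
  have p1 : (c : ℝ) * e ≤ ε * |t| := by
    rw [← hmul]
    have : 0 ≤ e * (1 + c * |r|) := by positivity
    linarith
  refine ⟨hlip.weaken ?_, fun x hx => ?_⟩
  · rw [Real.le_toNNReal_iff_coe_le (by positivity)]
    push_cast
    rwa [Real.coe_toNNReal _ he0]
  · have h1 := hlip.norm_sub_le x x₀
    have h2 : ‖ρ t x₀‖ ≤ e := by
      rw [← hρ t hx₀]; exact (ht x₀ hx₀ x₀ hx₀).1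
    have h3 : ‖x - x₀‖ ≤ |r| := (hr _ (sub_mem_sub hx hx₀)).trans (le_abs_self r)
    push_cast at h1
    rw [Real.coe_toNNReal _ he0] at h1
    have h4 : ‖ρ t x‖ ≤ ‖ρ t x - ρ t x₀‖ + ‖ρ t x₀‖ := by
      simpa using norm_add_le (ρ t x - ρ t x₀) (ρ t x₀)
    have h5 : (c : ℝ) * e * ‖x - x₀‖ ≤ c * e * |r| := mul_le_mul_of_nonneg_left h3 (by positivity)
    rw [← hmul]
    have : 0 ≤ e * c := by positivity
    linarith

lemma lipschitzWith_smul_add {t ε : ℝ} {L : NNReal} (hε : 0 ≤ ε) {Y ρ : Euc N → Euc N}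
    (hY : LipschitzWith L Y)
    (hρ : LipschitzWith (Real.toNNReal (ε * |t|)) ρ) (ht : (L + ε) * |t| ≤ 1 / 2) :
    ∃ κ : NNReal, κ ≤ 1 / 2 ∧ LipschitzWith κ fun x => t • Y x + ρ x := by
  refine ⟨‖t‖₊ * L + Real.toNNReal (ε * |t|), ?_, ((lipschitzWith_smul t).comp hY).add hρ⟩
  rw [← NNReal.coe_le_coe]
  push_cast
  rw [Real.coe_toNNReal _ (by positivity), Real.norm_eq_abs]
  linarith

/-- Multiplying the displacement by `η` freezes the support of `μ` and changes the map on `U` only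
inside a compact subset, so the image of `U` is the same. The modified map satisfies the hypotheses
of `hasDerivAt_shapeEnergy`. -/
theorem HasExpansion.hasShapeDeriv (hN : 1 ≤ N) [IsFiniteMeasure μ] (hμ : HasFiniteEnergy μ)
    (hUo : IsOpen U) (hU : Bornology.IsBounded U) (hμU : μ.support ⊆ U) (hD : IsOpen D)
    (hUD : closure U ⊆ D) {u : Euc N → ℝ} {G : Euc N → Euc N} (hu : IsState μ U u G)
    {X : ℝ → Euc N → Euc N} {W : Euc N → Euc N} (hX : HasExpansion U X W)
    (hW : ContDiffOn ℝ 1 W D) {η : Euc N → ℝ} (hη : IsBoundaryCutoff μ U D η) :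
    HasShapeDeriv (shapeEnergy μ) U X (shapeGrad U u G fun x => η x • W x) := by
  rcases U.eq_empty_or_nonempty with rfl | hne
  · simp only [HasShapeDeriv, image_empty, shapeGrad, setIntegral_empty]
    exact hasDerivAt_const _ _
  -- `χ W` is a globally Lipschitz field equal to `W` on `U`. Comparing images requires both maps,
  -- the original and the localised one, to be homeomorphisms of the whole space.
  obtain ⟨χ, hχ, ⟨ρ₀, hρ₀, hχ1⟩, -⟩ := exists_cutoff hU.isCompact_closure hD hUD
  have hχ1 : ∀ x ∈ U, χ x = 1 := fun x hx =>
    hχ1 x (subset_closure hx) x (by simpa using hρ₀.le)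
  obtain ⟨K, hK, hKU, hηK⟩ := hη.eq_one
  obtain ⟨δ, hδ, hδK⟩ := hK.exists_cthickening_subset_open hUo hKU
  have hKδ : ∀ x ∈ K, ∀ z, ‖z - x‖ ≤ δ → z ∈ U := fun x hx z hz =>
    hδK (Metric.mem_cthickening_of_dist_le z x δ K hx (by rwa [dist_eq_norm]))
  obtain ⟨ρ, hρX, hρ⟩ := hX.exists_extension hne hU
    ((hη.isTest.2.1.isBounded).union hU)
  have hYχ := hχ.contDiff_smul hD hW
  have hYη := hη.isTest.contDiff_smul hD hW
  have hcχ : HasCompactSupport fun x => χ x • W x := hχ.2.1.smul_right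
  have hcη : HasCompactSupport fun x => η x • W x := hη.isTest.2.1.smul_right
  obtain ⟨Lχ, hLχ⟩ := hYχ.lipschitzWith_of_hasCompactSupport hcχ (by simp)
  obtain ⟨Lη, hLη⟩ := hYη.lipschitzWith_of_hasCompactSupport hcη (by simp)
  obtain ⟨L, hL⟩ := hη.isTest.1.lipschitzWith_of_hasCompactSupport hη.isTest.2.1 (by simp)
  obtain ⟨M, hM⟩ := hcχ.exists_bound_of_continuous hYχ.continuous
  have hM0 : 0 ≤ M := (norm_nonneg _).trans (hM 0)
  have habs : ∀ x, |η x| ≤ 1 := fun x => by rw [abs_of_nonneg (hη.nonneg x)]; exact hη.le_one x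
  have hlipη : ∀ ε > 0, ∀ᶠ t in 𝓝 (0 : ℝ),
      LipschitzWith (Real.toNNReal (ε * |t|)) fun x => η x • ρ t x := fun ε hε => by
    have hpos : 0 < ε / (L + 1) := by positivity
    filter_upwards [hρ _ hpos] with t ht
    refine (lipschitzWith_smul_of_tsupport (B := ε / (L + 1) * |t|) (by positivity) hL habs ht.1
      fun x hx => ht.2 x (Or.inl hx)).weaken ?_
    rw [Real.le_toNNReal_iff_coe_le (by positivity)]
    push_cast
    rw [Real.coe_toNNReal _ (by positivity)]
    refine le_of_eq ?_
    field_simp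
  refine (hasDerivAt_shapeEnergy hN hμ hUo hU hμU hu hYη hcη
    (R := fun t x => t • (η x • W x) + η x • ρ t x) (fun t x hx => by simp [hη.eq_zero hx])
    fun ε hε => ?_).congr_of_eventuallyEq ?_
  · filter_upwards [hlipη ε hε] with t ht
    refine ⟨_, (Real.coe_toNNReal _ (by positivity)).le, ?_⟩
    simpa using ht
  · have hsmall : ∀ c : ℝ, ∀ d > 0, ∀ᶠ t in 𝓝 (0 : ℝ), c * |t| ≤ d := fun c d hd => by
      have : Tendsto (fun t : ℝ => c * |t|) (𝓝 0) (𝓝 0) := by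
        have h : Continuous fun t : ℝ => c * |t| := by fun_prop
        simpa using h.tendsto 0
      exact (this.eventually_lt_const hd).mono fun _ h => h.le
    filter_upwards [hρ 1 one_pos, hlipη 1 one_pos, hsmall (Lχ + 1) (1 / 2) (by norm_num),
      hsmall (Lη + 1) (1 / 2) (by norm_num), hsmall (2 * (M + 1)) δ hδ] with t h1 h2 h3 h4 h5
    obtain ⟨κ, hκ, hκl⟩ := lipschitzWith_smul_add zero_le_one hLχ h1.1 h3
    obtain ⟨κ', hκ', hκl'⟩ := lipschitzWith_smul_add zero_le_one hLη h2 h4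
    have himg : X t '' U = (fun x => x + (t • (χ x • W x) + ρ t x)) '' U :=
      image_congr fun x hx => by rw [hρX t x hx, hχ1 x hx, one_smul]
    have heq : ∀ x ∈ U \ K, t • (χ x • W x) + ρ t x = t • (η x • W x) + η x • ρ t x :=
      fun x hx => by rw [hχ1 x hx.1, hηK x ⟨subset_closure hx.1, hx.2⟩, one_smul, one_smul]
    have hclose : ∀ x ∈ K, 2 * ‖(t • (χ x • W x) + ρ t x) - (t • (η x • W x) + η x • ρ t x)‖ ≤ δ := by
      intro x hx
      have e : (t • (χ x • W x) + ρ t x) - (t • (η x • W x) + η x • ρ t x) =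
          (1 - η x) • (t • (χ x • W x) + ρ t x) := by
        rw [hχ1 x (hKU hx)]; module
      rw [e, norm_smul]
      have n1 : ‖1 - η x‖ ≤ 1 := by
        rw [Real.norm_eq_abs, abs_le]
        constructor <;> linarith [hη.nonneg x, hη.le_one x]
      have n2 : ‖t • (χ x • W x) + ρ t x‖ ≤ (M + 1) * |t| := by
        refine (norm_add_le _ _).trans ?_
        rw [norm_smul, Real.norm_eq_abs]
        have := h1.2 x (Or.inr (hKU hx))
        have := mul_le_mul_of_nonneg_left (hM x) (abs_nonneg t)
        linarith
      have := mul_le_mul n1 n2 (norm_nonneg _) zero_le_one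
      linarith
    rw [himg]
    congr 1
    refine Subset.antisymm (image_id_add_subset hκl' hκ' hKδ heq hclose)
      (image_id_add_subset hκl hκ hKδ (fun x hx => (heq x hx).symm) fun x hx => ?_)
    rw [norm_sub_rev]
    exact hclose x hx

end

/-! ### The Laplacian, and the mollified equation -/

section

variable {N : ℕ} {μ : Measure (Euc N)} {U : Set (Euc N)} {φ : Euc N → ℝ}

lemma two_le_infty : (2 : WithTop ℕ∞) ≤ ∞ := 
  (show ((2 : ℕ∞) : WithTop ℕ∞) ≤ ((⊤ : ℕ∞) : WithTop ℕ∞) from WithTop.coe_le_coe.2 le_top)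

lemma laplacian_eq_sum {ι : Type*} [Fintype ι] (b : OrthonormalBasis ι ℝ (Euc N)) {f : Euc N → ℝ}
    (hf : ContDiff ℝ 2 f) (x : Euc N) :
    Laplacian.laplacian f x = ∑ i, fderiv ℝ (fun y => fderiv ℝ f y (b i)) x (b i) := by
  rw [InnerProductSpace.laplacian_eq_iteratedFDeriv_orthonormalBasis f b]
  refine Finset.sum_congr rfl fun i _ => ?_
  have hd : DifferentiableAt ℝ (fderiv ℝ f) x :=
    (hf.fderiv_right (m := 1) (by norm_num)).differentiable one_ne_zero x
  rw [iteratedFDeriv_two_apply, fderiv_clm_apply hd (differentiableAt_const _)]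
  simp

lemma IsTest.fderiv_apply (h : IsTest U φ) (e : Euc N) : IsTest U fun x => fderiv ℝ φ x e := by
  refine ⟨(h.1.fderiv_right (m := ∞) (by simp)).clm_apply contDiff_const, h.2.1.fderiv_apply ℝ e,
    Subset.trans (closure_minimal (fun x hx => ?_) (isClosed_tsupport φ)) h.2.2⟩
  by_contra hx'
  refine hx ?_
  simp only
  rw [fderiv_of_notMem_tsupport (𝕜 := ℝ) hx', zero_apply]

lemma IsTest.laplacian (h : IsTest U φ) : IsTest U (Laplacian.laplacian φ) := by
  have e : Laplacian.laplacian φ = fun x => ∑ i, fderiv ℝ (fun y => fderiv ℝ φ y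
      (EuclideanSpace.basisFun (Fin N) ℝ i)) x (EuclideanSpace.basisFun (Fin N) ℝ i) :=
    funext fun x => laplacian_eq_sum _ (h.1.of_le two_le_infty) x
  rw [e]
  generalize (Finset.univ : Finset (Fin N)) = s
  induction s using Finset.cons_induction with
  | empty => simpa using isTest_zero
  | cons a s ha ih =>
    simp only [Finset.sum_cons]
    exact ((h.fderiv_apply _).fderiv_apply _).add ih

lemma IsTest.integral_mul_fderiv (h : IsTest U φ) {g : Euc N → ℝ} (hg : ContDiff ℝ 1 g)
    (e : Euc N) : ∫ x, g x * fderiv ℝ φ x e = -∫ x, fderiv ℝ g x e * φ x := by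
  have h1 := h.fderiv_apply e
  have hcg : Continuous fun x => fderiv ℝ g x e :=
    (hg.continuous_fderiv one_ne_zero).clm_apply continuous_const
  refine integral_mul_fderiv_eq_neg_fderiv_mul_of_integrable
    ((hcg.mul h.continuous).integrable_of_hasCompactSupport h.2.1.mul_left)
    ((hg.continuous.mul h1.continuous).integrable_of_hasCompactSupport h1.2.1.mul_left)
    ((hg.continuous.mul h.continuous).integrable_of_hasCompactSupport h.2.1.mul_left)
    (fun x _ => hg.differentiable one_ne_zero x) (fun x _ => h.differentiable x)

lemma IsTest.integral_mul_laplacian (h : IsTest U φ) {g : Euc N → ℝ} (hg : ContDiff ℝ 1 g) :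
    ∫ x, g x * Laplacian.laplacian φ x = -∫ x, inner ℝ (gradient g x) (gradient φ x) := by
  set b := EuclideanSpace.basisFun (Fin N) ℝ
  have hcg : ∀ e, Continuous fun x => fderiv ℝ g x e := fun e =>
    (hg.continuous_fderiv one_ne_zero).clm_apply continuous_const
  have e1 : ∀ x, g x * Laplacian.laplacian φ x =
      ∑ i, g x * fderiv ℝ (fun y => fderiv ℝ φ y (b i)) x (b i) := fun x => by
    rw [laplacian_eq_sum b (h.1.of_le two_le_infty), Finset.mul_sum]
  have e2 : ∀ x, inner ℝ (gradient g x) (gradient φ x) =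
      ∑ i, fderiv ℝ g x (b i) * fderiv ℝ φ x (b i) := fun x => by
    rw [← b.sum_inner_mul_inner]
    refine Finset.sum_congr rfl fun i _ => ?_
    rw [inner_gradient, real_inner_comm, inner_gradient]
  simp only [e1, e2]
  rw [integral_finsetSum _ fun i _ => ?_, integral_finsetSum _ fun i _ => ?_,
    ← Finset.sum_neg_distrib]
  · exact Finset.sum_congr rfl fun i _ => (h.fderiv_apply _).integral_mul_fderiv hg _
  · exact ((hcg _).mul (h.fderiv_apply _).continuous).integrable_of_hasCompactSupport
      (h.fderiv_apply _).2.1.mul_left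
  · have := (h.fderiv_apply (b i)).fderiv_apply (b i)
    exact (hg.continuous.mul this.continuous).integrable_of_hasCompactSupport this.2.1.mul_left

lemma fderiv_comp_const_sub {f : Euc N → ℝ} (hf : Differentiable ℝ f) (x t e : Euc N) :
    fderiv ℝ (fun t => f (x - t)) t e = -fderiv ℝ f (x - t) e := by
  have h' : HasFDerivAt (fun t => f (x - t)) _ t := (hf (x - t)).hasFDerivAt.comp t
    ((hasFDerivAt_id t).const_sub x)
  rw [h'.fderiv]
  simp

lemma laplacian_comp_const_sub {f : Euc N → ℝ} (hf : ContDiff ℝ ∞ f) (x t : Euc N) :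
    Laplacian.laplacian (fun t => f (x - t)) t = Laplacian.laplacian f (x - t) := by
  have hf2 : ContDiff ℝ 2 f := hf.of_le two_le_infty
  rw [laplacian_eq_sum (EuclideanSpace.basisFun (Fin N) ℝ) hf2,
    laplacian_eq_sum (EuclideanSpace.basisFun (Fin N) ℝ)
    (show ContDiff ℝ 2 fun t => f (x - t) from hf2.comp (contDiff_const.sub contDiff_id))]
  refine Finset.sum_congr rfl fun i _ => ?_
  set e := EuclideanSpace.basisFun (Fin N) ℝ i
  have h1 : Differentiable ℝ fun y => fderiv ℝ f y e :=
    ((hf.fderiv_right (m := ∞) (by simp)).clm_apply contDiff_const).differentiable (by simp)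
  simp only [fderiv_comp_const_sub (hf.differentiable (by simp))]
  rw [fderiv_fun_neg, neg_apply, fderiv_comp_const_sub h1, neg_neg]

lemma laplacian_mollify (n : ℕ) {f : Euc N → ℝ} (hf : LocallyIntegrable f volume) (x : Euc N) :
    Laplacian.laplacian (mollify n f) x =
      ∫ t, f t * Laplacian.laplacian (fun t => kernel N n (x - t)) t := by
  set b := EuclideanSpace.basisFun (Fin N) ℝ
  have hk := isTest_kernel (N := N) n
  have h2 : ∀ i, fderiv ℝ (fun y => fderiv ℝ (mollify n f) y (b i)) x (b i) =
      ∫ t, fderiv ℝ (fun y => fderiv ℝ (kernel N n) y (b i)) (x - t) (b i) * f t := fun i => by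
    have e : (fun y => fderiv ℝ (mollify n f) y (b i)) =
        convolution (fun y => fderiv ℝ (kernel N n) y (b i)) f (ContinuousLinearMap.lsmul ℝ ℝ)
          volume := by
      funext y
      rw [mollify, fderiv_convolution_apply hk.2.1 (hk.1.of_le (by simp)) hf, convolution_eq_swap]
      rfl
    rw [e, fderiv_convolution_apply (hk.fderiv_apply _).2.1 ((hk.fderiv_apply _).1.of_le (by simp)) hf]
  rw [laplacian_eq_sum b ((contDiff_mollify n hf).of_le two_le_infty), Finset.sum_congr rfl
    fun i _ => h2 i, ← integral_finsetSum]
  · refine integral_congr_ae (Eventually.of_forall fun t => ?_)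
    simp only
    rw [laplacian_comp_const_sub hk.1, laplacian_eq_sum b (hk.1.of_le two_le_infty), Finset.mul_sum]
    exact Finset.sum_congr rfl fun i _ => mul_comm _ _
  · intro i _
    have ht := (hk.fderiv_apply (b i)).fderiv_apply (b i)
    have := hf.integrable_smul_left_of_hasCompactSupport
      (g := fun t => fderiv ℝ (fun y => fderiv ℝ (kernel N n) y (b i)) (x - t) (b i))
      (ht.continuous.comp (continuous_const.sub continuous_id))
      (ht.2.1.comp_homeomorph (Homeomorph.subLeft x))
    simpa using this

section Source

variable {Ω : Set (Euc N)} {u : Euc N → ℝ}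

/-- The smoothed measure. -/
noncomputable def smoothMeasure (μ : Measure (Euc N)) (n : ℕ) (x : Euc N) : ℝ :=
  ∫ y, kernel N n (x - y) ∂μ

/-- The kernel centred at `x` is a test function for the distributional equation, so the mollified
solution satisfies the mollified equation everywhere. -/
lemma IsSolutionP.laplacian_mollify (hu : IsSolutionP μ Ω u) (hΩ : MeasurableSet Ω) (n : ℕ)
    (x : Euc N) : Laplacian.laplacian (mollify n u) x =
      mollify n (indicator Ω fun _ => (1 : ℝ)) x - smoothMeasure μ n x := by
  rw [QuadDomain.laplacian_mollify n hu.locallyIntegrable, hu.equation _ (isTest_kernel_sub n x),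
    smoothMeasure, mollify_apply, ← integral_indicator hΩ]
  congr 1
  refine integral_congr_ae (Eventually.of_forall fun t => ?_)
  by_cases ht : t ∈ Ω <;> simp [ht]

lemma smoothMeasure_eq_zero {n : ℕ} {x : Euc N}
    (h : ∀ y, dist y x < 1 / ((n : ℝ) + 1) → y ∉ μ.support) : smoothMeasure μ n x = 0 := by
  refine integral_eq_zero_of_ae ?_
  filter_upwards [Measure.support_mem_ae (μ := μ)] with y hy
  refine kernel_eq_zero (le_of_not_gt fun h' => h y ?_ hy)
  rwa [dist_comm, dist_eq_norm]

lemma IsSolutionP.integrable (hu : IsSolutionP μ Ω u) (hΩ : Bornology.IsBounded Ω) :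
    Integrable u :=
  (hu.locallyIntegrable.integrableOn_isCompact hΩ.isCompact_closure).integrable_of_forall_notMem_eq_zero
    fun x hx => hu.eq_zero x fun h => hx (subset_closure h)

lemma IsSolutionP.tsupport_subset (hu : IsSolutionP μ Ω u) : tsupport u ⊆ closure Ω :=
  closure_mono fun x hx => by_contra fun h => hx (hu.eq_zero x h)

lemma IsSolutionP.hasCompactSupport (hu : IsSolutionP μ Ω u) (hΩ : Bornology.IsBounded Ω) :
    HasCompactSupport u :=
  hΩ.isCompact_closure.of_isClosed_subset (isClosed_tsupport u) hu.tsupport_subset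

lemma one_div_succ_le_one (n : ℕ) : 1 / ((n : ℝ) + 1) ≤ 1 := by
  rw [div_le_one (by positivity)]; linarith [(Nat.cast_nonneg n : (0 : ℝ) ≤ n)]

lemma IsSolutionP.isTest_mollify (hu : IsSolutionP μ Ω u) (hΩ : Bornology.IsBounded Ω) (n : ℕ) :
    IsTest (Metric.cthickening 1 Ω) (mollify n u) := by
  refine ⟨contDiff_mollify n hu.locallyIntegrable, hasCompactSupport_mollify n
    (hu.hasCompactSupport hΩ), (tsupport_mollify_subset n u).trans ?_⟩
  refine (Metric.cthickening_mono (one_div_succ_le_one n) _).trans ?_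
  rw [← Metric.cthickening_closure (s := Ω)]
  exact Metric.cthickening_subset_of_subset _ hu.tsupport_subset

lemma mollify_nonneg {n : ℕ} {f : Euc N → ℝ} (hf : ∀ x, 0 ≤ f x) (x : Euc N) :
    0 ≤ mollify n f x := by
  rw [mollify_apply]
  exact integral_nonneg fun t => mul_nonneg (kernel_nonneg n _) (hf t)

/-- Scheffé's argument: mollification preserves the integral, so the `L¹` distance is twice the
integral of the positive part of `f - mollify n f`, which is dominated by `f` itself. -/
lemma tendsto_integral_abs_mollify_sub {f : Euc N → ℝ} (hf : Integrable f) (h0 : ∀ x, 0 ≤ f x) :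
    Tendsto (fun n => ∫ x, |mollify n f x - f x|) atTop (𝓝 0) := by
  have hi : ∀ n, Integrable (mollify n f) := fun n =>
    (integrable_kernel n).integrable_convolution _ hf
  have he : ∀ n, ∫ x, mollify n f x = ∫ x, f x := fun n => by
    rw [mollify, integral_convolution _ (integrable_kernel n) hf, integral_kernel]
    simp
  have hp : ∀ n, Integrable fun x => max (f x - mollify n f x) 0 := fun n =>
    (hf.sub (hi n)).pos_part
  have h1 : ∀ n, ∫ x, |mollify n f x - f x| = 2 * ∫ x, max (f x - mollify n f x) 0 := fun n => by
    have e : ∀ x, |mollify n f x - f x| = (mollify n f x - f x) + 2 * max (f x - mollify n f x) 0 :=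
      fun x => by
        rcases le_total (f x - mollify n f x) 0 with h | h
        · rw [max_eq_right h, abs_of_nonneg (by linarith)]; ring
        · rw [max_eq_left h, abs_of_nonpos (by linarith)]; ring
    simp only [e]
    rw [integral_add (by exact (hi n).sub hf) ((hp n).const_mul 2), integral_sub (hi n) hf, he,
      integral_const_mul, sub_self, zero_add]
  simp only [h1]
  have h2 : Tendsto (fun n => ∫ x, max (f x - mollify n f x) 0) atTop
      (𝓝 (∫ _ : Euc N, (0 : ℝ))) := by
    refine tendsto_integral_of_dominated_convergence f (fun n => (hp n).1) hf
      (fun n => Eventually.of_forall fun x => ?_) ?_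
    · rw [Real.norm_of_nonneg (le_max_right _ _)]
      exact max_le (by linarith [mollify_nonneg (n := n) h0 x]) (h0 x)
    · filter_upwards [ae_tendsto_mollify hf.locallyIntegrable] with x hx
      have := ((hx.const_sub (f x)).max (tendsto_const_nhds (x := (0 : ℝ))))
      simpa using this
  simpa using h2.const_mul 2

end Source

end

/-! ### Uniform energy bound and approximation by test functions on `Ω` -/

section

variable {N : ℕ} {μ : Measure (Euc N)} {Ω : Set (Euc N)} {u : Euc N → ℝ}

lemma continuous_kernel (n : ℕ) : Continuous (kernel N n) := (contDiff_kernel n).continuous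

lemma continuous_smoothMeasure [IsFiniteMeasure μ] (n : ℕ) : Continuous (smoothMeasure μ n) := by
  obtain ⟨M, hM⟩ := (hasCompactSupport_kernel (N := N) n).exists_bound_of_continuous
    (continuous_kernel n)
  refine continuous_of_dominated (bound := fun _ => M) (fun x => ?_)
    (fun x => Eventually.of_forall fun y => hM _) (integrable_const M)
    (Eventually.of_forall fun y => (continuous_kernel n).comp (continuous_id.sub continuous_const))
  exact ((continuous_kernel n).comp (continuous_const.sub continuous_id)).aestronglyMeasurable

lemma IsTest.comp_add_const {φ : Euc N → ℝ} (hφ : IsTest Set.univ φ) (z : Euc N) :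
    IsTest Set.univ fun y => φ (y + z) :=
  ⟨hφ.1.comp (contDiff_id.add contDiff_const), hφ.2.1.comp_homeomorph (Homeomorph.addRight z),
    subset_univ _⟩

lemma integral_mul_smoothMeasure_eq [IsFiniteMeasure μ] {ζ : Euc N → ℝ} (hζ : IsTest univ ζ)
    (n : ℕ) : ∫ x, ζ x * smoothMeasure μ n x = ∫ z, kernel N n z * ∫ y, ζ (y + z) ∂μ := by
  obtain ⟨M, hM⟩ := (hasCompactSupport_kernel (N := N) n).exists_bound_of_continuous
    (continuous_kernel n)
  obtain ⟨M', hM'⟩ := hζ.2.1.exists_bound_of_continuous hζ.continuous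
  have hck := continuous_kernel (N := N) n
  have hcζ := hζ.continuous
  have i1 : Integrable (Function.uncurry fun x y => ζ x * kernel N n (x - y)) (volume.prod μ) := by
    refine Integrable.mul_bdd (hζ.integrable volume |>.comp_fst μ) ?_ (Eventually.of_forall fun p => hM _)
    exact (by fun_prop : Continuous fun p : Euc N × Euc N => kernel N n (p.1 - p.2)).aestronglyMeasurable
  have i2 : Integrable (Function.uncurry fun y z => kernel N n z * ζ (y + z)) (μ.prod volume) := by
    refine Integrable.mul_bdd ((integrable_kernel n).comp_snd μ) ?_ (Eventually.of_forall fun p => hM' _)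
    exact (by fun_prop : Continuous fun p : Euc N × Euc N => ζ (p.1 + p.2)).aestronglyMeasurable
  calc ∫ x, ζ x * smoothMeasure μ n x = ∫ x, ∫ y, ζ x * kernel N n (x - y) ∂μ := by
        simp only [smoothMeasure, integral_const_mul]
    _ = ∫ y, (∫ x, ζ x * kernel N n (x - y)) ∂μ := integral_integral_swap i1
    _ = ∫ y, (∫ z, kernel N n z * ζ (y + z)) ∂μ := by
        refine integral_congr_ae (Eventually.of_forall fun y => ?_)
        simp only
        rw [← integral_add_left_eq_self _ y]
        refine integral_congr_ae (Eventually.of_forall fun z => ?_)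
        simp only [add_sub_cancel_left]
        ring
    _ = ∫ z, ∫ y, kernel N n z * ζ (y + z) ∂μ := integral_integral_swap i2
    _ = ∫ z, kernel N n z * ∫ y, ζ (y + z) ∂μ := by simp only [integral_const_mul]

/-- Pairing with the smoothed measure is averaging the pairings of `μ` with translates, and the `H¹`
norm is translation invariant. So the smoothed measures inherit the energy bound uniformly in `n`.
-/
lemma HasFiniteEnergy.exists_smoothMeasure_le [IsFiniteMeasure μ] (hμ : HasFiniteEnergy μ) :
    ∃ C : ℝ, 0 ≤ C ∧ ∀ ζ : Euc N → ℝ, IsTest univ ζ → ∀ n, |∫ x, ζ x * smoothMeasure μ n x| ≤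
      Real.sqrt (C * ((∫ x, ζ x ^ 2) + ∫ x, ‖gradient ζ x‖ ^ 2)) := by
  obtain ⟨C, hC0, hC⟩ := hμ.abs
  refine ⟨C, hC0, fun ζ hζ n => ?_⟩
  rw [integral_mul_smoothMeasure_eq hζ]
  set B := Real.sqrt (C * ((∫ x, ζ x ^ 2) + ∫ x, ‖gradient ζ x‖ ^ 2)) with hB
  have h1 : ∀ z, |∫ y, ζ (y + z) ∂μ| ≤ B := fun z => by
    refine (abs_integral_le_integral_abs).trans (Real.le_sqrt_of_sq_le ?_)
    have h := hC _ (hζ.comp_add_const z)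
    have hg : ∀ y, gradient (fun y => ζ (y + z)) y = gradient ζ (y + z) := fun y => by
      simp only [gradient]; rw [fderiv_comp_add_right]
    simp only [hg] at h
    rwa [integral_add_right_eq_self (fun y => ζ y ^ 2) z,
      integral_add_right_eq_self (fun y => ‖gradient ζ y‖ ^ 2) z] at h
  calc |∫ z, kernel N n z * ∫ y, ζ (y + z) ∂μ| ≤ ∫ z, kernel N n z * B := by
        rw [← Real.norm_eq_abs]
        refine norm_integral_le_of_norm_le ((integrable_kernel n).mul_const B)
          (Eventually.of_forall fun z => ?_)
        rw [norm_mul, Real.norm_of_nonneg (kernel_nonneg n z), Real.norm_eq_abs]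
        exact mul_le_mul_of_nonneg_left (h1 z) (kernel_nonneg n z)
    _ = B := by rw [integral_mul_const, integral_kernel, one_mul]

/-- Testing the mollified equation with its own solution bounds the Dirichlet integral `q` by `A
√q`, hence by `A²`. This is how a merely locally integrable `u` acquires finite energy. -/
lemma IsSolutionP.exists_dirichlet_mollify_le (hN : 1 ≤ N) [IsFiniteMeasure μ]
    (hμ : HasFiniteEnergy μ) (hΩo : IsOpen Ω) (hΩ : Bornology.IsBounded Ω)
    (hu : IsSolutionP μ Ω u) : ∃ M, ∀ n, ∫ x, ‖gradient (mollify n u) x‖ ^ 2 ≤ M := by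
  have hB : Bornology.IsBounded (Metric.cthickening 1 Ω) := hΩ.cthickening
  obtain ⟨K, hK0, hK⟩ := exists_poincare hN hμ hB
  obtain ⟨C, hC0, hC⟩ := hμ.exists_smoothMeasure_le
  set b := (volume (Metric.cthickening 1 Ω)).toReal with hb
  have hb0 : 0 ≤ b := ENNReal.toReal_nonneg
  set A := Real.sqrt (b * K) + Real.sqrt (C * (K + 1)) with hA
  have hA0 : 0 ≤ A := by positivity
  refine ⟨A ^ 2, fun n => ?_⟩
  set w := mollify n u with hw
  have hwt : IsTest (Metric.cthickening 1 Ω) w := hu.isTest_mollify hΩ n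
  set q := ∫ x, ‖gradient w x‖ ^ 2 with hq
  have hq0 : 0 ≤ q := integral_nonneg fun _ => sq_nonneg _
  have hind : Integrable (indicator Ω fun _ => (1 : ℝ)) :=
    (integrable_indicator_iff hΩo.measurableSet).2 (integrableOn_const hΩ.measure_lt_top.ne)
  set m := mollify n (indicator Ω fun _ => (1 : ℝ)) with hm
  have hmc : Continuous m := (contDiff_mollify n hind.locallyIntegrable).continuous
  have hm1 : ∀ x, ‖m x‖ ≤ 1 := norm_mollify_le zero_le_one hind.1 fun x => by
    by_cases hx : x ∈ Ω <;> simp [hx]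
  have i1 : Integrable fun x => w x * m x :=
    (hwt.continuous.mul hmc).integrable_of_hasCompactSupport hwt.2.1.mul_right
  have i2 : Integrable fun x => w x * smoothMeasure μ n x :=
    (hwt.continuous.mul (continuous_smoothMeasure n)).integrable_of_hasCompactSupport
      hwt.2.1.mul_right
  have green := hwt.integral_mul_laplacian (hwt.1.of_le (by simp))
  simp only [real_inner_self_eq_norm_sq] at green
  have e1 : q = -(∫ x, w x * m x) + ∫ x, w x * smoothMeasure μ n x := by
    rw [hq, ← neg_eq_iff_eq_neg.2 green]
    simp only [hw, hu.laplacian_mollify hΩo.measurableSet n, mul_sub]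
    rw [integral_sub i1 i2]; ring
  have b1 : |∫ x, w x * m x| ≤ Real.sqrt (b * K) * Real.sqrt q := by
    rw [← Real.sqrt_mul (by positivity), ← Real.norm_eq_abs]
    have : ∫ x, |w x| ≤ Real.sqrt (b * K * q) := by
      have h := integral_abs_le_sqrt hB (hwt.memLp 2 volume)
      have e : ∫ x in Metric.cthickening 1 Ω, |w x| = ∫ x, |w x| :=
        setIntegral_eq_integral_of_forall_compl_eq_zero fun x hx => by
          rw [image_eq_zero_of_notMem_tsupport fun h => hx (hwt.2.2 h), abs_zero]
      have e' : ∫ x in Metric.cthickening 1 Ω, w x ^ 2 = ∫ x, w x ^ 2 :=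
        setIntegral_eq_integral_of_forall_compl_eq_zero fun x hx => by
          rw [image_eq_zero_of_notMem_tsupport fun h => hx (hwt.2.2 h)]; ring
      rw [e, e'] at h
      refine h.trans (Real.sqrt_le_sqrt ?_)
      rw [mul_assoc]
      exact mul_le_mul_of_nonneg_left (hK w hwt).1 hb0
    refine le_trans (norm_integral_le_of_norm_le (hwt.integrable volume).abs
      (Eventually.of_forall fun x => ?_)) this
    rw [norm_mul, Real.norm_eq_abs]
    exact mul_le_of_le_one_right (abs_nonneg _) (hm1 x)
  have b2 : |∫ x, w x * smoothMeasure μ n x| ≤ Real.sqrt (C * (K + 1)) * Real.sqrt q := by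
    rw [← Real.sqrt_mul (by positivity)]
    refine (hC w hwt.univ n).trans (Real.sqrt_le_sqrt ?_)
    rw [mul_assoc]
    exact mul_le_mul_of_nonneg_left (by linarith [(hK w hwt).1]) hC0
  have hqs : Real.sqrt q * Real.sqrt q = q := Real.mul_self_sqrt hq0
  have h3 : q ≤ A * Real.sqrt q := by
    have := neg_abs_le (∫ x, w x * m x)
    have := le_abs_self (∫ x, w x * smoothMeasure μ n x)
    rw [hA, add_mul]
    linarith
  have h4 : Real.sqrt q ≤ A := by
    rcases (Real.sqrt_nonneg q).eq_or_lt with h | h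
    · rw [← h]; exact hA0
    · refine le_of_mul_le_mul_right ?_ h
      rw [hqs]; exact h3
  rw [← hqs, sq]
  exact mul_le_mul h4 h4 (Real.sqrt_nonneg _) hA0

/-- Rescaled as `ε F(· / ε)`, it removes values below `ε`, moves the others by at most `2ε`, and has
a derivative bounded independently of `ε`. -/
lemma exists_truncation : ∃ F : ℝ → ℝ, ContDiff ℝ ∞ F ∧ (∀ s ≤ 1, F s = 0) ∧
    (∀ s, 0 ≤ s → |F s - s| ≤ 2) ∧ ∃ C, 0 ≤ C ∧ ∀ s, |deriv F s| ≤ C := by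
  set F : ℝ → ℝ := fun s => s * Real.smoothTransition (s - 1) with hF
  have hFc : ContDiff ℝ ∞ F :=
    contDiff_id.mul (Real.smoothTransition.contDiff.comp (contDiff_id.sub contDiff_const))
  have h0 : ∀ s ≤ 1, F s = 0 := fun s hs => by
    simp only [hF]
    rw [Real.smoothTransition.zero_of_nonpos (by linarith), mul_zero]
  have h1 : ∀ s, 2 ≤ s → F s = s := fun s hs => by
    simp only [hF]
    rw [Real.smoothTransition.one_of_one_le (by linarith), mul_one]
  refine ⟨F, hFc, h0, fun s hs => ?_, ?_⟩
  · rcases le_total 2 s with h | h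
    · rw [h1 s h]; simp
    · have e : F s - s = s * (Real.smoothTransition (s - 1) - 1) := by simp only [hF]; ring
      rw [e, abs_mul, abs_of_nonneg hs]
      have a1 := Real.smoothTransition.nonneg (s - 1)
      have a2 := Real.smoothTransition.le_one (s - 1)
      have : |Real.smoothTransition (s - 1) - 1| ≤ 1 := by rw [abs_le]; constructor <;> linarith
      nlinarith [abs_nonneg (Real.smoothTransition (s - 1) - 1)]
  · obtain ⟨C, hC⟩ := (isCompact_Icc (a := (1 : ℝ)) (b := 2)).exists_bound_of_continuousOn
      (hFc.continuous_deriv (by simp)).continuousOn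
    refine ⟨max C 1, le_max_of_le_right zero_le_one, fun s => ?_⟩
    by_cases hs : s ∈ Icc (1 : ℝ) 2
    · exact (hC s hs).trans (le_max_left _ _)
    · rw [mem_Icc, not_and_or, not_le, not_le] at hs
      rcases hs with hs | hs
      · have : F =ᶠ[𝓝 s] fun _ => 0 := by
          filter_upwards [Iio_mem_nhds hs] with t ht using h0 t (le_of_lt ht)
        rw [this.deriv_eq]; simp
      · have : F =ᶠ[𝓝 s] fun t => t := by
          filter_upwards [Ioi_mem_nhds hs] with t ht using h1 t (le_of_lt ht)
        rw [this.deriv_eq]; simp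

lemma IsSolutionP.exists_small_near_compl (hμc : IsCompact μ.support) (hΩo : IsOpen Ω)
    (hΩ : Bornology.IsBounded Ω) (hμΩ : μ.support ⊆ Ω) (hu : IsSolutionP μ Ω u) {ε : ℝ}
    (hε : 0 < ε) : ∃ δ > 0, ∀ x ∉ Ω, ∀ y, dist y x < δ → u y ≤ ε := by
  obtain ⟨d, hd, hdΩ⟩ := hμc.exists_cthickening_subset_open hΩo hμΩ
  -- Points near the complement of `Ω` stay at distance `d / 2` from the support of `μ`, so uniform
  -- continuity of `u` on this compact set is all that is used.
  set K := Metric.cthickening 1 (closure Ω) \ Metric.thickening (d / 2) μ.support with hK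
  have hKc : IsCompact K := hΩ.isCompact_closure.cthickening.diff Metric.isOpen_thickening
  have hcK : ContinuousOn u K := hu.continuousOn.mono fun x hx h =>
    hx.2 (Metric.self_subset_thickening (by positivity) _ h)
  obtain ⟨δ, hδ, H⟩ := Metric.uniformContinuousOn_iff.1
    (hKc.uniformContinuousOn_of_continuous hcK) ε hε
  refine ⟨min δ (min (d / 2) 1), by positivity, fun x hx y hy => ?_⟩
  by_cases hyΩ : y ∈ Ω
  · have h1 : dist y x < δ := hy.trans_le (min_le_left _ _)
    have h2 : dist y x < d / 2 := hy.trans_le ((min_le_right _ _).trans (min_le_left _ _))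
    have h3 : dist y x < 1 := hy.trans_le ((min_le_right _ _).trans (min_le_right _ _))
    have hfar : ∀ z, dist z x < d / 2 → z ∉ Metric.thickening (d / 2) μ.support := fun z hz h => by
      obtain ⟨s, hs, hzs⟩ := Metric.mem_thickening_iff.1 h
      refine hx (hdΩ (Metric.mem_cthickening_of_dist_le x s d _ hs ?_))
      have := dist_triangle x z s
      rw [dist_comm x z] at this
      linarith
    have hyK : y ∈ K := ⟨Metric.self_subset_cthickening _ (subset_closure hyΩ), hfar y h2⟩
    have hxK : x ∈ K := ⟨Metric.mem_cthickening_of_dist_le x y 1 _ (subset_closure hyΩ)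
      (by rw [dist_comm]; exact h3.le), hfar x (by rw [dist_self]; positivity)⟩
    have := H y hyK x hxK h1
    rw [hu.eq_zero x hx, Real.dist_eq, sub_zero] at this
    exact (le_abs_self _).trans this.le
  · rw [hu.eq_zero y hyΩ]; exact hε.le

/-- Off `Ω` a fine mollification of `u` is at most `ε / 2`. Truncating values below `ε` therefore
gives a test function on `Ω`, with Dirichlet integral bounded uniformly. The boundary of `Ω` may be
arbitrary. -/
lemma IsSolutionP.exists_test_approx (hN : 1 ≤ N) [IsFiniteMeasure μ]
    (hμ : HasFiniteEnergy μ) (hμc : IsCompact μ.support) (hΩo : IsOpen Ω)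
    (hΩ : Bornology.IsBounded Ω) (hμΩ : μ.support ⊆ Ω) (hu : IsSolutionP μ Ω u) :
    ∃ M, ∀ δ > 0, ∃ φ, IsTest Ω φ ∧ ∫ x, |φ x - u x| ≤ δ ∧ ∫ x, ‖gradient φ x‖ ^ 2 ≤ M := by
  obtain ⟨M, hM⟩ := hu.exists_dirichlet_mollify_le hN hμ hΩo hΩ
  obtain ⟨F, hFc, hF0, hF2, C, hC0, hFC⟩ := exists_truncation
  refine ⟨C ^ 2 * M, fun δ hδ => ?_⟩
  have hB : Bornology.IsBounded (Metric.cthickening 1 Ω) := hΩ.cthickening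
  set b := (volume (Metric.cthickening 1 Ω)).toReal with hb
  have hb0 : 0 ≤ b := ENNReal.toReal_nonneg
  -- The truncation error is at most `2 ε` on a set of volume `b`, hence at most `δ / 2` in `L¹`;
  -- mollification uses the other half.
  set ε := δ / (4 * (b + 1)) with hε
  have hεpos : 0 < ε := by positivity
  have hεb : 2 * ε * b ≤ δ / 2 := by
    have : ε * (4 * (b + 1)) = δ := by rw [hε]; field_simp
    nlinarith
  obtain ⟨r, hr, hsmall⟩ := hu.exists_small_near_compl hμc hΩo hΩ hμΩ (half_pos hεpos)
  have hint := hu.integrable hΩ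
  obtain ⟨n, hn1, hn2⟩ : ∃ n : ℕ, 1 / ((n : ℝ) + 1) < r ∧ ∫ x, |mollify n u x - u x| < δ / 2 :=
    ((tendsto_one_div_add_atTop_nhds_zero_nat.eventually_lt_const hr).and
      ((tendsto_integral_abs_mollify_sub hint hu.nonneg).eventually_lt_const (half_pos hδ))).exists
  set w := mollify n u with hw
  have hwt : IsTest (Metric.cthickening 1 Ω) w := hu.isTest_mollify hΩ n
  have hw0 : ∀ x, 0 ≤ w x := mollify_nonneg hu.nonneg
  have hwΩ : ∀ x ∉ Ω, w x ≤ ε / 2 := fun x hx => by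
    have := dist_mollify_le (n := n) (f := u) (x := x) (z := 0) (half_pos hεpos).le hint.1
      fun y hy => by
        rw [Real.dist_eq, sub_zero, abs_of_nonneg (hu.nonneg y)]
        exact hsmall x hx y (hy.trans hn1)
    rw [Real.dist_eq, sub_zero] at this
    exact (le_abs_self _).trans this
  set φ : Euc N → ℝ := fun x => ε * F (w x / ε) with hφ
  have hφ0 : ∀ x, w x < ε → φ x = 0 := fun x hx => by
    simp only [hφ]
    rw [hF0 _ ((div_le_one hεpos).2 hx.le), mul_zero]
  have hsub : tsupport φ ⊆ Ω := by
    refine (closure_minimal (t := {x | ε ≤ w x}) (fun x hx => ?_)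
      (isClosed_le continuous_const hwt.continuous)).trans fun x hx => ?_
    · by_contra h
      exact hx (hφ0 x (not_le.1 h))
    · by_contra h
      have := hwΩ x h
      rw [mem_ofPred_eq] at hx
      linarith
  have hφt : IsTest Ω φ := by
    refine ⟨contDiff_const.mul (hFc.comp (hwt.1.div_const ε)), hwt.2.1.mono fun x hx h => hx ?_, hsub⟩
    exact hφ0 x (by rw [h]; exact hεpos)
  refine ⟨φ, hφt, ?_, ?_⟩
  · have hd : ∀ x, |φ x - w x| ≤ 2 * ε := fun x => by
      have h := hF2 (w x / ε) (div_nonneg (hw0 x) hεpos.le)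
      have e : φ x - w x = ε * (F (w x / ε) - w x / ε) := by
        simp only [hφ]; field_simp
      rw [e, abs_mul, abs_of_pos hεpos]
      nlinarith
    have i1 : Integrable fun x => |φ x - w x| := ((hφt.integrable volume).sub (hwt.integrable volume)).abs
    have i2 : Integrable fun x => |w x - u x| := ((hwt.integrable volume).sub hint).abs
    have h1 : ∫ x, |φ x - w x| ≤ 2 * ε * b := by
      have e : ∫ x in Metric.cthickening 1 Ω, |φ x - w x| = ∫ x, |φ x - w x| :=
        setIntegral_eq_integral_of_forall_compl_eq_zero fun x hx => by
          have hwx : w x = 0 := image_eq_zero_of_notMem_tsupport fun h => hx (hwt.2.2 h)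
          rw [hφ0 x (by rw [hwx]; exact hεpos), hwx, sub_zero, abs_zero]
      rw [← e]
      refine (setIntegral_mono i1.integrableOn
        (integrableOn_const (C := 2 * ε) hB.measure_lt_top.ne) hd).trans ?_
      rw [setIntegral_const, smul_eq_mul, mul_comm]
      rfl
    calc ∫ x, |φ x - u x| ≤ ∫ x, (|φ x - w x| + |w x - u x|) :=
          integral_mono ((hφt.integrable volume).sub hint).abs (i1.add i2) fun x => abs_sub_le _ _ _
      _ = (∫ x, |φ x - w x|) + ∫ x, |w x - u x| := integral_add i1 i2
      _ ≤ δ := by linarith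
  · have hg : ∀ x, ‖gradient φ x‖ ^ 2 ≤ C ^ 2 * ‖gradient w x‖ ^ 2 := fun x => by
      have hFd : Differentiable ℝ F := hFc.differentiable (by simp)
      have hd : HasDerivAt (fun s => ε * F (s / ε)) (deriv F (w x / ε)) (w x) := by
        have h := (((hFd (w x / ε)).hasDerivAt.comp (w x) ((hasDerivAt_id (w x)).div_const ε)).const_mul ε)
        have e : ε * (deriv F (w x / ε) * (1 / ε)) = deriv F (w x / ε) := by field_simp
        rw [e] at h
        exact h
      have := gradient_comp' (f := w) (x := x) hd.differentiableAt (hwt.differentiable x)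
      rw [hd.deriv] at this
      simp only [hφ]
      rw [this, norm_smul, mul_pow]
      exact mul_le_mul_of_nonneg_right (pow_le_pow_left₀ (norm_nonneg _) (hFC _) 2) (sq_nonneg _)
    calc ∫ x, ‖gradient φ x‖ ^ 2 ≤ ∫ x, C ^ 2 * ‖gradient w x‖ ^ 2 :=
          integral_mono (integrable_norm_sq_of_memLp (hφt.memLp_gradient 2 volume))
            ((integrable_norm_sq_of_memLp (hwt.memLp_gradient 2 volume)).const_mul _) hg
      _ ≤ C ^ 2 * M := by
          rw [integral_const_mul]
          exact mul_le_mul_of_nonneg_left (hM n) (sq_nonneg _)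

end

/-! ### The solution of (P) is the state of `Ω` -/

section

variable {N : ℕ} {μ : Measure (Euc N)} {Ω U : Set (Euc N)} {u : Euc N → ℝ}

lemma IsTest.mid {φ ψ : Euc N → ℝ} (hφ : IsTest U φ) (hψ : IsTest U ψ) :
    IsTest U fun x => 1 / 2 * φ x + 1 / 2 * ψ x :=
  (hφ.const_mul _).add (hψ.const_mul _)

lemma IsTest.dirichlet_parallelogram {φ ψ : Euc N → ℝ} (hφ : IsTest U φ) (hψ : IsTest U ψ) :
    ∫ x, ‖gradient φ x - gradient ψ x‖ ^ 2 = 2 * (∫ x, ‖gradient φ x‖ ^ 2) +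
      2 * (∫ x, ‖gradient ψ x‖ ^ 2) -
      2 * (2 * ∫ x, ‖gradient (fun x => 1 / 2 * φ x + 1 / 2 * ψ x) x‖ ^ 2) := by
  have i1 := integrable_norm_sq_of_memLp (hφ.memLp_gradient 2 volume)
  have i2 := integrable_norm_sq_of_memLp (hψ.memLp_gradient 2 volume)
  have i3 := integrable_norm_sq_of_memLp ((hφ.mid hψ).memLp_gradient 2 volume)
  have hg : ∀ x, gradient (fun x => 1 / 2 * φ x + 1 / 2 * ψ x) x =
      (1 / 2 : ℝ) • gradient φ x + (1 / 2 : ℝ) • gradient ψ x := fun x => by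
    rw [gradient_add' (hφ.const_mul _ |>.differentiable x) (hψ.const_mul _ |>.differentiable x),
      gradient_const_mul' (hφ.differentiable x), gradient_const_mul' (hψ.differentiable x)]
  rw [← integral_const_mul, ← integral_const_mul, ← integral_const_mul, ← integral_const_mul,
    ← integral_add (i1.const_mul _) (i2.const_mul _),
    ← integral_sub (by exact (i1.const_mul _).add (i2.const_mul _)) ((i3.const_mul _).const_mul _)]
  refine integral_congr_ae (Eventually.of_forall fun x => ?_)
  simp only
  rw [hg, ← smul_add, norm_smul, mul_pow, norm_add_sq_real, norm_sub_sq_real]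
  norm_num
  ring

/-- Test functions that tend to `u` in `L¹` and nearly minimise the Dirichlet integral among their
neighbours converge strongly in `H¹₀(Ω)`, and the limit must be `u`. The distributional equation
then becomes the weak one by integrating by parts on the approximations. -/
lemma IsSolutionP.exists_isState (hN : 1 ≤ N) [IsFiniteMeasure μ]
    (hμ : HasFiniteEnergy μ) (hμc : IsCompact μ.support) (hΩo : IsOpen Ω)
    (hΩ : Bornology.IsBounded Ω) (hμΩ : μ.support ⊆ Ω) (hu : IsSolutionP μ Ω u) :
    ∃ v G, IsState μ Ω v G ∧ v =ᵐ[volume] u := by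
  obtain ⟨M, hM⟩ := hu.exists_test_approx hN hμ hμc hΩo hΩ hμΩ
  have hint := hu.integrable hΩ
  have hi : ∀ φ, IsTest Ω φ → Integrable fun x => |φ x - u x| := fun φ hφ =>
    ((hφ.integrable volume).sub hint).abs
  obtain ⟨w, hwS, -, hwc⟩ := exists_cauchy_minimizing
    (S := fun n : ℕ => {φ : Euc N → ℝ | IsTest Ω φ ∧ ∫ x, |φ x - u x| ≤ 1 / ((n : ℝ) + 1)})
    (fun i j hij φ hφ => ⟨hφ.1, hφ.2.trans (one_div_le_one_div_of_le (by positivity)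
      (by have : (i : ℝ) ≤ j := by exact_mod_cast hij
          linarith))⟩)
    (mid := fun φ ψ x => 1 / 2 * φ x + 1 / 2 * ψ x)
    (fun n φ hφ ψ hψ => ⟨hφ.1.mid hψ.1, by
      calc ∫ x, |1 / 2 * φ x + 1 / 2 * ψ x - u x|
          ≤ ∫ x, (1 / 2 * |φ x - u x| + 1 / 2 * |ψ x - u x|) := by
            refine integral_mono (hi _ (hφ.1.mid hψ.1))
              (((hi φ hφ.1).const_mul _).add ((hi ψ hψ.1).const_mul _)) fun x => ?_
            have e : 1 / 2 * φ x + 1 / 2 * ψ x - u x =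
              1 / 2 * (φ x - u x) + 1 / 2 * (ψ x - u x) := by ring
            simp only
            rw [e]
            refine (abs_add_le _ _).trans ?_
            rw [abs_mul, abs_mul, abs_of_nonneg (by norm_num : (0 : ℝ) ≤ 1 / 2)]
        _ = 1 / 2 * (∫ x, |φ x - u x|) + 1 / 2 * ∫ x, |ψ x - u x| := by
            rw [integral_add ((hi φ hφ.1).const_mul _) ((hi ψ hψ.1).const_mul _),
              integral_const_mul, integral_const_mul]
        _ ≤ 1 / ((n : ℝ) + 1) := by linarith [hφ.2, hψ.2]⟩)
    -- The factor `2` makes the parallelogram identity exactly the hypothesis on `d`.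
    (F := fun φ => 2 * ∫ x, ‖gradient φ x‖ ^ 2)
    (d := fun φ ψ => ∫ x, ‖gradient φ x - gradient ψ x‖ ^ 2)
    (fun φ hφ ψ hψ => (hφ.1.dirichlet_parallelogram hψ.1).le)
    (m := 0) (M := 2 * M)
    (fun φ _ => mul_nonneg zero_le_two (integral_nonneg fun _ => sq_nonneg _))
    (fun n => by
      obtain ⟨φ, h1, h2, h3⟩ := hM (1 / ((n : ℝ) + 1)) (by positivity)
      exact ⟨φ, ⟨h1, h2⟩, mul_le_mul_of_nonneg_left h3 zero_le_two⟩)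
  have hwt : ∀ n, IsTest Ω (w n) := fun n => (hwS n).1
  obtain ⟨v, G, hv⟩ := exists_tendstoH1_of_cauchy hN hμ hΩ hwt hwc
  -- The same sequence tends to `v` in `L²` and to `u` in `L¹`, and limits in measure are unique.
  have hvu : v =ᵐ[volume] u := by
    refine tendstoInMeasure_ae_unique (f := w) (u := atTop)
      (tendstoInMeasure_of_tendsto_eLpNorm two_ne_zero
        (fun n => (hwt n).continuous.aestronglyMeasurable) hv.memLp.1 hv.tendsto)
      (tendstoInMeasure_of_tendsto_eLpNorm one_ne_zero
        (fun n => (hwt n).continuous.aestronglyMeasurable) hint.1 ?_)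
    have hL : ∀ n, Integrable (w n - u) := fun n => ((hwt n).integrable volume).sub hint
    rw [← ENNReal.tendsto_toReal_iff (fun n => (memLp_one_iff_integrable.2 (hL n)).2.ne) (by simp)]
    simp only [toReal_eLpNorm_one (hL _), ENNReal.toReal_zero]
    exact squeeze_zero (fun n => integral_nonneg fun _ => abs_nonneg _) (fun n => (hwS n).2)
      tendsto_one_div_add_atTop_nhds_zero_nat
  refine ⟨v, G, ⟨hv.memLp_of_test hwt, fun φ hφ => ?_⟩, hvu⟩
  have hL := hφ.laplacian
  have t1 := hv.tendsto_inner hwt Set.univ (hφ.memLp_gradient 2 volume)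
  have t2 := tendsto_integral_inner (ν := volume) (f := fun _ => Laplacian.laplacian φ)
    (f₀ := Laplacian.laplacian φ) (fun _ => hL.memLp 2 volume) (fun n => (hwt n).memLp 2 volume)
    (hL.memLp 2 volume) hv.memLp (by simp) hv.tendsto
  have e : ∀ n, ∫ x in Set.univ, inner ℝ (gradient φ x) (gradient (w n) x) =
      -∫ x, inner ℝ (Laplacian.laplacian φ x) (w n x) := fun n => by
    have h := hφ.integral_mul_laplacian ((hwt n).1.of_le (by simp))
    rw [Measure.restrict_univ, ← neg_eq_iff_eq_neg]
    simp only [real_inner_comm (gradient (w n) _)] at h ⊢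
    rw [← h]
    rfl
  simp only [e] at t1
  have key := tendsto_nhds_unique t1 t2.neg
  have e3 : ∫ x in Ω, inner ℝ (G x) (gradient φ x) = ∫ x in Set.univ, inner ℝ (gradient φ x) (G x) := by
    rw [Measure.restrict_univ, setIntegral_eq_integral_of_forall_compl_eq_zero fun x hx => by
      rw [hφ.gradient_eq_zero hx, inner_zero_right]]
    exact integral_congr_ae (Eventually.of_forall fun x => real_inner_comm _ _)
  have e4 : ∫ x, inner ℝ (Laplacian.laplacian φ x) (v x) = ∫ x, u x * Laplacian.laplacian φ x := by
    refine integral_congr_ae ?_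
    filter_upwards [hvu] with x hx
    rw [hx]; rfl
  rw [e3, key, e4, hu.equation φ hφ.univ, hφ.setIntegral_eq]
  congr 2
  exact (hφ.setIntegral_eq μ).symm

end

/-! ### Interior gradient estimate by the maximum principle -/

section

section GradientEstimate

variable {N : ℕ}

/-- A negative second derivative would make the minimum also a maximum, so `f` would be locally
constant, with zero second derivative. -/
lemma nonneg_of_isLocalMin_second_deriv {f f' : ℝ → ℝ} {c : ℝ} (hf : ∀ s, HasDerivAt f (f' s) s)
    (hf' : HasDerivAt f' c 0) (hm : IsLocalMin f 0) : 0 ≤ c := by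
  by_contra! hc
  have e : deriv f = f' := funext fun s => (hf s).deriv
  have h0 : f' 0 = 0 := hm.hasDerivAt_eq_zero (hf 0)
  have hM : IsLocalMax f 0 := isLocalMax_of_deriv_deriv_neg (by rw [e, hf'.deriv]; exact hc)
    (by rw [e, h0]) (hf 0).continuousAt
  have hconst : f =ᶠ[𝓝 0] fun _ => f 0 := by
    filter_upwards [hm, hM] with s h1 h2 using le_antisymm h2 h1
  have hd : deriv f =ᶠ[𝓝 0] fun _ => 0 := by
    simpa using hconst.deriv
  have := hd.deriv_eq
  rw [e, hf'.deriv] at this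
  simp only [deriv_const] at this
  exact hc.ne this

lemma hasDerivAt_line {w : Euc N → ℝ} (hw : Differentiable ℝ w) (p v : Euc N) (s : ℝ) :
    HasDerivAt (fun s : ℝ => w (p + s • v)) (fderiv ℝ w (p + s • v) v) s := by
  have h1 : HasDerivAt (fun s : ℝ => p + s • v) v s := by
    simpa using ((hasDerivAt_id s).smul_const v).const_add p
  exact (hw _).hasFDerivAt.comp_hasDerivAt s h1

lemma fderiv_fderiv_neg (w : Euc N → ℝ) (p v : Euc N) :
    fderiv ℝ (fun q => fderiv ℝ w q (-v)) p (-v) = fderiv ℝ (fun q => fderiv ℝ w q v) p v := by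
  simp only [map_neg]
  rw [fderiv_fun_neg, neg_apply, neg_neg]

lemma second_deriv_barrier {w : Euc N → ℝ} (hw : ContDiff ℝ 2 w) {A B C : ℝ} {p v q v' : Euc N}
    (hm : IsLocalMin (fun s : ℝ => A + B * s + C * s ^ 2 - 1 / 2 * w (p + s • v) +
      1 / 2 * w (q + s • v')) 0) :
    0 ≤ 2 * C - 1 / 2 * fderiv ℝ (fun y => fderiv ℝ w y v) p v +
      1 / 2 * fderiv ℝ (fun y => fderiv ℝ w y v') q v' := by
  have hd := hw.differentiable two_ne_zero
  have hd2 : ∀ v, Differentiable ℝ fun y => fderiv ℝ w y v := fun v =>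
    ((hw.fderiv_right (m := 1) (by norm_num)).clm_apply contDiff_const).differentiable one_ne_zero
  refine nonneg_of_isLocalMin_second_deriv (f' := fun s => B + 2 * C * s -
    1 / 2 * fderiv ℝ w (p + s • v) v + 1 / 2 * fderiv ℝ w (q + s • v') v') (fun s => ?_) ?_ hm
  · have h1 : HasDerivAt (fun s : ℝ => A + B * s + C * s ^ 2) (B + 2 * C * s) s := by
      have h := (((hasDerivAt_id s).const_mul B).const_add A).add ((hasDerivAt_pow 2 s).const_mul C)
      refine h.congr_deriv ?_
      simp; ring
    exact (h1.sub ((hasDerivAt_line hd p v s).const_mul _)).add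
      ((hasDerivAt_line hd q v' s).const_mul _)
  · have h1 : HasDerivAt (fun s : ℝ => B + 2 * C * s) (2 * C) 0 := by
      simpa using ((hasDerivAt_id (0 : ℝ)).const_mul (2 * C)).const_add B
    have h2 := hasDerivAt_line (hd2 v) p v 0
    have h3 := hasDerivAt_line (hd2 v') q v' 0
    simp only [zero_smul, add_zero] at h2 h3
    exact (h1.sub (h2.const_mul _)).add (h3.const_mul _)

/-- Interior gradient estimate for the Poisson equation. -/
lemma fderiv_apply_le_of_laplacian {ι : Type*} [Fintype ι] (b : OrthonormalBasis ι ℝ (Euc N))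
    {w : Euc N → ℝ} (hw : ContDiff ℝ 2 w) {x : Euc N} {d m F : ℝ} (hd : 0 < d)
    (hm : ∀ y, ‖y‖ ≤ d → |w (x + y)| ≤ m)
    (hF : ∀ y, ‖y‖ ≤ d → |Laplacian.laplacian w (x + y)| < F) (i : ι) :
    fderiv ℝ w x (b i) ≤ Fintype.card ι * m / d + F * d / 2 := by
  classical
  set n : ℝ := ((Fintype.card ι : ℕ) : ℝ) with hn
  have hm0 : 0 ≤ m := (abs_nonneg _).trans (hm 0 (by simpa using hd.le))
  have hF0 : 0 < F := (abs_nonneg _).trans_lt (hF 0 (by simpa using hd.le))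
  -- `a` is fixed so that `a |y|²` reaches `m` on the sphere of radius `d`. `β` is fixed so that the
  -- Laplacian `2 n a - 2 β` of the barrier equals `-F`.
  set a := m / d ^ 2 with ha
  set β := n * a + F / 2 with hβ
  have ha0 : 0 ≤ a := by positivity
  have hn0 : 0 ≤ n := Nat.cast_nonneg _
  have hβ0 : 0 ≤ β := by positivity
  set e := b i with he
  have hne : ‖e‖ = 1 := b.norm_eq_one i
  have hee : inner ℝ e e = (1 : ℝ) := by rw [real_inner_self_eq_norm_sq, hne, one_pow]
  set R : Euc N → Euc N := fun y => y - (2 * inner ℝ e y) • e with hR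
  have hRn : ∀ y, ‖R y‖ = ‖y‖ := fun y => by
    refine (sq_eq_sq₀ (norm_nonneg _) (norm_nonneg _)).1 ?_
    simp only [hR]
    rw [norm_sub_sq_real, norm_smul, hne, real_inner_smul_right, real_inner_comm, mul_one,
      Real.norm_eq_abs, sq_abs]
    ring
  -- The barrier minus the odd part of `w` under the reflection `R`, on a half ball. The odd part
  -- vanishes on the flat face and has slope `∂_e w(x)` at the centre.
  set h : Euc N → ℝ := fun y => a * ‖y‖ ^ 2 + β * (inner ℝ e y * (d - inner ℝ e y)) -
    1 / 2 * w (x + y) + 1 / 2 * w (x + R y) with hh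
  have hcw := hw.continuous
  have hch : Continuous h := by simp only [hh, hR]; fun_prop
  set H : Set (Euc N) := Metric.closedBall 0 d ∩ {y | 0 ≤ inner ℝ e y} with hH
  have hHc : IsCompact H := (isCompact_closedBall 0 d).inter_right
    (isClosed_le continuous_const (by fun_prop))
  have h0H : (0 : Euc N) ∈ H := ⟨by simpa using hd.le, by simp⟩
  obtain ⟨y, hyH, hymin⟩ := hHc.exists_isMinOn ⟨0, h0H⟩ hch.continuousOn
  have hyd : ‖y‖ ≤ d := by simpa using hyH.1
  have hyi : 0 ≤ inner ℝ e y := hyH.2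
  have hyi' : inner ℝ e y ≤ ‖y‖ := by
    have := real_inner_le_norm e y
    rwa [hne, one_mul] at this
  have hhy : 0 ≤ h y := by
    rcases hyi.eq_or_lt with h0 | hpos
    · have : R y = y := by simp only [hR]; rw [← h0]; simp
      simp only [hh]
      rw [this, ← h0]
      have : 0 ≤ a * ‖y‖ ^ 2 := by positivity
      linarith
    rcases hyd.eq_or_lt with h1 | hlt
    · have e1 : a * ‖y‖ ^ 2 = m := by rw [h1, ha]; field_simp
      have e2 : 0 ≤ β * (inner ℝ e y * (d - inner ℝ e y)) :=
        mul_nonneg hβ0 (mul_nonneg hyi (by linarith))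
      have e3 := le_of_abs_le (hm y hyd)
      have e4 := neg_le_of_abs_le (hm (R y) (by rw [hRn]; exact hyd))
      simp only [hh]
      linarith
    -- At an interior minimum every second directional derivative of `h` would be nonnegative, while
    -- their sum is negative by the choice of `β` and the strict bound `F`.
    · exfalso
      have hnhds : H ∈ 𝓝 y := by
        refine inter_mem ?_ ?_
        · exact mem_of_superset (Metric.isOpen_ball.mem_nhds (by simpa using hlt))
            Metric.ball_subset_closedBall
        · have hc : Continuous fun y : Euc N => inner ℝ e y := by fun_prop
          exact mem_of_superset ((isOpen_lt continuous_const hc).mem_nhds hpos)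
            fun z hz => by
              rw [mem_ofPred_eq] at hz ⊢; exact hz.le
      have hloc : IsLocalMin h y := hymin.isLocalMin hnhds
      have hj : ∀ j, 0 ≤ 2 * (a - β * (if i = j then 1 else 0)) -
          1 / 2 * fderiv ℝ (fun y => fderiv ℝ w y (b j)) (x + y) (b j) +
          1 / 2 * fderiv ℝ (fun y => fderiv ℝ w y (b j)) (x + R y) (b j) := fun j => by
        set δ : ℝ := if i = j then 1 else 0 with hδ
        have hin : inner ℝ e (b j) = δ := by
          rw [he, orthonormal_iff_ite.1 b.orthonormal i j]
        have hδ2 : δ ^ 2 = δ := by rw [hδ]; split_ifs <;> norm_num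
        have hnj : ‖b j‖ = 1 := b.norm_eq_one j
        have hline : IsLocalMin (fun s : ℝ => h (y + s • b j)) 0 := by
          have hc : ContinuousAt (fun s : ℝ => y + s • b j) 0 := by fun_prop
          have hc' : Tendsto (fun s : ℝ => y + s • b j) (𝓝 0) (𝓝 y) := by simpa using hc.tendsto
          refine (hc'.eventually hloc).mono fun s hs => ?_
          simpa using hs
        have hRj : ∀ s : ℝ, R (y + s • b j) = R y + s • R (b j) := fun s => by
          simp only [hR, inner_add_right, real_inner_smul_right]
          module
        have heq : (fun s : ℝ => h (y + s • b j)) = fun s =>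
            (a * ‖y‖ ^ 2 + β * (inner ℝ e y * (d - inner ℝ e y))) +
            (2 * a * inner ℝ y (b j) + β * δ * (d - 2 * inner ℝ e y)) * s +
            (a - β * δ) * s ^ 2 - 1 / 2 * w ((x + y) + s • b j) +
            1 / 2 * w ((x + R y) + s • R (b j)) := by
          funext s
          simp only [hh]
          rw [hRj, norm_add_sq_real, inner_add_right, real_inner_smul_right, real_inner_smul_right,
            norm_smul, hnj, hin, add_assoc x y, add_assoc x (R y), mul_one, Real.norm_eq_abs, sq_abs]
          have : β * δ = β * δ ^ 2 := by rw [hδ2]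
          rw [show (a - β * δ) * s ^ 2 = a * s ^ 2 - β * δ * s ^ 2 by ring, this]
          have h2 : β * δ ^ 2 * (d - 2 * inner ℝ e y) = β * δ * (d - 2 * inner ℝ e y) := by rw [hδ2]
          rw [h2]
          ring
        rw [heq] at hline
        have := second_deriv_barrier hw hline
        have hRb : R (b j) = b j ∨ R (b j) = -(b j) := by
          simp only [hR, hin]
          by_cases hij : i = j
          · right
            rw [hδ, if_pos hij, he, hij]
            module
          · left
            rw [hδ, if_neg hij]
            simp
        rcases hRb with hRb | hRb
        · rwa [hRb] at this
        · rw [hRb, fderiv_fderiv_neg] at this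
          exact this
      have hsum := Finset.sum_nonneg fun j (_ : j ∈ Finset.univ) => hj j
      rw [Finset.sum_add_distrib, Finset.sum_sub_distrib, ← Finset.mul_sum, ← Finset.mul_sum,
        ← Finset.mul_sum, ← laplacian_eq_sum b hw, ← laplacian_eq_sum b hw,
        Finset.sum_sub_distrib, ← Finset.mul_sum, Finset.sum_ite_eq] at hsum
      simp only [Finset.mem_univ, if_true, Finset.sum_const, Finset.card_univ, nsmul_eq_mul] at hsum
      have f1 := neg_lt_of_abs_lt (hF y hyd)
      have f2 := lt_of_abs_lt (hF (R y) (by rw [hRn]; exact hyd))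
      rw [← hn] at hsum
      linarith
  have hpos : ∀ z ∈ H, 0 ≤ h z := fun z hz => hhy.trans (hymin hz)
  have hk : HasDerivAt (fun s : ℝ => h (s • e)) (β * d - fderiv ℝ w x e) 0 := by
    have heq : (fun s : ℝ => h (s • e)) = fun s => 0 + (β * d) * s +
        (a - β) * s ^ 2 - 1 / 2 * w (x + s • e) + 1 / 2 * w (x + s • (-e)) := by
      funext s
      have : R (s • e) = s • (-e) := by
        simp only [hR]
        rw [real_inner_smul_right, hee]
        module
      simp only [hh]
      rw [this, norm_smul, hne, real_inner_smul_right, hee, mul_one, Real.norm_eq_abs, sq_abs]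
      ring
    rw [heq]
    have hd1 := hw.differentiable two_ne_zero
    have h1 : HasDerivAt (fun s : ℝ => 0 + (β * d) * s + (a - β) * s ^ 2) (β * d) 0 := by
      have h := (((hasDerivAt_id (0 : ℝ)).const_mul (β * d)).const_add 0).add
        ((hasDerivAt_pow 2 (0 : ℝ)).const_mul (a - β))
      refine h.congr_deriv ?_
      simp
    have h2 := hasDerivAt_line hd1 x e 0
    have h3 := hasDerivAt_line hd1 x (-e) 0
    refine ((h1.sub (h2.const_mul _)).add (h3.const_mul _)).congr_deriv ?_
    simp only [zero_smul, add_zero, map_neg]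
    ring
  have hlim := hk.tendsto_slope_zero_right
  -- `h` vanishes at the centre and is nonnegative on the half ball, so its slope in direction `e`
  -- is nonnegative.
  have hge : 0 ≤ β * d - fderiv ℝ w x e := by
    refine ge_of_tendsto hlim ?_
    filter_upwards [Ioo_mem_nhdsGT hd] with s hs
    have e0 : h ((0 : ℝ) • e) = 0 := by simp [hh, hR]
    rw [zero_add, e0, sub_zero, smul_eq_mul]
    refine mul_nonneg (inv_nonneg.2 hs.1.le) (hpos _ ⟨?_, ?_⟩)
    · rw [mem_closedBall_zero_iff, norm_smul, hne, mul_one, Real.norm_of_nonneg hs.1.le]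
      exact hs.2.le
    · rw [mem_ofPred_eq, real_inner_smul_right, hee, mul_one]
      exact hs.1.le
  have : β * d = n * m / d + F * d / 2 := by
    rw [hβ, ha]; field_simp
  linarith

lemma norm_fderiv_le_of_laplacian {w : Euc N → ℝ} (hw : ContDiff ℝ 2 w) {x : Euc N} {d m F : ℝ}
    (hd : 0 < d) (hm : ∀ y, ‖y‖ ≤ d → |w (x + y)| ≤ m)
    (hF : ∀ y, ‖y‖ ≤ d → |Laplacian.laplacian w (x + y)| < F) :
    ‖fderiv ℝ w x‖ ≤ N * (N * m / d + F * d / 2) := by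
  set b := EuclideanSpace.basisFun (Fin N) ℝ
  have h1 : ∀ i, |fderiv ℝ w x (b i)| ≤ N * m / d + F * d / 2 := fun i => by
    have p1 := fderiv_apply_le_of_laplacian b hw hd hm hF i
    have p2 := fderiv_apply_le_of_laplacian b (w := -w) hw.neg (m := m) (F := F) hd
      (fun y hy => by rw [Pi.neg_apply, abs_neg]; exact hm y hy)
      (fun y hy => by
        rw [InnerProductSpace.laplacian_neg, Pi.neg_apply, abs_neg]; exact hF y hy) i
    rw [fderiv_neg, neg_apply] at p2
    rw [Fintype.card_fin] at p1 p2
    exact abs_le.2 ⟨by linarith, p1⟩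
  have hpos : 0 ≤ (N : ℝ) * (N * m / d + F * d / 2) := by
    have hm0 : 0 ≤ m := (abs_nonneg _).trans (hm 0 (by simpa using hd.le))
    have hF0 : 0 < F := (abs_nonneg _).trans_lt (hF 0 (by simpa using hd.le))
    positivity
  refine ContinuousLinearMap.opNorm_le_bound _ hpos fun v => ?_
  have hv : fderiv ℝ w x v = ∑ i, inner ℝ (b i) v * fderiv ℝ w x (b i) := by
    conv_lhs => rw [← b.sum_repr' v]
    simp
  rw [hv, Real.norm_eq_abs]
  calc |∑ i, inner ℝ (b i) v * fderiv ℝ w x (b i)|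
      ≤ ∑ i : Fin N, ‖v‖ * (N * m / d + F * d / 2) := by
        refine (Finset.abs_sum_le_sum_abs _ _).trans (Finset.sum_le_sum fun i _ => ?_)
        rw [abs_mul]
        refine mul_le_mul ?_ (h1 i) (abs_nonneg _) (norm_nonneg _)
        have := abs_real_inner_le_norm (b i) v
        rwa [b.norm_eq_one, one_mul] at this
    _ = N * (N * m / d + F * d / 2) * ‖v‖ := by
        simp; ring

end GradientEstimate

end

/-! ### Regularity of the solution off the support of `μ` -/

section

section Regularity

variable {N : ℕ} {μ : Measure (Euc N)} {Ω : Set (Euc N)} {u : Euc N → ℝ}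

lemma abs_mollify_indicator_le (hΩo : MeasurableSet Ω) (n : ℕ) (x : Euc N) :
    |mollify n (indicator Ω fun _ => (1 : ℝ)) x| ≤ 1 :=
  norm_mollify_le (f := indicator Ω fun _ => (1 : ℝ)) zero_le_one
    (aestronglyMeasurable_const.indicator hΩo) (fun x => by by_cases hx : x ∈ Ω <;> simp [hx]) x

lemma exists_uniform_mollify {O : Set (Euc N)} (hO : IsOpen O) (hu : ContinuousOn u O)
    (hm : AEStronglyMeasurable u volume) {K : Set (Euc N)} (hK : IsCompact K) (hKO : K ⊆ O) {η : ℝ}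
    (hη : 0 < η) : ∃ n₀ : ℕ, ∀ n ≥ n₀, ∀ x ∈ K, |mollify n u x - u x| ≤ η := by
  obtain ⟨r, hr, hrO⟩ := hK.exists_cthickening_subset_open hO hKO
  obtain ⟨δ, hδ, H⟩ := Metric.uniformContinuousOn_iff.1
    ((hK.cthickening (r := r)).uniformContinuousOn_of_continuous (hu.mono hrO)) η hη
  obtain ⟨n₀, hn₀⟩ := exists_nat_one_div_lt (lt_min hδ hr)
  refine ⟨n₀, fun n hn x hx => ?_⟩
  have hle : 1 / ((n : ℝ) + 1) ≤ 1 / ((n₀ : ℝ) + 1) :=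
    one_div_le_one_div_of_le (by positivity) (by
      have : (n₀ : ℝ) ≤ n := by exact_mod_cast hn
      linarith)
  rw [← Real.dist_eq]
  refine dist_mollify_le hη.le hm fun y hy => (H y ?_ x ?_ ?_).le
  · exact Metric.mem_cthickening_of_dist_le y x r K hx
      (hy.le.trans (hle.trans (hn₀.le.trans (min_le_right _ _))))
  · exact Metric.self_subset_cthickening K hx
  · exact hy.trans_le (hle.trans (hn₀.le.trans (min_le_left _ _)))

lemma isOpen_compl_support : IsOpen μ.supportᶜ :=
  (Measure.isClosed_support (μ := μ)).isOpen_compl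

/-- Away from the support of `μ`, differences of mollifications have Laplacian at most `2` in
absolute value and are uniformly small. In the gradient estimate the radius `d` is chosen first, to
make the Laplacian term small, and then the sup norm. -/
lemma IsSolutionP.uniformCauchySeqOn_fderiv (hΩo : IsOpen Ω) (hΩ : Bornology.IsBounded Ω)
    (hu : IsSolutionP μ Ω u) {x₀ : Euc N} {r : ℝ} (hr : 0 < r)
    (hball : Metric.closedBall x₀ (3 * r) ⊆ μ.supportᶜ) :
    UniformCauchySeqOn (fun n => fderiv ℝ (mollify n u)) atTop (Metric.ball x₀ r) := by
  rw [Metric.uniformCauchySeqOn_iff]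
  intro ε hε
  set d := min r (ε / (3 * ((N : ℝ) + 1))) with hd
  have hd0 : 0 < d := by positivity
  have hd1 : d ≤ r := min_le_left _ _
  have hd2 : 3 * ((N : ℝ) + 1) * d ≤ ε := by
    have : d ≤ ε / (3 * ((N : ℝ) + 1)) := min_le_right _ _
    rw [le_div_iff₀ (by positivity)] at this
    linarith
  set η := ε * d / (8 * ((N : ℝ) + 1) ^ 2) with hη
  have hη0 : 0 < η := by positivity
  obtain ⟨n₁, hn₁⟩ := exists_uniform_mollify isOpen_compl_support hu.continuousOn
    (hu.integrable hΩ).1 (isCompact_closedBall x₀ (2 * r))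
    ((Metric.closedBall_subset_closedBall (by linarith)).trans hball) hη0
  obtain ⟨n₂, hn₂⟩ := exists_nat_one_div_lt hr
  have hsm : ∀ n ≥ n₂, ∀ z ∈ Metric.closedBall x₀ (2 * r), smoothMeasure μ n z = 0 :=
    fun n hn z hz => smoothMeasure_eq_zero fun y hy => hball (by
      have hle : 1 / ((n : ℝ) + 1) ≤ 1 / ((n₂ : ℝ) + 1) :=
        one_div_le_one_div_of_le (by positivity) (by
          have : (n₂ : ℝ) ≤ n := by exact_mod_cast hn
          linarith)
      rw [Metric.mem_closedBall] at hz ⊢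
      have := dist_triangle y z x₀
      linarith)
  refine ⟨max n₁ n₂, fun m hm n hn y hy => ?_⟩
  have hz : ∀ z : Euc N, ‖z‖ ≤ d → y + z ∈ Metric.closedBall x₀ (2 * r) := fun z hz => by
    rw [Metric.mem_ball] at hy
    rw [Metric.mem_closedBall]
    have := dist_triangle (y + z) y x₀
    have h2 : dist (y + z) y = ‖z‖ := by rw [dist_eq_norm, add_sub_cancel_left]
    linarith
  have hc : ∀ n, ContDiff ℝ 2 (mollify n u) := fun n =>
    (contDiff_mollify n hu.locallyIntegrable).of_le two_le_infty
  have key := norm_fderiv_le_of_laplacian (w := mollify m u - mollify n u) (x := y) (m := 2 * η)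
    (F := 3) ((hc m).sub (hc n)) hd0 (fun z hzd => by
      have h1 := hn₁ m (le_of_max_le_left hm) _ (hz z hzd)
      have h2 := hn₁ n (le_of_max_le_left hn) _ (hz z hzd)
      rw [abs_sub_comm] at h2
      have := abs_sub_le (mollify m u (y + z)) (u (y + z)) (mollify n u (y + z))
      rw [Pi.sub_apply]
      linarith) (fun z hzd => by
      rw [(hc m).contDiffAt.laplacian_sub (hc n).contDiffAt, hu.laplacian_mollify hΩo.measurableSet,
        hu.laplacian_mollify hΩo.measurableSet, hsm m (le_of_max_le_right hm) _ (hz z hzd),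
        hsm n (le_of_max_le_right hn) _ (hz z hzd), sub_zero, sub_zero]
      have h1 := abs_mollify_indicator_le hΩo.measurableSet m (y + z)
      have h2 := abs_mollify_indicator_le hΩo.measurableSet n (y + z)
      have := abs_sub (mollify m (indicator Ω fun _ => (1 : ℝ)) (y + z))
        (mollify n (indicator Ω fun _ => (1 : ℝ)) (y + z))
      linarith)
  have hdiff : ∀ n, DifferentiableAt ℝ (mollify n u) y := fun n =>
    (hc n).differentiable two_ne_zero y
  rw [fderiv_sub (hdiff m) (hdiff n)] at key
  rw [dist_eq_norm]
  refine key.trans_lt ?_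
  have e1 : (N : ℝ) * (2 * η) / d = N * ε / (4 * ((N : ℝ) + 1) ^ 2) := by
    rw [hη]; field_simp; ring
  have hN0 : (0 : ℝ) ≤ N := Nat.cast_nonneg N
  have e2 : (N : ℝ) * (N * ε / (4 * ((N : ℝ) + 1) ^ 2)) ≤ ε / 4 := by
    rw [← mul_div_assoc, div_le_div_iff₀ (by positivity) (by norm_num)]
    have : (N : ℝ) * N ≤ (N + 1) ^ 2 := by nlinarith
    nlinarith
  have e3 : (N : ℝ) * (3 * d / 2) ≤ ε / 2 := by nlinarith
  rw [mul_add, e1]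
  linarith

lemma exists_closedBall_subset_compl_support {x : Euc N} (hx : x ∉ μ.support) :
    ∃ r > 0, Metric.closedBall x (3 * r) ⊆ μ.supportᶜ := by
  obtain ⟨ε, hε, h⟩ := Metric.nhds_basis_closedBall.mem_iff.1
    (isOpen_compl_support.mem_nhds (show x ∈ μ.supportᶜ from hx))
  exact ⟨ε / 3, by positivity, by rwa [mul_div_cancel₀ _ (by norm_num : (3 : ℝ) ≠ 0)]⟩

lemma IsSolutionP.tendstoLocallyUniformlyOn_fderiv (hΩo : IsOpen Ω) (hΩ : Bornology.IsBounded Ω)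
    (hu : IsSolutionP μ Ω u) :
    TendstoLocallyUniformlyOn (fun n => fderiv ℝ (mollify n u)) (fderiv ℝ u) atTop μ.supportᶜ ∧
      ∀ x ∈ μ.supportᶜ, DifferentiableAt ℝ u x := by
  set g' : Euc N → Euc N →L[ℝ] ℝ := fun x => limUnder atTop fun n => fderiv ℝ (mollify n u) x
  have h1 : TendstoLocallyUniformlyOn (fun n => fderiv ℝ (mollify n u)) g' atTop μ.supportᶜ := by
    rw [tendstoLocallyUniformlyOn_iff_filter]
    intro x hx
    obtain ⟨r, hr, hb⟩ := exists_closedBall_subset_compl_support hx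
    have hc := hu.uniformCauchySeqOn_fderiv hΩo hΩ hr hb
    have hun := hc.tendstoUniformlyOn_of_tendsto (f := g') fun y hy =>
      (hc.cauchySeq hy).tendsto_limUnder
    refine (hun.tendstoUniformlyOnFilter).mono_right ?_
    exact nhdsWithin_le_nhds.trans (le_principal_iff.2 (Metric.ball_mem_nhds x hr))
  have h2 : ∀ x ∈ μ.supportᶜ, HasFDerivAt u (g' x) x := fun x hx => by
    refine hasFDerivAt_of_tendstoLocallyUniformlyOn isOpen_compl_support h1 (fun n y _ =>
      ((contDiff_mollify n hu.locallyIntegrable).differentiable (by simp) y).hasFDerivAt)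
      (fun y hy => ?_) hx
    rw [Metric.tendsto_atTop]
    intro ε hε
    obtain ⟨n₀, hn₀⟩ := exists_uniform_mollify isOpen_compl_support hu.continuousOn
      (hu.integrable hΩ).1 (isCompact_singleton (x := y)) (singleton_subset_iff.2 hy) (half_pos hε)
    refine ⟨n₀, fun n hn => ?_⟩
    rw [Real.dist_eq]
    exact (hn₀ n hn y rfl).trans_lt (half_lt_self hε)
  exact ⟨h1.congr_right fun x hx => (h2 x hx).fderiv.symm, fun x hx => (h2 x hx).differentiableAt⟩

lemma IsSolutionP.contDiffOn (hΩo : IsOpen Ω) (hΩ : Bornology.IsBounded Ω)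
    (hu : IsSolutionP μ Ω u) : ContDiffOn ℝ 1 u μ.supportᶜ := by
  obtain ⟨h1, h2⟩ := hu.tendstoLocallyUniformlyOn_fderiv hΩo hΩ
  rw [show (1 : WithTop ℕ∞) = 0 + 1 from rfl, contDiffOn_succ_iff_fderiv_of_isOpen isOpen_compl_support]
  refine ⟨fun x hx => (h2 x hx).differentiableWithinAt, by simp, contDiffOn_zero.2 ?_⟩
  exact h1.continuousOn (Eventually.of_forall fun n =>
    ((contDiff_mollify n hu.locallyIntegrable).continuous_fderiv (by simp)).continuousOn).frequently

/-- Fermat's rule: where `u` vanishes it attains its global minimum. -/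
lemma IsSolutionP.gradient_eq_zero (hu : IsSolutionP μ Ω u) {x : Euc N} (hx : x ∉ Ω) :
    gradient u x = 0 := by
  have : IsLocalMin u x := Eventually.of_forall fun y => by
    rw [hu.eq_zero x hx]; exact hu.nonneg y
  rw [gradient, this.fderiv_eq_zero, map_zero]

lemma IsSolutionP.tendsto_gradient (hΩo : IsOpen Ω) (hΩ : Bornology.IsBounded Ω)
    (hu : IsSolutionP μ Ω u) {x : Euc N} (hx : x ∉ μ.support) :
    Tendsto (fun n => gradient (mollify n u) x) atTop (𝓝 (gradient u x)) :=
  ((LinearIsometryEquiv.continuous _).tendsto _).comp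
    ((hu.tendstoLocallyUniformlyOn_fderiv hΩo hΩ).1.tendsto_at hx)

lemma IsSolutionP.exists_bound_gradient (hΩo : IsOpen Ω) (hΩ : Bornology.IsBounded Ω)
    (hu : IsSolutionP μ Ω u) {K : Set (Euc N)} (hK : IsCompact K) (hKμ : K ⊆ μ.supportᶜ) :
    ∃ C, ∀ᶠ n in atTop, ∀ x ∈ K, ‖gradient (mollify n u) x‖ ≤ C := by
  have h1 := (hu.tendstoLocallyUniformlyOn_fderiv hΩo hΩ).1
  have hcont := (hu.contDiffOn hΩo hΩ).continuousOn_fderiv_of_isOpen isOpen_compl_support le_rfl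
  obtain ⟨C, hC⟩ := hK.exists_bound_of_continuousOn (hcont.mono hKμ)
  have h2 := (tendstoLocallyUniformlyOn_iff_forall_isCompact isOpen_compl_support).1 h1 K hKμ hK
  refine ⟨C + 1, (Metric.tendstoUniformlyOn_iff.1 h2 1 one_pos).mono fun n hn x hx => ?_⟩
  have h3 := hn x hx
  rw [dist_eq_norm, norm_sub_rev] at h3
  rw [norm_gradient]
  have := norm_le_norm_add_norm_sub' (fderiv ℝ (mollify n u) x) (fderiv ℝ u x)
  have := hC x hx
  rw [norm_sub_rev] at *
  linarith [norm_sub_rev (fderiv ℝ (mollify n u) x) (fderiv ℝ u x)]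

lemma MemH10.hasWeakGradient {U : Set (Euc N)} {v : Euc N → ℝ} {G : Euc N → Euc N}
    (h : MemH10 μ U v G) : HasWeakGradient v G := by
  obtain ⟨w, hw, hv⟩ := memH10_iff.1 h
  intro φ hφ e
  have hd := hφ.fderiv_apply e
  have t1 := tendsto_integral_inner (ν := volume) (f := w) (f₀ := v)
    (g := fun _ x => fderiv ℝ φ x e) (g₀ := fun x => fderiv ℝ φ x e)
    (fun n => (hw n).memLp 2 volume) (fun _ => hd.memLp 2 volume) hv.memLp (hd.memLp 2 volume)
    hv.tendsto (by simp)
  have hφe : MemLp (fun x => φ x • e) 2 volume :=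
    (hφ.continuous.smul continuous_const).memLp_of_hasCompactSupport hφ.2.1.smul_right
  have t2 := tendsto_integral_inner (ν := volume) (f := fun n => gradient (w n)) (f₀ := G)
    (g := fun _ x => φ x • e) (g₀ := fun x => φ x • e)
    (fun n => (hw n).memLp_gradient 2 volume) (fun _ => hφe) hv.memLp_grad hφe
    hv.tendsto_grad (by simp)
  have e1 : ∀ n, ∫ x, inner ℝ (w n x) (fderiv ℝ φ x e) =
      -∫ x, inner ℝ (gradient (w n) x) (φ x • e) := fun n => by
    have := hφ.integral_mul_fderiv ((hw n).1.of_le (by simp)) e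
    have e2 : ∫ x, inner ℝ (w n x) (fderiv ℝ φ x e) = ∫ x, w n x * fderiv ℝ φ x e :=
      integral_congr_ae (Eventually.of_forall fun x => mul_comm _ _)
    rw [e2, this]
    congr 1
    refine integral_congr_ae (Eventually.of_forall fun x => ?_)
    simp only
    rw [real_inner_smul_right, inner_gradient, mul_comm]
  simp only [e1] at t1
  have := tendsto_nhds_unique t1 t2.neg
  have e3 : ∫ x, inner ℝ (v x) (fderiv ℝ φ x e) = ∫ x, v x * fderiv ℝ φ x e :=
    integral_congr_ae (Eventually.of_forall fun x => mul_comm _ _)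
  rw [← e3, this]
  congr 1
  refine integral_congr_ae (Eventually.of_forall fun x => ?_)
  simp only
  rw [real_inner_smul_right, mul_comm]

/-- Mollifying the weak gradient is differentiating the mollification. Its limit is `G` at Lebesgue
points and the classical gradient off the support of `μ`. -/
lemma IsSolutionP.ae_eq_gradient (hΩo : IsOpen Ω) (hΩ : Bornology.IsBounded Ω)
    (hu : IsSolutionP μ Ω u) {v : Euc N → ℝ} {G : Euc N → Euc N} (hv : MemH10 μ Ω v G)
    (hvu : v =ᵐ[volume] u) : ∀ᵐ x, x ∉ μ.support → G x = gradient u x := by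
  have hvl : LocallyIntegrable v volume := hv.1.locallyIntegrable (by norm_num)
  have hGl : LocallyIntegrable G volume := hv.2.1.locallyIntegrable (by norm_num)
  have hm : ∀ n, mollify n v = mollify n u := fun n => funext fun x => by
    rw [mollify_apply, mollify_apply]
    refine integral_congr_ae ?_
    filter_upwards [hvu] with t ht
    rw [ht]
  filter_upwards [ae_tendsto_mollify hGl] with x hx hxμ
  have h := hu.tendsto_gradient hΩo hΩ hxμ
  simp only [← hm, hv.hasWeakGradient.gradient_mollify hvl hGl] at h
  exact tendsto_nhds_unique hx h

end Regularity

end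

/-! ### Pohozaev's identity and criticality -/

section

section Pohozaev

variable {N : ℕ} {μ : Measure (Euc N)} {Ω : Set (Euc N)} {u : Euc N → ℝ}

lemma continuous_trace : Continuous (trace : (Euc N →L[ℝ] Euc N) → ℝ) := by
  unfold trace
  fun_prop

lemma sum_inner_apply_mul {ι : Type*} [Fintype ι] (b : OrthonormalBasis ι ℝ (Euc N))
    (A : Euc N →L[ℝ] Euc N) (q z : Euc N) :
    ∑ i, inner ℝ (A (b i)) q * inner ℝ (b i) z = inner ℝ (A z) q := by
  conv_rhs => rw [← b.sum_repr' z]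
  rw [map_sum, sum_inner]
  refine Finset.sum_congr rfl fun i _ => ?_
  rw [map_smul, real_inner_smul_left, mul_comm]

lemma integral_fderiv_eq_zero {f : Euc N → ℝ} (hf : ContDiff ℝ 1 f) (hc : HasCompactSupport f)
    (e : Euc N) : ∫ x, fderiv ℝ f x e = 0 := by
  have hcd : Continuous fun x => fderiv ℝ f x e :=
    (hf.continuous_fderiv one_ne_zero).clm_apply continuous_const
  have := integral_mul_fderiv_eq_neg_fderiv_mul_of_integrable (μ := (volume : Measure (Euc N)))
    (f := fun _ => (1 : ℝ)) (g := f) (v := e) (by simp)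
    (by simpa using hcd.integrable_of_hasCompactSupport (hc.fderiv_apply ℝ e))
    (by simpa using hf.continuous.integrable_of_hasCompactSupport hc)
    (fun x _ => differentiableAt_const _) (fun x _ => hf.differentiable one_ne_zero x)
  simpa using this

lemma contDiff_gradient {w : Euc N → ℝ} (hw : ContDiff ℝ 2 w) : ContDiff ℝ 1 (gradient w) :=
  (LinearIsometryEquiv.contDiff _).comp (hw.fderiv_right (m := 1) (by norm_num))

lemma inner_fderiv_gradient {w : Euc N → ℝ} (hw : ContDiff ℝ 2 w) (x a e : Euc N) :
    inner ℝ (fderiv ℝ (gradient w) x a) e = fderiv ℝ (fun y => fderiv ℝ w y e) x a := by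
  have h := (contDiff_gradient hw).differentiable one_ne_zero x
  have e1 : (fun y => fderiv ℝ w y e) = fun y => inner ℝ (gradient w y) e :=
    funext fun y => (inner_gradient w y e).symm
  rw [e1, fderiv_inner_apply ℝ h (differentiableAt_const e)]
  simp

lemma inner_fderiv_gradient_comm {w : Euc N → ℝ} (hw : ContDiff ℝ 2 w) (x a e : Euc N) :
    inner ℝ (fderiv ℝ (gradient w) x a) e = inner ℝ (fderiv ℝ (gradient w) x e) a := by
  rw [inner_fderiv_gradient hw, inner_fderiv_gradient hw]
  have hd : DifferentiableAt ℝ (fderiv ℝ w) x :=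
    (hw.fderiv_right (m := 1) (by norm_num)).differentiable one_ne_zero x
  rw [fderiv_clm_apply hd (differentiableAt_const _), fderiv_clm_apply hd (differentiableAt_const _)]
  have := (hw.contDiffAt (x := x)).isSymmSndFDerivAt (by simp) a e
  simpa using this

lemma laplacian_eq_sum_gradient {ι : Type*} [Fintype ι] (b : OrthonormalBasis ι ℝ (Euc N))
    {w : Euc N → ℝ} (hw : ContDiff ℝ 2 w) (x : Euc N) :
    Laplacian.laplacian w x = ∑ i, inner ℝ (b i) (fderiv ℝ (gradient w) x (b i)) := by
  rw [laplacian_eq_sum b hw]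
  refine Finset.sum_congr rfl fun i _ => ?_
  rw [real_inner_comm, inner_fderiv_gradient hw]

/-- Pohozaev's identity. -/
lemma integral_pohozaev {w : Euc N → ℝ} (hw : ContDiff ℝ 2 w) {Y : Euc N → Euc N}
    (hY : ContDiff ℝ 1 Y) (hYc : HasCompactSupport Y) :
    ∫ x, ((1 / 2 * ‖gradient w x‖ ^ 2 + w x) * trace (fderiv ℝ Y x) -
      inner ℝ (fderiv ℝ Y x (gradient w x)) (gradient w x)) =
    -∫ x, inner ℝ (Y x) (gradient w x) * (1 - Laplacian.laplacian w x) := by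
  set b := EuclideanSpace.basisFun (Fin N) ℝ with hb
  set p := gradient w with hp
  have hpc : ContDiff ℝ 1 p := contDiff_gradient hw
  have hpd : Differentiable ℝ p := hpc.differentiable one_ne_zero
  have hYd : Differentiable ℝ Y := hY.differentiable one_ne_zero
  have hwc : ContDiff ℝ 1 w := hw.of_le (by norm_num)
  have hwd : Differentiable ℝ w := hwc.differentiable one_ne_zero
  -- The components of `(½|∇w|² + w) Y - ⟨Y, ∇w⟩ ∇w`. The divergence of this field is the difference
  -- of the two integrands, because the terms with the Hessian applied to `Y` cancel by symmetry.
  set Z : Fin N → Euc N → ℝ := fun i x =>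
    (1 / 2 * inner ℝ (p x) (p x) + w x) * inner ℝ (b i) (Y x) -
      inner ℝ (Y x) (p x) * inner ℝ (b i) (p x) with hZ
  have hZc : ∀ i, ContDiff ℝ 1 (Z i) := fun i =>
    (((contDiff_const.mul (hpc.inner ℝ hpc)).add hwc).mul (contDiff_const.inner ℝ hY)).sub
      ((hY.inner ℝ hpc).mul (contDiff_const.inner ℝ hpc))
  have hZs : ∀ i, HasCompactSupport (Z i) := fun i => by
    refine hYc.mono fun x hx h => hx ?_
    simp [hZ, h]
  have hint : ∀ i, Integrable fun x => fderiv ℝ (Z i) x (b i) := fun i =>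
    (((hZc i).continuous_fderiv one_ne_zero).clm_apply
      continuous_const).integrable_of_hasCompactSupport ((hZs i).fderiv_apply ℝ _)
  have hZd : ∀ i x, fderiv ℝ (Z i) x (b i) =
      (inner ℝ (fderiv ℝ p x (b i)) (p x) + inner ℝ (b i) (p x)) * inner ℝ (b i) (Y x) +
      (1 / 2 * inner ℝ (p x) (p x) + w x) * inner ℝ (b i) (fderiv ℝ Y x (b i)) -
      (inner ℝ (fderiv ℝ Y x (b i)) (p x) + inner ℝ (fderiv ℝ p x (b i)) (Y x)) *
        inner ℝ (b i) (p x) -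
      inner ℝ (Y x) (p x) * inner ℝ (b i) (fderiv ℝ p x (b i)) := fun i x => by
    have d1 : DifferentiableAt ℝ (fun x => (inner ℝ (p x) (p x) : ℝ)) x := (hpd x).inner ℝ (hpd x)
    have d2 : DifferentiableAt ℝ (fun x => (inner ℝ (b i) (Y x) : ℝ)) x :=
      (differentiableAt_const _).inner ℝ (hYd x)
    have d3 : DifferentiableAt ℝ (fun x => (inner ℝ (Y x) (p x) : ℝ)) x := (hYd x).inner ℝ (hpd x)
    have d4 : DifferentiableAt ℝ (fun x => (inner ℝ (b i) (p x) : ℝ)) x :=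
      (differentiableAt_const _).inner ℝ (hpd x)
    have d5 : DifferentiableAt ℝ (fun x => 1 / 2 * (inner ℝ (p x) (p x) : ℝ) + w x) x :=
      (d1.const_mul (1 / 2)).add (hwd x)
    have d6 : DifferentiableAt ℝ (fun x => (1 / 2 * (inner ℝ (p x) (p x) : ℝ) + w x) *
      inner ℝ (b i) (Y x)) x := d5.mul d2
    have d7 : DifferentiableAt ℝ (fun x => (inner ℝ (Y x) (p x) : ℝ) *
      inner ℝ (b i) (p x)) x := d3.mul d4
    simp only [hZ]
    rw [fderiv_fun_sub d6 d7, fderiv_fun_mul d5 d2,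
      fderiv_fun_mul d3 d4, fderiv_fun_add (d1.const_mul _) (hwd x), fderiv_const_mul d1]
    simp only [sub_apply, add_apply, smul_apply, smul_eq_mul]
    rw [fderiv_inner_apply ℝ (hpd x) (hpd x), fderiv_inner_apply ℝ (hYd x) (hpd x),
      fderiv_inner_apply ℝ (differentiableAt_const _) (hYd x),
      fderiv_inner_apply ℝ (differentiableAt_const _) (hpd x), ← inner_gradient w x (b i)]
    rw [(hasFDerivAt_const (b i) x).fderiv]
    simp only [zero_apply, inner_zero_left, add_zero]
    rw [real_inner_comm (fderiv ℝ p x (b i)) (p x), real_inner_comm (b i) (gradient w x),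
      real_inner_comm (fderiv ℝ p x (b i)) (Y x)]
    ring
  have hsum : ∀ x, ∑ i, fderiv ℝ (Z i) x (b i) =
      ((1 / 2 * ‖p x‖ ^ 2 + w x) * trace (fderiv ℝ Y x) - inner ℝ (fderiv ℝ Y x (p x)) (p x)) +
      inner ℝ (Y x) (p x) * (1 - Laplacian.laplacian w x) := fun x => by
    simp only [hZd, add_mul, Finset.sum_sub_distrib, Finset.sum_add_distrib]
    rw [sum_inner_apply_mul b, sum_inner_apply_mul b, sum_inner_apply_mul b, ← Finset.mul_sum,
      ← Finset.mul_sum, ← Finset.mul_sum, ← laplacian_eq_sum_gradient b hw, hp,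
      inner_fderiv_gradient_comm hw x (Y x), ← hp]
    have e1 : ∑ i, inner ℝ (b i) (p x) * inner ℝ (b i) (Y x) = inner ℝ (Y x) (p x) := by
      rw [← b.sum_inner_mul_inner]
      exact Finset.sum_congr rfl fun i _ => by rw [real_inner_comm (Y x), mul_comm]
    rw [e1, real_inner_self_eq_norm_sq]
    simp only [trace, ← hb]
    ring
  have hzero : ∫ x, ∑ i, fderiv ℝ (Z i) x (b i) = 0 := by
    rw [integral_finsetSum _ fun i _ => hint i]
    exact Finset.sum_eq_zero fun i _ => integral_fderiv_eq_zero (hZc i) (hZs i) _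
  simp only [hsum] at hzero
  have hcw := hw.continuous
  have hcp := hpc.continuous
  have hcY := hY.continuous
  have hcDY := hY.continuous_fderiv one_ne_zero
  have hcL : Continuous (Laplacian.laplacian w) := by
    have : Laplacian.laplacian w = fun x => ∑ i, inner ℝ (b i) (fderiv ℝ p x (b i)) :=
      funext fun x => laplacian_eq_sum_gradient b hw x
    rw [this]
    have := hpc.continuous_fderiv one_ne_zero
    fun_prop
  have hctr : Continuous fun x => trace (fderiv ℝ Y x) := continuous_trace.comp hcDY
  rw [integral_add] at hzero
  · linarith
  · refine Continuous.integrable_of_hasCompactSupport (by fun_prop) ?_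
    refine (hYc.fderiv ℝ).mono fun x hx h => hx ?_
    simp [h, trace]
  · refine Continuous.integrable_of_hasCompactSupport (by fun_prop) ?_
    refine hYc.mono fun x hx h => hx ?_
    simp [h]

/-- Pohozaev's identity needs two derivatives, so it is applied to mollifications. On the support of
`Y` their gradients are bounded and converge and their Laplacians are mollifications of the
indicator of `Ω`. Hence both sides pass to the limit by dominated convergence. -/
theorem IsSolutionP.shapeGrad_eq_zero (hΩo : IsOpen Ω) (hΩ : Bornology.IsBounded Ω)
    (hu : IsSolutionP μ Ω u) {v : Euc N → ℝ} {G : Euc N → Euc N} (hv : MemH10 μ Ω v G)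
    (hvu : v =ᵐ[volume] u) {Y : Euc N → Euc N} (hY : ContDiff ℝ 1 Y) (hYc : HasCompactSupport Y)
    (hYμ : Disjoint (tsupport Y) μ.support) : shapeGrad Ω v G Y = 0 := by
  have hKμ : tsupport Y ⊆ μ.supportᶜ := disjoint_left.1 hYμ
  have hDY0 : ∀ x ∉ tsupport Y, fderiv ℝ Y x = 0 := fun x hx => fderiv_of_notMem_tsupport (𝕜 := ℝ) hx
  have hcDY := hY.continuous_fderiv one_ne_zero
  have hcY := hY.continuous
  have hctr : Continuous fun x => trace (fderiv ℝ Y x) := continuous_trace.comp hcDY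
  have hcw : ∀ n, ContDiff ℝ ∞ (mollify n u) := fun n => contDiff_mollify n hu.locallyIntegrable
  have hcg : ∀ n, Continuous (gradient (mollify n u)) := fun n =>
    (contDiff_gradient ((hcw n).of_le two_le_infty)).continuous
  obtain ⟨C, hC⟩ := hu.exists_bound_gradient hΩo hΩ hYc hKμ
  obtain ⟨M, hM⟩ := hYc.isCompact.exists_bound_of_continuousOn (hu.continuousOn.mono hKμ)
  obtain ⟨n₀, hn₀⟩ := exists_uniform_mollify isOpen_compl_support hu.continuousOn
    (hu.integrable hΩ).1 hYc.isCompact hKμ one_pos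
  obtain ⟨δ, hδ, hδμ⟩ := hYc.isCompact.exists_cthickening_subset_open isOpen_compl_support hKμ
  have hsm : ∀ᶠ n : ℕ in atTop, ∀ x ∈ tsupport Y, smoothMeasure μ n x = 0 := by
    filter_upwards [tendsto_one_div_add_atTop_nhds_zero_nat.eventually_lt_const hδ] with n hn x hx
    exact smoothMeasure_eq_zero fun y hy => hδμ
      (Metric.mem_cthickening_of_dist_le y x δ _ hx (hy.le.trans hn.le))
  have hwb : ∀ᶠ n : ℕ in atTop, ∀ x ∈ tsupport Y, |mollify n u x| ≤ M + 1 := by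
    filter_upwards [eventually_ge_atTop n₀] with n hn x hx
    have h1 := hn₀ n hn x hx
    have h2 := hM x hx
    rw [Real.norm_eq_abs] at h2
    have h3 := abs_sub_abs_le_abs_sub (mollify n u x) (u x)
    linarith
  have hli : LocallyIntegrable (indicator Ω fun _ => (1 : ℝ)) volume :=
    ((integrable_indicator_iff hΩo.measurableSet).2
      (integrableOn_const hΩ.measure_lt_top.ne)).locallyIntegrable
  have t1 : Tendsto (fun n => ∫ x, ((1 / 2 * ‖gradient (mollify n u) x‖ ^ 2 + mollify n u x) *
      trace (fderiv ℝ Y x) - inner ℝ (fderiv ℝ Y x (gradient (mollify n u) x))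
        (gradient (mollify n u) x))) atTop
      (𝓝 (∫ x, ((1 / 2 * ‖gradient u x‖ ^ 2 + u x) *
      trace (fderiv ℝ Y x) - inner ℝ (fderiv ℝ Y x (gradient u x)) (gradient u x)))) := by
    refine tendsto_integral_filter_of_dominated_convergence
      (fun x => ((N : ℝ) + 1) * ‖fderiv ℝ Y x‖ * (C ^ 2 + (M + 1)))
      (Eventually.of_forall fun n => ?_) ?_ ?_ ?_
    · have h1 := hcg n
      have h2 := (hcw n).continuous
      exact (by fun_prop : Continuous _).aestronglyMeasurable
    · filter_upwards [hC, hwb] with n hn hn'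
      refine Eventually.of_forall fun x => ?_
      rw [Real.norm_eq_abs]
      refine (abs_trace_sub_inner_le _ _ _).trans ?_
      by_cases hx : x ∈ tsupport Y
      · refine mul_le_mul_of_nonneg_left ?_ (by positivity)
        exact add_le_add (pow_le_pow_left₀ (norm_nonneg _) (hn x hx) 2) (hn' x hx)
      · rw [hDY0 x hx]; simp
    · refine Continuous.integrable_of_hasCompactSupport (by fun_prop) ?_
      exact ((hYc.fderiv ℝ).norm.mul_left).mul_right
    · filter_upwards [ae_tendsto_mollify hu.locallyIntegrable] with x hx
      by_cases hxY : x ∈ tsupport Y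
      · have hg := hu.tendsto_gradient hΩo hΩ (hKμ hxY)
        refine ((((hg.norm.pow 2).const_mul _).add hx).mul_const _).sub ?_
        exact Tendsto.inner (((fderiv ℝ Y x).continuous.tendsto _).comp hg) hg
      · simp [hDY0 x hxY, trace]
  have t2 : Tendsto (fun n => ∫ x, inner ℝ (Y x) (gradient (mollify n u) x) *
      (1 - Laplacian.laplacian (mollify n u) x)) atTop (𝓝 (∫ _ : Euc N, (0 : ℝ))) := by
    refine tendsto_integral_filter_of_dominated_convergence
      (fun x => ‖Y x‖ * C * 2)
      (Eventually.of_forall fun n => ?_) ?_ ?_ ?_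
    · have h1 := hcg n
      have h2 := (hcw n).continuous
      have h3 : Continuous (Laplacian.laplacian (mollify n u)) :=
        (hu.isTest_mollify hΩ n).laplacian.continuous
      exact (by fun_prop : Continuous _).aestronglyMeasurable
    · filter_upwards [hC, hsm] with n hn hn'
      refine Eventually.of_forall fun x => ?_
      by_cases hx : x ∈ tsupport Y
      · rw [hu.laplacian_mollify hΩo.measurableSet, hn' x hx, sub_zero, norm_mul]
        have h1 := abs_mollify_indicator_le hΩo.measurableSet n x
        refine mul_le_mul ((norm_inner_le_norm _ _).trans
          (mul_le_mul_of_nonneg_left (hn x hx) (norm_nonneg _))) ?_ (norm_nonneg _) ?_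
        · rw [Real.norm_eq_abs, abs_le]
          rw [abs_le] at h1
          constructor <;> linarith
        · exact mul_nonneg (norm_nonneg _) ((norm_nonneg _).trans (hn x hx))
      · rw [image_eq_zero_of_notMem_tsupport hx]; simp
    · refine Continuous.integrable_of_hasCompactSupport (by fun_prop) ?_
      exact (hYc.norm.mul_right).mul_right
    · filter_upwards [ae_tendsto_mollify hli] with x hx
      by_cases hxY : x ∈ tsupport Y
      · have hg := hu.tendsto_gradient hΩo hΩ (hKμ hxY)
        have h1 : Tendsto (fun n => Laplacian.laplacian (mollify n u) x) atTop
            (𝓝 (indicator Ω (fun _ => (1 : ℝ)) x)) := by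
          refine hx.congr' ?_
          filter_upwards [hsm] with n hn
          rw [hu.laplacian_mollify hΩo.measurableSet, hn x hxY, sub_zero]
        have h2 := (Tendsto.inner (tendsto_const_nhds (x := Y x)) hg (𝕜 := ℝ)).mul (h1.const_sub 1)
        -- The overdetermined condition enters here: inside `Ω` the second factor vanishes, outside
        -- the gradient does.
        have e : inner ℝ (Y x) (gradient u x) * (1 - indicator Ω (fun _ => (1 : ℝ)) x) = 0 := by
          by_cases hxΩ : x ∈ Ω
          · simp [hxΩ]
          · rw [hu.gradient_eq_zero hxΩ]; simp
        rwa [e] at h2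
      · simp [image_eq_zero_of_notMem_tsupport hxY]
  have heq : ∀ n, _ := fun n => integral_pohozaev ((hcw n).of_le two_le_infty) hY hYc
  simp only [heq] at t1
  have key := tendsto_nhds_unique t1 t2.neg
  rw [integral_zero, neg_zero] at key
  rw [← key, shapeGrad]
  have e1 : ∫ x in Ω, ((1 / 2 * ‖gradient u x‖ ^ 2 + u x) * trace (fderiv ℝ Y x) -
      inner ℝ (fderiv ℝ Y x (gradient u x)) (gradient u x)) =
      ∫ x, ((1 / 2 * ‖gradient u x‖ ^ 2 + u x) * trace (fderiv ℝ Y x) -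
      inner ℝ (fderiv ℝ Y x (gradient u x)) (gradient u x)) :=
    setIntegral_eq_integral_of_forall_compl_eq_zero fun x hx => by
      rw [hu.gradient_eq_zero hx, hu.eq_zero x hx]; simp
  rw [← e1]
  refine integral_congr_ae (ae_restrict_of_ae ?_)
  filter_upwards [hvu, hu.ae_eq_gradient hΩo hΩ hv hvu] with x h1 h2
  by_cases hxY : x ∈ tsupport Y
  · rw [h1, h2 (hKμ hxY)]
  · rw [hDY0 x hxY]; simp [trace]

end Pohozaev

end

/-! ### Outward normals and transversal fields -/

section

section Normal

variable {N : ℕ} {S : Set (Euc N)} {x ν ν' w : Euc N}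

lemma IsOutwardNormal.norm_eq_one (h : IsOutwardNormal S x ν) : ‖ν‖ = 1 := by
  obtain ⟨W, ψ, -, -, -, -, hg, -, rfl⟩ := h
  rw [norm_smul, norm_inv, norm_norm, inv_mul_cancel₀ (norm_ne_zero_iff.2 hg)]

lemma hasStrictFDerivAt_innerSL_gradient {W : Set (Euc N)} {ψ : Euc N → ℝ} (hW : IsOpen W)
    (hψ : ContDiffOn ℝ 1 ψ W) (hx : x ∈ W) :
    HasStrictFDerivAt ψ (innerSL ℝ (gradient ψ x)) x := by
  have h := (hψ.contDiffAt (hW.mem_nhds hx)).hasStrictFDerivAt one_ne_zero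
  have e : innerSL ℝ (gradient ψ x) = fderiv ℝ ψ x := ContinuousLinearMap.ext fun z => by
    rw [innerSL_apply_apply, inner_gradient]
  rwa [e]

/-- Directions that point out of `S` at a boundary point keep the complement of `S` invariant. -/
lemma IsOutwardNormal.eventually_notMem (h : IsOutwardNormal S x ν) (hw : 0 < inner ℝ ν w) :
    ∀ᶠ p : Euc N × Euc N × ℝ in 𝓝 x ×ˢ 𝓝 w ×ˢ 𝓝[≥] 0, p.1 ∉ S → p.1 + p.2.2 • p.2.1 ∉ S := by
  obtain ⟨W, ψ, hWo, hxW, hψ, hψ0, hg, hS, rfl⟩ := h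
  set g := gradient ψ x with hgd
  have hg0 : 0 < ‖g‖ := norm_pos_iff.2 hg
  have hw' : 0 < inner ℝ g w := by
    rw [real_inner_smul_left] at hw
    exact pos_of_mul_pos_right hw (by positivity)
  have hc : 0 < inner ℝ g w / (‖w‖ + 1) := by positivity
  -- Strict differentiability makes the increment of `ψ` positive uniformly over nearby base points,
  -- directions and small steps.
  have hd := (hasStrictFDerivAt_innerSL_gradient hWo hψ hxW).isLittleO.def hc
  rw [← hgd] at hd
  have hle : (𝓝 x ×ˢ 𝓝 w ×ˢ 𝓝[≥] (0 : ℝ)) ≤ 𝓝 (x, w, (0 : ℝ)) := by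
    rw [nhds_prod_eq, nhds_prod_eq]
    exact Filter.prod_mono le_rfl (Filter.prod_mono le_rfl nhdsWithin_le_nhds)
  have hcont : Tendsto (fun p : Euc N × Euc N × ℝ => p.1 + p.2.2 • p.2.1) (𝓝 (x, w, (0 : ℝ)))
      (𝓝 x) := by
    have : Continuous fun p : Euc N × Euc N × ℝ => p.1 + p.2.2 • p.2.1 := by fun_prop
    simpa using this.tendsto (x, w, (0 : ℝ))
  have hfst : Tendsto (fun p : Euc N × Euc N × ℝ => p.1) (𝓝 (x, w, (0 : ℝ))) (𝓝 x) :=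
    continuous_fst.tendsto (x, w, (0 : ℝ))
  have hpair := hcont.prodMk_nhds hfst
  have hdir : ∀ᶠ p : Euc N × Euc N × ℝ in 𝓝 (x, w, (0 : ℝ)),
      inner ℝ g w / (‖w‖ + 1) * ‖p.2.1‖ < inner ℝ g p.2.1 := by
    refine ContinuousAt.eventually_lt (by fun_prop) (by fun_prop) ?_
    simp only
    rw [div_mul_eq_mul_div, div_lt_iff₀ (by positivity)]
    nlinarith
  have hs : ∀ᶠ p : Euc N × Euc N × ℝ in 𝓝 x ×ˢ 𝓝 w ×ˢ 𝓝[≥] (0 : ℝ), 0 ≤ p.2.2 :=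
    (tendsto_snd.comp tendsto_snd).eventually
      (self_mem_nhdsWithin : ∀ᶠ s in 𝓝[≥] (0 : ℝ), s ∈ Ici (0 : ℝ))
  filter_upwards [hle (hpair.eventually hd), hle hdir, hle (hfst (hWo.mem_nhds hxW)),
    hle (hcont (hWo.mem_nhds hxW)), hs] with p h1 h2 h3 h4 h5 hp hpS
  have a1 : 0 ≤ ψ p.1 := not_lt.1 fun h => hp ((hS _ h3).2 h)
  have a2 := (hS _ h4).1 hpS
  simp only [add_sub_cancel_left, innerSL_apply_apply, real_inner_smul_right, norm_smul,
    Real.norm_eq_abs, abs_of_nonneg h5] at h1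
  have a3 := (abs_le.1 h1).1
  nlinarith

/-- Directions that point into `S` at a boundary point. -/
lemma IsOutwardNormal.eventually_mem (h : IsOutwardNormal S x ν) (hw : inner ℝ ν w < 0) :
    ∀ᶠ s in 𝓝[>] (0 : ℝ), x + s • w ∈ S := by
  obtain ⟨W, ψ, hWo, hxW, hψ, hψ0, hg, hS, rfl⟩ := h
  set g := gradient ψ x with hgd
  have hg0 : 0 < ‖g‖ := norm_pos_iff.2 hg
  have hw' : inner ℝ g w < 0 := by
    rw [real_inner_smul_left] at hw
    by_contra h
    exact hw.not_ge (mul_nonneg (by positivity) (not_lt.1 h))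
  have hd := (hasStrictFDerivAt_innerSL_gradient hWo hψ hxW).hasFDerivAt
  have hl : HasDerivAt (fun s : ℝ => x + s • w) w 0 := by
    simpa using ((hasDerivAt_id (0 : ℝ)).smul_const w).const_add x
  have hd' : HasDerivAt (fun s : ℝ => ψ (x + s • w)) (inner ℝ g w) 0 := by
    have hd0 : HasFDerivAt ψ (innerSL ℝ g) (x + (0 : ℝ) • w) := by simpa using hd
    simpa [Function.comp_def] using hd0.comp_hasDerivAt (0 : ℝ) hl
  have ht := hd'.hasDerivWithinAt (s := Ioi 0)
  rw [hasDerivWithinAt_iff_tendsto_slope' (by simp)] at ht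
  have hWm : ∀ᶠ s in 𝓝[>] (0 : ℝ), x + s • w ∈ W := by
    have : ContinuousAt (fun s : ℝ => x + s • w) 0 := hl.continuousAt
    exact nhdsWithin_le_nhds (this.eventually (by simpa using hWo.mem_nhds hxW))
  filter_upwards [ht.eventually_lt_const hw', hWm, self_mem_nhdsWithin] with s h1 h2 h3
  refine (hS _ h2).2 ?_
  rw [slope_def_field] at h1
  simp only [zero_smul, add_zero, hψ0, sub_zero] at h1
  have h3 : 0 < s := h3
  by_contra h
  exact h1.not_ge (div_nonneg (not_lt.1 h) h3.le)

lemma IsOutwardNormal.notMem (h : IsOutwardNormal S x ν) : x ∉ S := by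
  obtain ⟨W, ψ, hWo, hxW, hψ, hψ0, hg, hS, rfl⟩ := h
  rw [hS x hxW, hψ0]
  exact lt_irrefl 0

/-- Otherwise the ray from `x` in direction `w` would stay outside `S` for one defining function and
enter `S` for the other. -/
lemma IsOutwardNormal.inner_nonneg (h : IsOutwardNormal S x ν) (h' : IsOutwardNormal S x ν')
    (hw : 0 < inner ℝ ν w) : 0 ≤ inner ℝ ν' w := by
  by_contra hlt
  have h1 := h'.eventually_mem (not_le.1 hlt)
  have h2 := h.eventually_notMem hw
  have hte : Tendsto (fun s : ℝ => (x, w, s)) (𝓝[>] 0) (𝓝 x ×ˢ 𝓝 w ×ˢ 𝓝[≥] 0) :=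
    (tendsto_const_nhds).prodMk (tendsto_const_nhds.prodMk
      (tendsto_id.mono_right (nhdsWithin_mono _ Ioi_subset_Ici_self)))
  obtain ⟨s, hs1, hs2⟩ := (h1.and (hte.eventually h2)).exists
  exact hs2 h.notMem hs1

/-- The half spaces of two outward normals agree. -/
lemma IsOutwardNormal.inner_pos (h : IsOutwardNormal S x ν) (h' : IsOutwardNormal S x ν')
    (hw : 0 < inner ℝ ν w) : 0 < inner ℝ ν' w := by
  have hc : ∀ᶠ δ in 𝓝[>] (0 : ℝ), 0 < inner ℝ ν (w - δ • ν') := by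
    have : ContinuousAt (fun δ : ℝ => inner ℝ ν (w - δ • ν')) 0 := by fun_prop
    exact nhdsWithin_le_nhds (this.eventually (lt_mem_nhds (by simpa using hw)))
  obtain ⟨δ, h1, h2⟩ := (hc.and self_mem_nhdsWithin).exists
  have h2 : 0 < δ := h2
  have h3 := h.inner_nonneg h' h1
  rw [inner_sub_right, real_inner_smul_right, real_inner_self_eq_norm_sq, h'.norm_eq_one] at h3
  linarith

lemma convex_forall_inner_pos (P : Euc N → Prop) :
    Convex ℝ {w : Euc N | ∀ ν, P ν → 0 < inner ℝ ν w} := by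
  intro a ha b hb s t hs ht hst ν hν
  have h1 := ha ν hν
  have h2 := hb ν hν
  rw [inner_add_right, real_inner_smul_right, real_inner_smul_right]
  rcases hs.eq_or_lt with rfl | hs
  · obtain rfl : t = 1 := by linarith
    simpa using h2
  · have := mul_pos hs h1
    have := mul_nonneg ht h2.le
    linarith

/-- A set with `C¹` boundary has a smooth vector field that points outward on the boundary. -/
lemma HasC1Boundary.exists_outward (h : HasC1Boundary S) (hS : IsOpen S) :
    ∃ W : Euc N → Euc N, ContDiff ℝ ∞ W ∧
      ∀ x ∈ frontier S, ∀ ν, IsOutwardNormal S x ν → 0 < inner ℝ ν (W x) := by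
  let t : Euc N → Set (Euc N) := fun x =>
    {w | ∀ ν, (x ∈ frontier S ∧ IsOutwardNormal S x ν) → 0 < inner ℝ ν w}
  -- The admissible directions at each point form a convex set, so locally constant choices can be
  -- glued by a partition of unity. Near a boundary point the constant choice is the gradient of the
  -- defining function there.
  have hloc : ∀ x, ∃ c : Euc N, ∀ᶠ y in 𝓝 x, c ∈ t y := fun x => ?_
  · obtain ⟨g, hg⟩ := exists_contMDiffMap_forall_mem_convex_of_local_const (n := ⊤)
      (modelWithCornersSelf ℝ (Euc N)) (fun x => convex_forall_inner_pos _) hloc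
    exact ⟨g, g.contMDiff.contDiff, fun x hx ν hν => hg x ν ⟨hx, hν⟩⟩
  by_cases hx : x ∈ frontier S
  · obtain ⟨-, W, ψ, hWo, hxW, hψ, hψ0, hgr, hψS, -⟩ := h x hx
    refine ⟨gradient ψ x, ?_⟩
    have hcont : ContinuousAt (gradient ψ) x := by
      have h1 := (hψ.continuousOn_fderiv_of_isOpen hWo le_rfl).continuousAt (hWo.mem_nhds hxW)
      exact (InnerProductSpace.toDual ℝ (Euc N)).symm.continuous.continuousAt.comp h1
    have hpos : ∀ᶠ y in 𝓝 x, 0 < inner ℝ (gradient ψ y) (gradient ψ x) := by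
      have : ContinuousAt (fun y => inner ℝ (gradient ψ y) (gradient ψ x)) x :=
        hcont.inner continuousAt_const
      exact this.eventually (lt_mem_nhds (real_inner_self_pos.2 hgr))
    filter_upwards [hpos, hWo.mem_nhds hxW] with y hy hyW ν ⟨hyS, hν⟩
    have hne : gradient ψ y ≠ 0 := fun h0 => by simp [h0] at hy
    have hψy : ψ y = 0 := by
      refine le_antisymm ?_ (not_lt.1 fun hlt => ?_)
      · have hcl : y ∈ closure (W ∩ S) := hWo.inter_closure ⟨hyW, hyS.1⟩
        by_contra hlt
        have hev : ∀ᶠ z in 𝓝 y, 0 < ψ z :=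
          (hψ.continuousOn.continuousAt (hWo.mem_nhds hyW)).eventually (lt_mem_nhds (not_le.1 hlt))
        obtain ⟨z, hz1, hz2⟩ := (mem_closure_iff_frequently.1 hcl).and_eventually hev |>.exists
        exact ((hψS z hz1.1).1 hz1.2).not_gt hz2
      · have := (hψS y hyW).2 hlt
        rw [hS.frontier_eq] at hyS
        exact hyS.2 this
    have hn : IsOutwardNormal S y (‖gradient ψ y‖⁻¹ • gradient ψ y) :=
      ⟨W, ψ, hWo, hyW, hψ, hψy, hne, hψS, rfl⟩
    refine hn.inner_pos hν ?_
    rw [real_inner_smul_left]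
    have := norm_pos_iff.2 hne
    positivity
  · refine ⟨0, ?_⟩
    filter_upwards [isClosed_frontier.isOpen_compl.mem_nhds hx] with y hy ν hν
    exact (hy hν.1).elim

end Normal

end

/-! ### The descent inequality -/

section

section Descent

variable {N : ℕ} {μ : Measure (Euc N)} {S D : Set (Euc N)} {v : Euc N → ℝ} {G : Euc N → Euc N}

lemma shapeGrad_add_smul (hS : Bornology.IsBounded S) (hv : MemLp v 2 volume)
    (hG : MemLp G 2 volume) {Y Z : Euc N → Euc N} (hY : ContDiff ℝ 1 Y) (hYc : HasCompactSupport Y)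
    (hZ : ContDiff ℝ 1 Z) (hZc : HasCompactSupport Z) (c : ℝ) :
    shapeGrad S v G (fun x => Y x + c • Z x) = shapeGrad S v G Y + c * shapeGrad S v G Z := by
  obtain ⟨L, hL⟩ := hY.lipschitzWith_of_hasCompactSupport hYc one_ne_zero
  obtain ⟨L', hL'⟩ := hZ.lipschitzWith_of_hasCompactSupport hZc one_ne_zero
  rw [shapeGrad, shapeGrad, shapeGrad, ← integral_const_mul, ← integral_add
    (integrableOn_shapeGrad hS hv hG hY fun x => norm_fderiv_le_of_lipschitz ℝ hL)
    ((integrableOn_shapeGrad hS hv hG hZ fun x => norm_fderiv_le_of_lipschitz ℝ hL').const_mul c)]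
  refine integral_congr_ae (Eventually.of_forall fun x => ?_)
  have e : fderiv ℝ (fun x => Y x + c • Z x) x = fderiv ℝ Y x + c • fderiv ℝ Z x :=
    ((hY.differentiable one_ne_zero x).hasFDerivAt.add
      ((hZ.differentiable one_ne_zero x).hasFDerivAt.const_smul c)).fderiv
  simp only [e, trace_add, trace_smul, add_apply, smul_apply, inner_add_left,
    real_inner_smul_left]
  ring

lemma nonpos_of_hasDerivAt {f : ℝ → ℝ} {d : ℝ} (h : HasDerivAt f d 0)
    (hf : ∀ᶠ t in 𝓝[>] (0 : ℝ), f t ≤ f 0) : d ≤ 0 := by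
  have ht := h.hasDerivWithinAt (s := Ioi 0)
  rw [hasDerivWithinAt_iff_tendsto_slope' (by simp)] at ht
  refine le_of_tendsto ht ?_
  filter_upwards [hf, self_mem_nhdsWithin] with t h1 h2
  have h2 : 0 < t := h2
  rw [slope_def_field]
  exact div_nonpos_of_nonpos_of_nonneg (by linarith) (by linarith)

/-- A time step uniform over all base points comes from compactness of the support of `Y`. Frontier
points are covered by the hypothesis, exterior points by continuity, and points off the support do
not move. -/
lemma eventually_forall_add_smul_notMem (hS : IsOpen S) {Y : Euc N → Euc N} (hY : Continuous Y)
    (hYc : HasCompactSupport Y)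
    (h : ∀ x ∈ frontier S, ∀ᶠ p : Euc N × Euc N × ℝ in 𝓝 x ×ˢ 𝓝 (Y x) ×ˢ 𝓝[≥] 0,
      p.1 ∉ S → p.1 + p.2.2 • p.2.1 ∉ S) :
    ∀ᶠ t in 𝓝[>] (0 : ℝ), ∀ x ∉ S, x + t • Y x ∉ S := by
  have key : ∀ᶠ t in 𝓝 (0 : ℝ), ∀ x ∈ tsupport Y, 0 ≤ t → x ∉ S → x + t • Y x ∉ S := by
    refine hYc.isCompact.eventually_forall_of_forall_eventually fun x _ => ?_
    by_cases hxS : x ∈ S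
    · filter_upwards [(continuous_snd.tendsto ((0 : ℝ), x)).eventually (hS.mem_nhds hxS)]
        with p hp _ hp'
      exact (hp' hp).elim
    by_cases hxc : x ∈ closure S
    · have hf := h x (by rw [hS.frontier_eq]; exact ⟨hxc, hxS⟩)
      have hle : Tendsto (fun p : ℝ × Euc N => (p.2, Y p.2, p.1))
          (𝓝 ((0 : ℝ), x) ⊓ 𝓟 ((Ici 0) ×ˢ univ)) (𝓝 x ×ˢ 𝓝 (Y x) ×ˢ 𝓝[≥] 0) := by
        refine Tendsto.prodMk ?_ (Tendsto.prodMk ?_ ?_)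
        · exact (continuous_snd.tendsto ((0 : ℝ), x)).mono_left inf_le_left
        · exact ((hY.comp continuous_snd).tendsto ((0 : ℝ), x)).mono_left inf_le_left
        · refine tendsto_inf.2 ⟨?_, ?_⟩
          · exact (continuous_fst.tendsto ((0 : ℝ), x)).mono_left inf_le_left
          · exact (tendsto_principal_principal (f := Prod.fst).2 fun p hp => hp.1).mono_left inf_le_right
      have := eventually_inf_principal.1 (hle.eventually hf)
      filter_upwards [this] with p hp h0 hpS
      exact hp ⟨h0, mem_univ _⟩ hpS
    · have hc : Tendsto (fun p : ℝ × Euc N => p.2 + p.1 • Y p.2) (𝓝 ((0 : ℝ), x)) (𝓝 x) := by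
        have : Continuous fun p : ℝ × Euc N => p.2 + p.1 • Y p.2 := by fun_prop
        simpa using this.tendsto ((0 : ℝ), x)
      filter_upwards [hc.eventually (isClosed_closure.isOpen_compl.mem_nhds hxc)] with p hp _ _ hpS
      exact hp (subset_closure hpS)
  filter_upwards [nhdsWithin_le_nhds key, self_mem_nhdsWithin] with t ht h0 x hx
  by_cases hxY : x ∈ tsupport Y
  · exact ht x hxY (le_of_lt h0) hx
  · rwa [image_eq_zero_of_notMem_tsupport hxY, smul_zero, add_zero]

/-- Fields that do not move points of the complement into `S` decrease the energy. -/
lemma shapeGrad_nonpos (hN : 1 ≤ N) [IsFiniteMeasure μ] (hμ : HasFiniteEnergy μ) (hSo : IsOpen S)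
    (hS : Bornology.IsBounded S) (hμS : μ.support ⊆ S) (hv : IsState μ S v G) {Y : Euc N → Euc N}
    (hY : ContDiff ℝ 1 Y) (hYc : HasCompactSupport Y) (hYμ : ∀ x ∈ μ.support, Y x = 0)
    (h : ∀ x ∈ frontier S, ∀ᶠ p : Euc N × Euc N × ℝ in 𝓝 x ×ˢ 𝓝 (Y x) ×ˢ 𝓝[≥] 0,
      p.1 ∉ S → p.1 + p.2.2 • p.2.1 ∉ S) : shapeGrad S v G Y ≤ 0 := by
  obtain ⟨L, hL⟩ := hY.lipschitzWith_of_hasCompactSupport hYc one_ne_zero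
  have hd := hasDerivAt_shapeEnergy hN hμ hSo hS hμS hv hY hYc (R := fun t x => t • Y x)
    (fun t x hx => by simp [hYμ x hx])
    fun ε hε => Eventually.of_forall fun t => ⟨0, by simp; positivity, by simp⟩
  refine nonpos_of_hasDerivAt hd ?_
  have hsmall : ∀ᶠ t in 𝓝 (0 : ℝ), ‖t‖₊ * L ≤ 1 / 2 := by
    have hc : Continuous fun t : ℝ => ‖t‖₊ * L := by fun_prop
    exact ((hc.tendsto' 0 0 (by simp)).eventually_lt_const (by norm_num)).mono fun _ h => h.le
  filter_upwards [eventually_forall_add_smul_notMem hSo hY.continuous hYc h,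
    nhdsWithin_le_nhds hsmall] with t h1 h2
  have hlip : LipschitzWith (‖t‖₊ * L) fun x => t • Y x := (lipschitzWith_smul t).comp hL
  have e0 : (fun x => x + (0 : ℝ) • Y x) '' S = S := by simp
  rw [e0]
  -- The map is onto and no point of the complement enters `S`, so `S` is contained in its image and
  -- the energy can only drop.
  refine shapeEnergy_anti hN hμ (fun z hz => ?_) (isBounded_image_id_add hlip hS)
  obtain ⟨y, rfl⟩ := surjective_id_add hlip h2 z
  exact ⟨y, by_contra fun hy => h1 y hy hz, rfl⟩

lemma nonneg_of_ae_nonneg {A : Set (Euc N)} (hA : IsOpen A) (hv : ContinuousOn v A)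
    (h : ∀ᵐ x ∂(volume.restrict A), 0 ≤ v x) : ∀ x ∈ A, 0 ≤ v x := by
  intro x hx
  by_contra hlt
  have ho : IsOpen (A ∩ v ⁻¹' Iio 0) := hv.isOpen_inter_preimage hA isOpen_Iio
  refine (ho.measure_pos volume ⟨x, hx, not_le.1 hlt⟩).ne' ?_
  rw [ae_restrict_iff' hA.measurableSet] at h
  refine measure_mono_null (fun y hy => ?_) h
  exact fun hy' => (hy' hy.1).not_gt hy.2

/-- The one-sided normal derivative of a nonnegative function that vanishes at the boundary. -/
lemma IsOutwardNormal.normalDeriv_nonpos {x ν : Euc N} (hν : IsOutwardNormal S x ν) {d : ℝ}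
    (hd : HasNormalDeriv v x ν d) {A : Set (Euc N)} (hA : A ∈ 𝓝 x) (hvx : v x = 0)
    (hv : ∀ y ∈ S ∩ A, 0 ≤ v y) : d ≤ 0 := by
  have hν1 : inner ℝ ν (-ν) < 0 := by
    rw [inner_neg_right, real_inner_self_eq_norm_sq, hν.norm_eq_one]; norm_num
  have h1 := hν.eventually_mem hν1
  have h2 : ∀ᶠ s in 𝓝[>] (0 : ℝ), x + s • -ν ∈ A := by
    have hc : Continuous fun s : ℝ => x + s • -ν := by fun_prop
    exact nhdsWithin_le_nhds ((hc.tendsto' 0 x (by simp)).eventually hA)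
  have ht : HasDerivWithinAt (fun s : ℝ => v (x + s • ν)) d (Iio 0) 0 :=
    HasDerivWithinAt.mono hd Iio_subset_Iic_self
  rw [hasDerivWithinAt_iff_tendsto_slope' (by simp)] at ht
  have hneg : Tendsto (fun s : ℝ => -s) (𝓝[>] 0) (𝓝[<] 0) := by
    simpa using tendsto_neg_nhdsGT (a := (0 : ℝ))
  refine le_of_tendsto (ht.comp hneg) ?_
  filter_upwards [h1, h2, self_mem_nhdsWithin] with s h1 h2 h3
  have h3 : 0 < s := h3
  have := hv _ ⟨h1, h2⟩
  simp only [Function.comp_apply, slope_def_field, zero_smul, add_zero, hvx, sub_zero]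
  rw [neg_smul, ← smul_neg]
  exact div_nonpos_of_nonneg_of_nonpos this (by linarith)

/-- A field with `V · n ≥ 0` may be tangent, and then domains need not grow. Adding `ε W` with `W`
strictly outward restores strictness; the first variation is linear in the field, so `ε → 0` gives
the claim. -/
theorem shapeGrad_nonpos_of_inner_nonneg (hN : 1 ≤ N) [IsFiniteMeasure μ]
    (hμ : HasFiniteEnergy μ) (hSo : IsOpen S) (hS : Bornology.IsBounded S) (hμS : μ.support ⊆ S)
    (hS1 : HasC1Boundary S) (hv : IsState μ S v G) (hD : IsOpen D) {V : Euc N → Euc N}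
    (hV : ContDiffOn ℝ 1 V D) (hVν : ∀ x ∈ frontier S, ∀ ν, IsOutwardNormal S x ν →
      0 ≤ inner ℝ (V x) ν) {η : Euc N → ℝ} (hη : IsBoundaryCutoff μ S D η) :
    shapeGrad S v G (fun x => η x • V x) ≤ 0 := by
  obtain ⟨W, hW, hWν⟩ := hS1.exists_outward hSo
  have hY := hη.isTest.contDiff_smul hD hV
  have hZ := hη.isTest.contDiff_smul hD (hW.of_le (by simp)).contDiffOn
  have hYc : HasCompactSupport fun x => η x • V x := hη.isTest.2.1.smul_right
  have hZc : HasCompactSupport fun x => η x • W x := hη.isTest.2.1.smul_right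
  have hη1 : ∀ x ∈ frontier S, η x = 1 := fun x hx => by
    obtain ⟨K, -, hKS, hK⟩ := hη.eq_one
    rw [hSo.frontier_eq] at hx
    exact hK x ⟨hx.1, fun h => hx.2 (hKS h)⟩
  have key : ∀ ε > (0 : ℝ), shapeGrad S v G (fun x => η x • V x) +
      ε * shapeGrad S v G (fun x => η x • W x) ≤ 0 := fun ε hε => by
    rw [← shapeGrad_add_smul hS hv.1.1 hv.1.2.1 hY hYc hZ hZc]
    refine shapeGrad_nonpos hN hμ hSo hS hμS hv (hY.add (hZ.const_smul ε))
      (hYc.add (HasCompactSupport.smul_left (f := fun _ => ε) hZc))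
      (fun x hx => by simp [hη.eq_zero hx]) fun x hx => ?_
    obtain ⟨ν, hν⟩ := hS1 x hx
    refine hν.eventually_notMem ?_
    rw [hη1 x hx, one_smul, one_smul, inner_add_right, real_inner_smul_right]
    have h1 := hVν x hx ν hν
    rw [real_inner_comm] at h1
    have := mul_pos hε (hWν x hx ν hν)
    linarith
  refine le_of_tendsto (x := 𝓝[>] (0 : ℝ)) (f := fun ε => shapeGrad S v G (fun x => η x • V x) +
      ε * shapeGrad S v G (fun x => η x • W x)) ?_ (eventually_mem_nhdsWithin.mono fun ε hε => key ε hε)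
  have hc : Continuous fun ε : ℝ => shapeGrad S v G (fun x => η x • V x) +
      ε * shapeGrad S v G (fun x => η x • W x) := by fun_prop
  exact (hc.tendsto' 0 _ (by simp)).mono_left nhdsWithin_le_nhds

end Descent

end

end QuadDomain

/-! ### The main theorem -/

theorem mainTheorem4 {N : ℕ} (hN : 1 ≤ N)
    (μ : Measure (QuadDomain.Euc N)) [IsFiniteMeasure μ]
    (hμc : IsCompact μ.support) (hμE : QuadDomain.HasFiniteEnergy μ)
    (Ω : Set (QuadDomain.Euc N)) (hΩo : IsOpen Ω) (hΩb : Bornology.IsBounded Ω)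
    (hμΩ : μ.support ⊆ Ω)
    (u : QuadDomain.Euc N → ℝ) (hu : QuadDomain.IsSolutionP μ Ω u) :
    -- the functional `E` is well defined on bounded open sets
    (∀ U : Set (QuadDomain.Euc N), IsOpen U → Bornology.IsBounded U →
      (∃ v G, QuadDomain.IsState μ U v G) ∧
      ∀ v G, QuadDomain.IsState μ U v G →
        QuadDomain.shapeEnergy μ U = QuadDomain.energy μ U v G) ∧
    -- the solution of (P) is the state of `Ω`
    (∃ v G, QuadDomain.IsState μ Ω v G ∧ v =ᵐ[volume] u) ∧
    -- its gradient vanishes on the free boundary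
    (ContDiffOn ℝ 1 u μ.supportᶜ ∧ ∀ x ∈ frontier Ω, gradient u x = 0) ∧
    -- it is a critical point of `E`
    (∀ (D : Set (QuadDomain.Euc N)) (V X : ℝ → QuadDomain.Euc N → QuadDomain.Euc N),
      IsOpen D → closure Ω ⊆ D → QuadDomain.IsVelocityField D V →
      QuadDomain.IsDeformation D V Ω X →
      QuadDomain.HasShapeDeriv (QuadDomain.shapeEnergy μ) Ω X 0) ∧
    -- `dE(S, V) ≤ 0` if `S ⊆ Ω` and `V · n = -∂u_S/∂n` on the boundary of `S`
    (∀ (S : Set (QuadDomain.Euc N)) (v : QuadDomain.Euc N → ℝ)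
      (G : QuadDomain.Euc N → QuadDomain.Euc N) (D : Set (QuadDomain.Euc N))
      (V X : ℝ → QuadDomain.Euc N → QuadDomain.Euc N),
      IsOpen S → S ⊆ Ω → μ.support ⊆ S → QuadDomain.HasC1Boundary S →
      QuadDomain.IsState μ S v G →
      ContinuousOn v (closure S \ μ.support) → (∀ x ∈ frontier S, v x = 0) →
      (∀ᵐ x ∂(volume.restrict S), 0 ≤ v x) →
      IsOpen D → closure S ⊆ D → QuadDomain.IsVelocityField D V →
      QuadDomain.IsDeformation D V S X →
      (∀ x ∈ frontier S, ∀ ν, QuadDomain.IsOutwardNormal S x ν →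
        QuadDomain.HasNormalDeriv v x ν (-(inner ℝ (V 0 x) ν))) →
      ∃ d : ℝ, d ≤ 0 ∧ QuadDomain.HasShapeDeriv (QuadDomain.shapeEnergy μ) S X d) := by
  refine ⟨fun U _ hU => ⟨QuadDomain.exists_isState hN hμE hU, fun v G h =>
    QuadDomain.shapeEnergy_eq hU h⟩, hu.exists_isState hN hμE hμc hΩo hΩb hμΩ,
    ⟨hu.contDiffOn hΩo hΩb, fun x hx => hu.gradient_eq_zero fun h => ?_⟩, ?_, ?_⟩
  · rw [hΩo.frontier_eq] at hx
    exact hx.2 h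
  · intro D V X hD hΩD hV hX
    obtain ⟨v, G, hv, hvu⟩ := hu.exists_isState hN hμE hμc hΩo hΩb hμΩ
    obtain ⟨η, hη⟩ := QuadDomain.exists_isBoundaryCutoff hμc hΩo hΩb hμΩ hD hΩD
    have h := QuadDomain.HasExpansion.hasShapeDeriv hN hμE hΩo hΩb hμΩ hD hΩD hv
      (hX.hasExpansion hV hD hΩb hΩD) (hV.contDiffOn 0) hη
    rwa [hu.shapeGrad_eq_zero hΩo hΩb hv.1 hvu (hη.isTest.contDiff_smul hD (hV.contDiffOn 0))
      hη.isTest.2.1.smul_right (hη.disjoint.mono_left (tsupport_smul_subset_left _ _))] at h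
  · intro S v G D V X hS hSΩ hμS hS1 hv hvc hv0 hvn hD hSD hV hX hn
    have hSb := hΩb.subset hSΩ
    obtain ⟨η, hη⟩ := QuadDomain.exists_isBoundaryCutoff hμc hS hSb hμS hD hSD
    refine ⟨_, ?_, QuadDomain.HasExpansion.hasShapeDeriv hN hμE hS hSb hμS hD hSD hv
      (hX.hasExpansion hV hD hSb hSD) (hV.contDiffOn 0) hη⟩
    have hμo : IsOpen μ.supportᶜ := QuadDomain.isOpen_compl_support
    -- Continuity off the support of `μ` upgrades the sign of the state from almost everywhere to
    -- everywhere, as one-sided difference quotients at the boundary require.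
    have hpos := QuadDomain.nonneg_of_ae_nonneg (A := S ∩ μ.supportᶜ) (hS.inter hμo)
      (hvc.mono fun x hx => ⟨subset_closure hx.1, hx.2⟩)
      (ae_restrict_of_ae_restrict_of_subset inter_subset_left hvn)
    refine QuadDomain.shapeGrad_nonpos_of_inner_nonneg hN hμE hS hSb hμS hS1 hv hD
      (hV.contDiffOn 0) (fun x hx ν hν => ?_) hη
    -- Applied with `∂v/∂ν = -⟨V, ν⟩`, this says that the velocity does not point inward.
    have := hν.normalDeriv_nonpos (hn x hx ν hν)
      (hμo.mem_nhds fun h => hν.notMem (hμS h)) (hv0 x hx) hpos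
    linarith
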